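/- **Notation.** A Bernstein function with characteristics $(a,b,\mu)$ is a function $f(s)=a+bs+\int_{(0,\infty)}(1-e^{-sy})\,\mu(dy)$, $s>0$, where $a,b\ge 0$ and $\mu$ is a measure on $(0,\infty)$ with $\int (1\wedge y)\,\mu(dy)<\infty$. Let $\mathfrak B$ be the set of unbounded Bernstein functions with $a=0$. The measure $\mu$ is sub-homogeneous (resp. super-homogeneous) if for every $\lambda>0$ there is $C(\lambda)>0$ such that $\mu(C(\lambda)x,\infty)\le\lambda\,\mu(x,\infty)$ (resp. $\lambda\,\mu(x,\infty)\le\mu(C(\lambda)x,\infty)$) for all $x>0$. Let $\mathfrak L$ be the set of probability measures on $[0,\infty)$, and write $\hat\nu(s)=\int e^{-sx}\nu(dx)$. For a function $\psi$ let $\mathfrak L_\psi$ be the set of $\nu\in\mathfrak L$ for which there is a function $L$, slowly varying at infinity, with $|\hat\nu(s)-1|/(\psi(s)L(1/s))\to 1$ as $s\to0^+$; $\mathfrak L_s$ is this class for $\psi(s)=s$. For $\psi\in\mathfrak B$ and $\nu\in\mathfrak L$ let $\Phi_\psi(\nu)\in\mathfrak L$ be the measure with Laplace transform $\hat\nu(\psi(s))$,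 and let $\mathfrak L_s^\psi=\Phi_\psi(\mathfrak L_s)$. A random variable is said to be in one of these classes if its law is. The CTRW with space-time jumps $(J_k,W_k)_{k\ge1}$, where the $(J_k,W_k)\in\mathbb R^d\times[0,\infty)$ are i.i.d. ($J_k$ and $W_k$ may be dependent), is $X_t=\sum_{n\ge1}J_n\mathbf 1\{T_n\le t\}$, $T_n=W_1+\dots+W_n$. A subordinator $D$ with symbol $\psi$ is a nondecreasing Lévy process with $\mathbb E e^{-sD_t}=e^{-t\psi(s)}$, and its inverse is $E_t=\inf\{u:D_u>t\}$. The process $(X_{E_t-})^+$ is the right limit in $t$ of $t\mapsto X_{E_t-}$, where $X_{u-}$ is the left limit of $X$ at $u$. For processes with a.s. càdlàg paths, $\overset{J_1}{\sim}$ means equality of the laws on the Borel sets of the Skorokhod $J_1$ topology of $\mathbb D([0,\infty),\mathbb R^d)$. **Proposition.** Let $\psi\in\mathfrak B$ and let $Y$ be a CTRW with i.i.d. space-time jumps $(J_k,W_k^\psi)$. 1. If $W_1^\psi\in\mathfrak L_s^\psi$, then there exist, on some probability space, a CTRW $X$ with i.i.d. space-time jumps $(J'_k,W_k)$, where $W_1\in\mathfrak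 L_s$, and an inverse $E$ of a subordinator with symbol $\psi$, independent of $\{W_k\}$, such that $Y_t\overset{J_1}{\sim}(X_{E_t-})^+$. 2. Conversely, suppose that $W_1^\psi\in\mathfrak L_\psi$ and that $Y_t\overset{J_1}{\sim}(X_{E_t-})^+$, where $X$ is a CTRW with i.i.d. space-time jumps $(J'_k,W_k)$, $W_k>0$ a.s., and $E$ is the inverse of a subordinator with symbol $\psi$, independent of $\{W_k\}$. Suppose that the spatial jumps are real jumps, i.e. $J_1\ne0$ a.s. and $J'_1\neq 0$ a.s., and that $\psi$ has characteristics $(0,b,\mu)$ with $\mu$ sub-homogeneous or super-homogeneous. Then $W_1^\psi\in\mathfrak L_s^\psi$ and $W_1\in\mathfrak L_s$. -/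

import Mathlib

open MeasureTheory ProbabilityTheory Filter Topology
open scoped NNReal ENNReal

namespace CTRW

noncomputable section

/-! ### Bernstein functions -/

/-- `f` is, on `(0, ∞)`, the Bernstein function with characteristics `(a, b, μ)`:
`f s = a + b s + ∫ (1 - e^{-s y}) μ(dy)`, where `a, b ≥ 0` and `μ` is a measure on `(0, ∞)`
with `∫ min(1, y) μ(dy) < ∞`. -/
structure HasCharacteristics (f : ℝ → ℝ) (a b : ℝ) (μ : Measure ℝ) : Prop where
  a_nonneg : 0 ≤ a
  b_nonneg : 0 ≤ b
  concentrated : μ (Set.Iic 0) = 0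
  integrable : ∫⁻ y, ENNReal.ofReal (min 1 y) ∂μ < ∞
  eq : ∀ s : ℝ, 0 < s → f s = a + b * s + ∫ y, (1 - Real.exp (-(s * y))) ∂μ

/-- The class `𝔅` of unbounded Bernstein functions with characteristics `(0, b, μ)`. -/
def unboundedBernstein : Set (ℝ → ℝ) :=
  {ψ | (∃ (b : ℝ) (μ : Measure ℝ), HasCharacteristics ψ 0 b μ) ∧ ¬ BddAbove (ψ '' Set.Ioi 0)}

/-- Sub-homogeneous measures on `(0, ∞)`. -/
def SubHomogeneous (μ : Measure ℝ) : Prop :=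
  ∀ l : ℝ, 0 < l → ∃ C : ℝ, 0 < C ∧
    ∀ x : ℝ, 0 < x → μ (Set.Ioi (C * x)) ≤ ENNReal.ofReal l * μ (Set.Ioi x)

/-- Super-homogeneous measures on `(0, ∞)`. -/
def SuperHomogeneous (μ : Measure ℝ) : Prop :=
  ∀ l : ℝ, 0 < l → ∃ C : ℝ, 0 < C ∧
    ∀ x : ℝ, 0 < x → ENNReal.ofReal l * μ (Set.Ioi x) ≤ μ (Set.Ioi (C * x))

/-! ### Classes of waiting time distributions -/

/-- The Laplace transform of a measure. -/
def laplace (ν : Measure ℝ) (s : ℝ) : ℝ := ∫ x, Real.exp (-(s * x)) ∂ν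

/-- `L` is slowly varying at infinity. -/
def SlowlyVarying (L : ℝ → ℝ) : Prop :=
  ∀ l : ℝ, 0 < l → Tendsto (fun x => L (l * x) / L x) atTop (𝓝 1)

/-- The class `𝔏` of probability measures on `[0, ∞)`. -/
def probHalfLine : Set (Measure ℝ) :=
  {ν | IsProbabilityMeasure ν ∧ ν (Set.Iio 0) = 0}

/-- The class `𝔏_ψ`: the Laplace transform is `∼ 1 - ψ(s) L(1/s)` as `s → 0+`, for some slowly
varying `L`. The class `𝔏_s` is `layer id`. -/
def layer (ψ : ℝ → ℝ) : Set (Measure ℝ) :=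
  {ν | ν ∈ probHalfLine ∧ ∃ L : ℝ → ℝ, SlowlyVarying L ∧
    Tendsto (fun s => |laplace ν s - 1| / (ψ s * L s⁻¹)) (𝓝[>] 0) (𝓝 1)}

/-- `ρ = Φ_ψ(ν)`: the Laplace transform of `ρ` is that of `ν` composed with `ψ`. -/
def IsPhi (ψ : ℝ → ℝ) (ν ρ : Measure ℝ) : Prop :=
  ν ∈ probHalfLine ∧ ρ ∈ probHalfLine ∧ ∀ s : ℝ, 0 < s → laplace ρ s = laplace ν (ψ s)

/-- The class `𝔏_{ψ₁}^{ψ₂}`, the image of `𝔏_{ψ₁}` under `Φ_{ψ₂}`.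
The class `𝔏_s^ψ` is `layerImage id ψ`. -/
def layerImage (ψ₁ ψ₂ : ℝ → ℝ) : Set (Measure ℝ) :=
  {ρ | ∃ ν ∈ layer ψ₁, IsPhi ψ₂ ν ρ}

/-! ### The Skorokhod space and the `J₁` topology -/

/-- Right continuity with left limits, on `[0, ∞)`. -/
def IsCadlag {E : Type*} [TopologicalSpace E] (f : ℝ≥0 → E) : Prop :=
  ∀ t, ContinuousWithinAt f (Set.Ici t) t ∧ ∃ l, Tendsto f (𝓝[<] t) (𝓝 l)

/-- The space `𝔻[0, ∞)` of càdlàg functions with values in `E`. -/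
def Skorokhod (E : Type*) [TopologicalSpace E] : Type _ := {f : ℝ≥0 → E // IsCadlag f}

variable {E : Type*} [NormedAddCommGroup E]

/-- The basic `J₁` neighbourhood of `f`: the functions `g` for which some increasing homeomorphism
`τ` of `[0, ∞)` is `ε`-close to the identity, and `g ∘ τ` is `ε`-close to `f` on `[0, 1/ε]`. -/
def Skorokhod.nbhd (f : Skorokhod E) (ε : ℝ) : Set (Skorokhod E) :=
  {g | ∃ τ : ℝ≥0 ≃o ℝ≥0, (∀ t, dist (τ t) t < ε) ∧
    ∀ t : ℝ≥0, (t : ℝ) ≤ 1 / ε → ‖g.1 (τ t) - f.1 t‖ < ε}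

theorem Skorokhod.nbhd_mono (f : Skorokhod E) {δ ε : ℝ} (hδ : 0 < δ) (h : δ ≤ ε) :
    f.nbhd δ ⊆ f.nbhd ε := by
  rintro g ⟨τ, h1, h2⟩
  exact ⟨τ, fun t => (h1 t).trans_le h, fun t ht =>
    (h2 t (ht.trans (one_div_le_one_div_of_le hδ h))).trans_le h⟩

/-- The `J₁` topology on `𝔻[0, ∞)`. A sequence `fₙ` converges to `f` in it if and only if there are
increasing homeomorphisms `τₙ` of `[0, ∞)` such that `τₙ` tends to the identity uniformly and
`fₙ ∘ τₙ` tends to `f` uniformly on every `[0, T]`. -/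
instance Skorokhod.instTopologicalSpace : TopologicalSpace (Skorokhod E) where
  IsOpen U := ∀ f ∈ U, ∃ ε : ℝ, 0 < ε ∧ f.nbhd ε ⊆ U
  isOpen_univ := fun _ _ => ⟨1, one_pos, Set.subset_univ _⟩
  isOpen_inter := by
    rintro U V hU hV f ⟨hfU, hfV⟩
    obtain ⟨ε, hε, h1⟩ := hU f hfU
    obtain ⟨δ, hδ, h2⟩ := hV f hfV
    exact ⟨min ε δ, lt_min hε hδ, Set.subset_inter
      ((f.nbhd_mono (lt_min hε hδ) (min_le_left _ _)).trans h1)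
      ((f.nbhd_mono (lt_min hε hδ) (min_le_right _ _)).trans h2)⟩
  isOpen_sUnion := by
    rintro S hS f ⟨U, hU, hfU⟩
    obtain ⟨ε, hε, h⟩ := hS U hU f hfU
    exact ⟨ε, hε, h.trans (Set.subset_sUnion_of_mem hU)⟩

instance Skorokhod.instMeasurableSpace : MeasurableSpace (Skorokhod E) := borel _

instance Skorokhod.instBorelSpace : BorelSpace (Skorokhod E) := ⟨rfl⟩

/-- The process `Z` has almost surely paths in `𝔻[0, ∞)`, and its law on the Borel sets of the
`J₁` topology is `Q`. -/
def HasJ1Law {Ω : Type*} [MeasurableSpace Ω] (Z : ℝ≥0 → Ω → E) (Q : Measure (Skorokhod E))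
    (P : Measure Ω) : Prop :=
  ∃ z : Ω → Skorokhod E, HasLaw z Q P ∧ ∀ᵐ ω ∂P, ∀ t, (z ω).1 t = Z t ω

/-- Two processes, possibly on different probability spaces, have the same `J₁` law. -/
def SameJ1Law {Ω Ω' : Type*} [MeasurableSpace Ω] [MeasurableSpace Ω']
    (Z : ℝ≥0 → Ω → E) (P : Measure Ω) (Z' : ℝ≥0 → Ω' → E) (P' : Measure Ω') : Prop :=
  ∃ Q : Measure (Skorokhod E), HasJ1Law Z Q P ∧ HasJ1Law Z' Q P'

/-! ### Continuous time random walks, subordinators, time change -/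

/-- The space-time jumps `(J k, W k)`, `k = 0, 1, …`, are i.i.d.; `J k` and `W k` of the same index
may be dependent. -/
structure IsIIDJumps {Ω : Type*} [MeasurableSpace Ω] [MeasurableSpace E]
    (J : ℕ → Ω → E) (W : ℕ → Ω → ℝ) (P : Measure Ω) : Prop where
  measurable_jump : ∀ k, Measurable (J k)
  measurable_wait : ∀ k, Measurable (W k)
  indep : iIndepFun (fun k ω => (J k ω, W k ω)) P
  identDistrib : ∀ k, IdentDistrib (fun ω => (J k ω, W k ω)) (fun ω => (J 0 ω, W 0 ω)) P P

/-- The time `W 0 + ⋯ + W n` of the jump `J n`. -/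
def jumpTime {Ω : Type*} (W : ℕ → Ω → ℝ) (n : ℕ) (ω : Ω) : ℝ :=
  ∑ i ∈ Finset.range (n + 1), W i ω

/-- The CTRW with space-time jumps `(J k, W k)`: the sum of the jumps whose time is at most `t`. -/
def ctrw {Ω : Type*} (J : ℕ → Ω → E) (W : ℕ → Ω → ℝ) (t : ℝ≥0) (ω : Ω) : E :=
  ∑' n, Set.indicator (Set.Ici (jumpTime W n ω)) (fun _ => J n ω) (t : ℝ)

/-- `D` is a subordinator with symbol `ψ`: a Lévy process with nondecreasing paths and
`𝔼 e^{-s D_t} = e^{-t ψ(s)}`. -/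
structure IsSubordinator {Ω : Type*} [MeasurableSpace Ω] (ψ : ℝ → ℝ) (D : ℝ≥0 → Ω → ℝ)
    (P : Measure Ω) : Prop where
  measurable : ∀ t, Measurable (D t)
  zero : ∀ᵐ ω ∂P, D 0 ω = 0
  paths : ∀ᵐ ω ∂P, Monotone (fun t => D t ω) ∧ IsCadlag (fun t => D t ω)
  indepIncrements : HasIndepIncrements D P
  stationary : ∀ t h, IdentDistrib (fun ω => D (t + h) ω - D t ω) (D h) P P
  laplace_eq : ∀ (t : ℝ≥0) (s : ℝ), 0 < s →
    ∫ ω, Real.exp (-(s * D t ω)) ∂P = Real.exp (-(t * ψ s))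

/-- `T` is the inverse `T_t = inf {u : D_u > t}` of a subordinator `D` with symbol `ψ`. -/
def IsInverseSubordinator {Ω : Type*} [MeasurableSpace Ω] (ψ : ℝ → ℝ) (T : ℝ≥0 → Ω → ℝ≥0)
    (P : Measure Ω) : Prop :=
  (∀ t, Measurable (T t)) ∧ ∃ D : ℝ≥0 → Ω → ℝ, IsSubordinator ψ D P ∧
    ∀ᵐ ω ∂P, ∀ t : ℝ≥0, T t ω = sInf {u : ℝ≥0 | (t : ℝ) < D u ω}

/-- The process `(X_{T_t -})^+`: first the left limit of `X` is taken and evaluated at `T_t`, and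
then the right limit in `t`. -/
def timeChange {Ω : Type*} (X : ℝ≥0 → Ω → E) (T : ℝ≥0 → Ω → ℝ≥0) (t : ℝ≥0) (ω : Ω) : E :=
  Function.rightLim (fun r => Function.leftLim (fun v => X v ω) (T r ω)) t

end

end CTRW

namespace CTRW

/-!
Two facts drive both directions. First, if a walk `X` has nonnegative waiting times and `T` is the
inverse of a subordinator `D`, then `(X_{T-})^+` is the walk with the jumps of `X` and with the
increments of `D` along the jump times of `X` as waiting times. Secondly, conditioning on an
independent `W` turns `𝔼 e^{-s D_W}` into the Laplace transform of `W` at `ψ s`, so that `D_W` has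
the law `Φ_ψ` of the law of `W`.

Existence: for the independent product of a subordinator and i.i.d. steps `W_k` with law `ν`, the
increments of `D` along the partial sums are i.i.d. with law `Φ_ψ(ν)`, and each spatial jump is
drawn from the conditional law of `J₁` given the waiting time `W₁^ψ`. The subordinator is a drift
plus the sum of the jumps given by a Poisson process of pairs (time, size) with intensity `dt ⊗ μ`:
this σ-finite measure is a countable sum of finite measures, each of which gives a Poisson number of
i.i.d. points.

Converse: when the jumps do not vanish, the time at which a path first leaves `0` is a functional of
the path, measurable for `J₁`, whose values for the two processes are `W₁^ψ` and `D_{W₁}`; hence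
`W₁^ψ` has the law `ρ = Φ_ψ(ν)`, with `ν` the law of `W₁`, and `1 - ν̂(ψ(s)) = 1 - ρ̂(s)`. It
remains to undo the change of variable `u = ψ(s)` in a slowly varying function. Sub- or
super-homogeneity of `μ` makes `ψ(C s)` exceed any prescribed multiple of `ψ(s)` for a suitable
constant `C`, and a monotone function squeezed between slowly varying bounds is slowly varying.
-/

/-! ### Laplace exponents -/

/-- A Lévy measure on `[0, ∞)`, in the sense needed to define its Laplace exponent. Mass at `0` is
allowed, as it does not contribute, so that every probability measure on `[0, ∞)` is included. -/
structure IsLevyMeasure (μ : Measure ℝ) : Prop where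
  ae_nonneg : ∀ᵐ y ∂μ, 0 ≤ y
  integrable_min : Integrable (fun y : ℝ => min 1 y) μ

/-- The Laplace exponent `s ↦ ∫ (1 - e^{-s y}) μ(dy)` of `μ`: the Bernstein function with
characteristics `(0, 0, μ)`. -/
noncomputable def laplaceExponent (μ : Measure ℝ) (s : ℝ) : ℝ := ∫ y, (1 - Real.exp (-(s * y))) ∂μ

theorem one_sub_exp_neg_nonneg {x : ℝ} (hx : 0 ≤ x) : 0 ≤ 1 - Real.exp (-x) :=
  sub_nonneg.2 (Real.exp_le_one_iff.2 (neg_nonpos.2 hx))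

theorem one_sub_exp_neg_mul_le {s y : ℝ} (hy : 0 ≤ y) :
    1 - Real.exp (-(s * y)) ≤ max 1 s * min 1 y := by
  rcases le_total y 1 with h | h
  · rw [min_eq_right h]
    calc 1 - Real.exp (-(s * y)) ≤ s * y := by linarith [Real.add_one_le_exp (-(s * y))]
      _ ≤ max 1 s * y := by gcongr; exact le_max_right _ _
  · rw [min_eq_left h, mul_one]
    exact (sub_le_self _ (Real.exp_pos _).le).trans (le_max_left _ _)

theorem mul_one_sub_exp_neg_le {c x : ℝ} (hc : 0 ≤ c) (hc1 : c ≤ 1) :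
    c * (1 - Real.exp (-x)) ≤ 1 - Real.exp (-(c * x)) := by
  have h := convexOn_exp.2 (Set.mem_univ (-x)) (Set.mem_univ 0) hc (sub_nonneg.2 hc1)
    (add_sub_cancel c 1)
  simp only [smul_eq_mul, mul_zero, add_zero, Real.exp_zero, mul_one, mul_neg] at h
  linarith

namespace IsLevyMeasure

variable {μ : Measure ℝ}

theorem of_mem_probHalfLine (h : μ ∈ probHalfLine) : IsLevyMeasure μ := by
  have := h.1
  have hnn : ∀ᵐ y ∂μ, 0 ≤ y := by simpa [ae_iff, Set.Iio_def] using h.2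
  refine ⟨hnn, Integrable.of_bound (by fun_prop) 1 ?_⟩
  filter_upwards [hnn] with y hy
  rw [Real.norm_of_nonneg (le_min zero_le_one hy)]
  exact min_le_left 1 y

theorem ae_one_sub_exp_nonneg (h : IsLevyMeasure μ) {s : ℝ} (hs : 0 ≤ s) :
    0 ≤ᵐ[μ] fun y => 1 - Real.exp (-(s * y)) := by
  filter_upwards [h.ae_nonneg] with y hy
  exact one_sub_exp_neg_nonneg (mul_nonneg hs hy)

theorem ae_norm_one_sub_exp_le (h : IsLevyMeasure μ) {s c : ℝ} (hs : 0 ≤ s) (hc : 1 ≤ c)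
    (hsc : s ≤ c) : ∀ᵐ y ∂μ, ‖1 - Real.exp (-(s * y))‖ ≤ c * min 1 y := by
  filter_upwards [h.ae_nonneg] with y hy
  rw [Real.norm_of_nonneg (one_sub_exp_neg_nonneg (mul_nonneg hs hy))]
  refine (one_sub_exp_neg_mul_le hy).trans ?_
  gcongr
  exact max_le hc hsc

theorem integrable_one_sub_exp (h : IsLevyMeasure μ) {s : ℝ} (hs : 0 ≤ s) :
    Integrable (fun y => 1 - Real.exp (-(s * y))) μ :=
  (h.integrable_min.const_mul (max 1 s)).mono' (by fun_prop)
    (h.ae_norm_one_sub_exp_le hs (le_max_left _ _) (le_max_right _ _))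

theorem laplaceExponent_nonneg (h : IsLevyMeasure μ) {s : ℝ} (hs : 0 ≤ s) :
    0 ≤ laplaceExponent μ s :=
  integral_nonneg_of_ae (h.ae_one_sub_exp_nonneg hs)

theorem laplaceExponent_pos (h : IsLevyMeasure μ) (h0 : μ (Set.Ioi 0) ≠ 0) {s : ℝ} (hs : 0 < s) :
    0 < laplaceExponent μ s := by
  refine (integral_pos_iff_support_of_nonneg_ae (h.ae_one_sub_exp_nonneg hs.le)
    (h.integrable_one_sub_exp hs.le)).2 ((pos_iff_ne_zero.2 h0).trans_le (measure_mono ?_))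
  intro y (hy : 0 < y)
  have : Real.exp (-(s * y)) < 1 := Real.exp_lt_one_iff.2 (neg_neg_of_pos (mul_pos hs hy))
  exact (sub_pos.2 this).ne'

theorem laplaceExponent_eq_zero (h : IsLevyMeasure μ) (h0 : μ (Set.Ioi 0) = 0) (s : ℝ) :
    laplaceExponent μ s = 0 := by
  refine integral_eq_zero_of_ae ?_
  filter_upwards [h.ae_nonneg, measure_eq_zero_iff_ae_notMem.1 h0] with y hy hy'
  simp [le_antisymm (not_lt.1 hy') hy]

theorem laplaceExponent_eq_zero_iff (h : IsLevyMeasure μ) {s : ℝ} (hs : 0 < s) :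
    laplaceExponent μ s = 0 ↔ μ (Set.Ioi 0) = 0 :=
  ⟨fun h0 => by_contra fun hμ => (h.laplaceExponent_pos hμ hs).ne' h0,
    fun h0 => h.laplaceExponent_eq_zero h0 s⟩

theorem monotoneOn_laplaceExponent (h : IsLevyMeasure μ) :
    MonotoneOn (laplaceExponent μ) (Set.Ici 0) := by
  intro s hs t ht hst
  refine integral_mono_ae (h.integrable_one_sub_exp hs) (h.integrable_one_sub_exp ht) ?_
  filter_upwards [h.ae_nonneg] with y hy
  gcongr

theorem antitoneOn_laplaceExponent_div (h : IsLevyMeasure μ) :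
    AntitoneOn (fun s => laplaceExponent μ s / s) (Set.Ioi 0) := by
  intro s (hs : 0 < s) t (ht : 0 < t) hst
  have hle : s / t * laplaceExponent μ t ≤ laplaceExponent μ s := by
    rw [laplaceExponent, ← integral_const_mul]
    refine integral_mono ((h.integrable_one_sub_exp ht.le).const_mul _)
      (h.integrable_one_sub_exp hs.le) fun y => ?_
    simpa only [← mul_assoc, div_mul_cancel₀ s ht.ne'] using
      mul_one_sub_exp_neg_le (x := t * y) (div_nonneg hs.le ht.le) ((div_le_one ht).2 hst)
  rw [div_le_div_iff₀ ht hs]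
  rw [div_mul_eq_mul_div, div_le_iff₀ ht] at hle
  linarith

theorem continuousOn_laplaceExponent (h : IsLevyMeasure μ) :
    ContinuousOn (laplaceExponent μ) (Set.Ici 0) := by
  intro s (hs : 0 ≤ s)
  refine continuousWithinAt_of_dominated (bound := fun y => (s + 1) * min 1 y)
    (Eventually.of_forall fun t => by fun_prop) ?_ (h.integrable_min.const_mul _)
    (ae_of_all _ fun y => by fun_prop)
  filter_upwards [self_mem_nhdsWithin,
    mem_nhdsWithin_of_mem_nhds (Iio_mem_nhds (lt_add_one s))] with t (ht : 0 ≤ t) (hts : t < s + 1)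
  exact h.ae_norm_one_sub_exp_le ht (by linarith) hts.le

/-- Layer cake: `1 - e^{-s y}` is the mass of `[0, s y)` under the exponential law. -/
theorem ofReal_laplaceExponent (h : IsLevyMeasure μ) {s : ℝ} (hs : 0 < s) :
    ENNReal.ofReal (laplaceExponent μ s)
      = ∫⁻ x in Set.Ioi (0 : ℝ), μ (Set.Ioi (x / s)) * ENNReal.ofReal (Real.exp (-x)) := by
  have hcake := lintegral_comp_eq_lintegral_meas_lt_mul μ (f := fun y => s * y)
    (g := fun x => Real.exp (-x)) (h.ae_nonneg.mono fun y hy => mul_nonneg hs.le hy)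
    (by fun_prop) (fun t _ => Continuous.intervalIntegrable (by fun_prop) 0 t)
    (ae_of_all _ fun x => (Real.exp_pos _).le)
  have hset (x : ℝ) : {y : ℝ | x < s * y} = Set.Ioi (x / s) := by
    ext y
    simp [div_lt_iff₀' hs]
  have hexp (y : ℝ) : ∫ x in (0 : ℝ)..y, Real.exp (-x) = 1 - Real.exp (-y) := by simp
  simp only [hexp, hset] at hcake
  rw [laplaceExponent, ofReal_integral_eq_lintegral_ofReal (h.integrable_one_sub_exp hs.le)
    (h.ae_one_sub_exp_nonneg hs.le), hcake]

theorem mul_laplaceExponent_le (h : IsLevyMeasure μ) {l c : ℝ} (hl : 0 ≤ l) (hc : 0 < c)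
    (htail : ∀ x : ℝ, 0 < x → ENNReal.ofReal l * μ (Set.Ioi x) ≤ μ (Set.Ioi (x / c))) {s : ℝ}
    (hs : 0 < s) : l * laplaceExponent μ s ≤ laplaceExponent μ (c * s) := by
  have hcs : 0 < c * s := mul_pos hc hs
  rw [← ENNReal.ofReal_le_ofReal_iff (h.laplaceExponent_nonneg hcs.le), ENNReal.ofReal_mul hl,
    h.ofReal_laplaceExponent hs, h.ofReal_laplaceExponent hcs,
    ← lintegral_const_mul' _ _ ENNReal.ofReal_ne_top]
  refine setLIntegral_mono' measurableSet_Ioi fun x (hx : 0 < x) => ?_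
  rw [← mul_assoc, mul_comm c s, ← div_div]
  gcongr
  exact htail _ (div_pos hx hs)

end IsLevyMeasure

theorem exists_mul_tail_le {μ : Measure ℝ} (hμ : SubHomogeneous μ ∨ SuperHomogeneous μ) {l : ℝ}
    (hl : 0 < l) : ∃ c : ℝ, 0 < c ∧
      ∀ x : ℝ, 0 < x → ENNReal.ofReal l * μ (Set.Ioi x) ≤ μ (Set.Ioi (x / c)) := by
  rcases hμ with hμ | hμ
  · obtain ⟨C, hC, htail⟩ := hμ l⁻¹ (inv_pos.2 hl)
    refine ⟨C, hC, fun x hx => ?_⟩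
    have hx' := htail (x / C) (div_pos hx hC)
    calc ENNReal.ofReal l * μ (Set.Ioi x)
        ≤ ENNReal.ofReal l * (ENNReal.ofReal l⁻¹ * μ (Set.Ioi (x / C))) := by
          gcongr
          rwa [mul_div_cancel₀ x hC.ne'] at hx'
      _ = μ (Set.Ioi (x / C)) := by
          rw [← mul_assoc, ← ENNReal.ofReal_mul hl.le, mul_inv_cancel₀ hl.ne', ENNReal.ofReal_one,
            one_mul]
  · obtain ⟨C, hC, htail⟩ := hμ l hl
    exact ⟨C⁻¹, inv_pos.2 hC, fun x hx => by simpa [mul_comm] using htail x hx⟩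

/-! ### Laplace transforms of probability measures on the half line -/

/-- The powers of `e` span a star subalgebra of bounded continuous functions separating points. -/
theorem ext_of_integral_pow_eq {X : Type*} [TopologicalSpace X] [PolishSpace X]
    [MeasurableSpace X] [BorelSpace X] {ν ρ : Measure X} [IsFiniteMeasure ν] [IsFiniteMeasure ρ]
    (e : BoundedContinuousFunction X ℝ) (he : Function.Injective e)
    (h : ∀ n : ℕ, ∫ x, e x ^ n ∂ν = ∫ x, e x ^ n ∂ρ) : ν = ρ := by
  refine ext_of_forall_mem_subalgebra_integral_eq_of_polish (𝕜 := ℝ)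
    (A := StarAlgebra.adjoin ℝ {e}) ?_ fun g hg => ?_
  · intro x y hxy
    refine ⟨_, ⟨_, ⟨e, StarAlgebra.self_mem_adjoin_singleton ℝ e, rfl⟩, rfl⟩, he.ne hxy⟩
  · have hstar : star e = e := by ext; simp
    have hg' : g ∈ Algebra.adjoin ℝ {e} := by
      have := StarSubalgebra.mem_toSubalgebra.2 hg
      rwa [StarAlgebra.adjoin_toSubalgebra, Set.star_singleton, hstar, Set.union_self] at this
    rw [Algebra.adjoin_singleton_eq_range_aeval] at hg'
    obtain ⟨p, rfl⟩ := hg'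
    have hp (x : X) : (Polynomial.aeval e p) x
        = ∑ i ∈ Finset.range (p.natDegree + 1), p.coeff i * e x ^ i := by
      simp [Polynomial.aeval_eq_sum_range, BoundedContinuousFunction.sum_apply]
    have hint (m : Measure X) [IsFiniteMeasure m] (i : ℕ) : Integrable (fun x => e x ^ i) m :=
      (e ^ i).integrable m
    change ∫ x, (Polynomial.aeval e p) x ∂ν = ∫ x, (Polynomial.aeval e p) x ∂ρ
    simp only [hp]
    rw [integral_finsetSum _ fun i _ => (hint ν i).const_mul _,
      integral_finsetSum _ fun i _ => (hint ρ i).const_mul _]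
    simp only [integral_const_mul, h]

theorem map_coe_map_toNNReal {ν : Measure ℝ} (hν : ∀ᵐ x ∂ν, 0 ≤ x) :
    (ν.map Real.toNNReal).map ((↑) : ℝ≥0 → ℝ) = ν := by
  rw [Measure.map_map (by fun_prop) (by fun_prop)]
  exact (Measure.map_congr (hν.mono fun x hx => Real.coe_toNNReal x hx)).trans Measure.map_id

theorem measurePreserving_coe_map_toNNReal {ν : Measure ℝ} (hν : ν ∈ probHalfLine) :
    MeasurePreserving ((↑) : ℝ≥0 → ℝ) (ν.map Real.toNNReal) ν :=
  ⟨by fun_prop, map_coe_map_toNNReal (IsLevyMeasure.of_mem_probHalfLine hν).ae_nonneg⟩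

theorem ext_of_laplace {ν ρ : Measure ℝ} (hν : ν ∈ probHalfLine) (hρ : ρ ∈ probHalfLine)
    (h : ∀ s : ℝ, 0 < s → laplace ν s = laplace ρ s) : ν = ρ := by
  have := hν.1
  have := hρ.1
  have hν0 := (measurePreserving_coe_map_toNNReal hν).map_eq
  have hρ0 := (measurePreserving_coe_map_toNNReal hρ).map_eq
  have hexp_le (x : ℝ≥0) : ‖Real.exp (-x)‖ ≤ 1 := by simp
  let e : BoundedContinuousFunction ℝ≥0 ℝ :=
    .ofNormedAddCommGroup (fun x => Real.exp (-x)) (by fun_prop) 1 hexp_le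
  have he : Function.Injective e := fun x y hxy =>
    NNReal.coe_injective (neg_injective (Real.exp_injective hxy))
  have hmoment (m : Measure ℝ) (hm : (m.map Real.toNNReal).map ((↑) : ℝ≥0 → ℝ) = m) (n : ℕ) :
      ∫ x, e x ^ n ∂m.map Real.toNNReal = laplace m n := by
    conv_rhs => rw [laplace, ← hm, integral_map (by fun_prop) (by fun_prop)]
    simp [e, ← Real.exp_nat_mul]
  have hlaplace_zero (m : Measure ℝ) [IsProbabilityMeasure m] : laplace m 0 = 1 := by
    simp [laplace]
  suffices hmap : ν.map Real.toNNReal = ρ.map Real.toNNReal by rw [← hν0, hmap, hρ0]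
  have := Measure.isProbabilityMeasure_map (μ := ν) (f := Real.toNNReal) (by fun_prop)
  have := Measure.isProbabilityMeasure_map (μ := ρ) (f := Real.toNNReal) (by fun_prop)
  refine ext_of_integral_pow_eq e he fun n => ?_
  rw [hmoment ν hν0, hmoment ρ hρ0]
  rcases n.eq_zero_or_pos with rfl | hn
  · simp only [Nat.cast_zero, hlaplace_zero]
  · exact h n (Nat.cast_pos.2 hn)

section laplace

variable {ν : Measure ℝ}

theorem one_sub_laplace (hν : ν ∈ probHalfLine) {s : ℝ} (hs : 0 ≤ s) :
    1 - laplace ν s = laplaceExponent ν s := by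
  have := hν.1
  have hint : Integrable (fun x => Real.exp (-(s * x))) ν := by
    refine ((integrable_const (1 : ℝ)).sub
      ((IsLevyMeasure.of_mem_probHalfLine hν).integrable_one_sub_exp hs)).congr
      (ae_of_all _ fun x => ?_)
    simp
  rw [laplaceExponent, integral_sub (integrable_const _) hint]
  simp [laplace]

theorem abs_laplace_sub_one (hν : ν ∈ probHalfLine) {s : ℝ} (hs : 0 ≤ s) :
    |laplace ν s - 1| = laplaceExponent ν s := by
  rw [abs_sub_comm, one_sub_laplace hν hs,
    abs_of_nonneg ((IsLevyMeasure.of_mem_probHalfLine hν).laplaceExponent_nonneg hs)]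

theorem measure_Ioi_ne_zero_of_mem_layer {ψ : ℝ → ℝ} (h : ν ∈ layer ψ) : ν (Set.Ioi 0) ≠ 0 := by
  intro h0
  obtain ⟨hν, L, -, hL⟩ := h
  have hzero : ∀ᶠ s in 𝓝[>] (0 : ℝ), |laplace ν s - 1| / (ψ s * L s⁻¹) = 0 := by
    filter_upwards [self_mem_nhdsWithin] with s (hs : 0 < s)
    rw [abs_laplace_sub_one hν hs.le,
      (IsLevyMeasure.of_mem_probHalfLine hν).laplaceExponent_eq_zero h0, zero_div]
  exact zero_ne_one (tendsto_nhds_unique tendsto_const_nhds (hL.congr' hzero))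

end laplace

/-! ### Unbounded Bernstein functions -/

namespace HasCharacteristics

variable {ψ : ℝ → ℝ} {b : ℝ} {μ : Measure ℝ}

theorem isLevyMeasure (h : HasCharacteristics ψ 0 b μ) : IsLevyMeasure μ := by
  have hnn : ∀ᵐ y ∂μ, 0 ≤ y := by
    filter_upwards [measure_eq_zero_iff_ae_notMem.1 h.concentrated] with y hy
    exact (not_le.1 hy).le
  refine ⟨hnn, by fun_prop, ?_⟩
  rw [hasFiniteIntegral_iff_ofReal (hnn.mono fun y hy => le_min zero_le_one hy)]
  exact h.integrable

theorem eq_add_laplaceExponent (h : HasCharacteristics ψ 0 b μ) {s : ℝ} (hs : 0 < s) :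
    ψ s = b * s + laplaceExponent μ s := by
  rw [h.eq s hs, zero_add, laplaceExponent]

theorem monotoneOn (h : HasCharacteristics ψ 0 b μ) : MonotoneOn ψ (Set.Ioi 0) := by
  intro s hs t ht hst
  rw [h.eq_add_laplaceExponent hs, h.eq_add_laplaceExponent ht]
  exact add_le_add (mul_le_mul_of_nonneg_left hst h.b_nonneg)
    (h.isLevyMeasure.monotoneOn_laplaceExponent (Set.mem_Ici_of_Ioi hs) (Set.mem_Ici_of_Ioi ht) hst)

theorem continuousOn (h : HasCharacteristics ψ 0 b μ) : ContinuousOn ψ (Set.Ioi 0) :=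
  ((continuous_const_mul b).continuousOn.add
    (h.isLevyMeasure.continuousOn_laplaceExponent.mono Set.Ioi_subset_Ici_self)).congr
    fun _ hs => h.eq_add_laplaceExponent hs

theorem tendsto_zero (h : HasCharacteristics ψ 0 b μ) : Tendsto ψ (𝓝[>] 0) (𝓝 0) := by
  have hlim : Tendsto (fun s => b * s + laplaceExponent μ s) (𝓝[>] 0) (𝓝 0) := by
    have hcont := ((continuous_const_mul b).continuousOn.add
      h.isLevyMeasure.continuousOn_laplaceExponent).continuousWithinAt (Set.self_mem_Ici (a := 0))
    refine (hcont.tendsto.mono_left (nhdsWithin_mono _ Set.Ioi_subset_Ici_self)).trans (le_of_eq ?_)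
    simp [laplaceExponent]
  refine hlim.congr' ?_
  filter_upwards [self_mem_nhdsWithin] with s hs
  exact (h.eq_add_laplaceExponent hs).symm

theorem tendsto_atTop_atTop (h : HasCharacteristics ψ 0 b μ)
    (hub : ¬ BddAbove (ψ '' Set.Ioi 0)) : Tendsto ψ atTop atTop := by
  refine tendsto_atTop.2 fun c => ?_
  obtain ⟨_, ⟨s, hs, rfl⟩, hc⟩ := not_bddAbove_iff.1 hub c
  filter_upwards [eventually_ge_atTop s] with t ht
  exact hc.le.trans (h.monotoneOn hs (lt_of_lt_of_le hs ht) ht)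

theorem pos (h : HasCharacteristics ψ 0 b μ) (hub : ¬ BddAbove (ψ '' Set.Ioi 0)) {s : ℝ}
    (hs : 0 < s) : 0 < ψ s := by
  rw [h.eq_add_laplaceExponent hs]
  rcases h.b_nonneg.eq_or_lt with rfl | hb
  · by_cases hμ : μ (Set.Ioi 0) = 0
    · refine absurd ⟨0, ?_⟩ hub
      rintro _ ⟨t, ht, rfl⟩
      rw [h.eq_add_laplaceExponent ht, h.isLevyMeasure.laplaceExponent_eq_zero hμ, zero_mul,
        zero_add]
    · simpa using h.isLevyMeasure.laplaceExponent_pos hμ hs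
  · exact add_pos_of_pos_of_nonneg (mul_pos hb hs) (h.isLevyMeasure.laplaceExponent_nonneg hs.le)

theorem exists_mul_le_comp_mul (h : HasCharacteristics ψ 0 b μ)
    (hμ : SubHomogeneous μ ∨ SuperHomogeneous μ) {l : ℝ} (hl : 0 < l) :
    ∃ c : ℝ, 0 < c ∧ ∀ s : ℝ, 0 < s → l * ψ s ≤ ψ (c * s) := by
  obtain ⟨c, hc, htail⟩ := exists_mul_tail_le hμ hl
  refine ⟨max c l, lt_max_of_lt_left hc, fun s hs => ?_⟩
  have hms : 0 < max c l * s := mul_pos (lt_max_of_lt_left hc) hs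
  rw [h.eq_add_laplaceExponent hs, h.eq_add_laplaceExponent hms, mul_add]
  refine add_le_add ?_ ?_
  · calc l * (b * s) = b * (l * s) := mul_left_comm _ _ _
      _ ≤ b * (max c l * s) := by
        gcongr
        exacts [h.b_nonneg, le_max_right _ _]
  · calc l * laplaceExponent μ s ≤ laplaceExponent μ (c * s) :=
          h.isLevyMeasure.mul_laplaceExponent_le hl.le hc htail hs
      _ ≤ laplaceExponent μ (max c l * s) :=
          h.isLevyMeasure.monotoneOn_laplaceExponent (mul_pos hc hs).le hms.le (by gcongr; simp)

end HasCharacteristics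

/-! ### Slow variation -/

theorem SlowlyVarying.of_one_lt {L : ℝ → ℝ} (hL0 : ∀ᶠ x in atTop, L x ≠ 0)
    (h : ∀ l : ℝ, 1 < l → Tendsto (fun x => L (l * x) / L x) atTop (𝓝 1)) : SlowlyVarying L := by
  intro l hl
  rcases lt_trichotomy l 1 with hl1 | rfl | hl1
  · have hx : Tendsto (fun x : ℝ => l * x) atTop atTop := tendsto_id.const_mul_atTop hl
    have hinv := ((h l⁻¹ ((one_lt_inv₀ hl).2 hl1)).comp hx).inv₀ one_ne_zero
    simpa [Function.comp_def, inv_mul_cancel_left₀ hl.ne'] using hinv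
  · refine tendsto_const_nhds.congr' (hL0.mono fun x hx => ?_)
    simp only [one_mul, div_self hx]
  · exact h l hl1

theorem SlowlyVarying.eventually_ne_zero {L : ℝ → ℝ} (h : SlowlyVarying L) :
    ∀ᶠ x in atTop, L x ≠ 0 := by
  filter_upwards [(h 1 one_pos).eventually_ne one_ne_zero] with x hx hx0
  exact hx (by rw [hx0, div_zero])

theorem SlowlyVarying.of_tendsto_div {G L : ℝ → ℝ} (hL : SlowlyVarying L)
    (h : Tendsto (fun x => G x / L x) atTop (𝓝 1)) : SlowlyVarying G := by
  intro l hl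
  have hx : Tendsto (fun x : ℝ => l * x) atTop atTop := tendsto_id.const_mul_atTop hl
  have hlim := ((h.comp hx).mul (hL l hl)).div h one_ne_zero
  simp only [mul_one, div_one] at hlim
  refine hlim.congr' ?_
  filter_upwards [hL.eventually_ne_zero, hx.eventually hL.eventually_ne_zero] with x hx hlx
  simp only [Function.comp_apply, Pi.div_apply]
  rw [div_mul_div_cancel₀ hlx, div_div_div_cancel_right₀ hx]

theorem nhdsGT_zero_le_map {ψ : ℝ → ℝ} (hcont : ContinuousOn ψ (Set.Ioi 0))
    (hpos : ∀ s, 0 < s → 0 < ψ s) (hlim : Tendsto ψ (𝓝[>] 0) (𝓝 0)) :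
    𝓝[>] 0 ≤ map ψ (𝓝[>] 0) := by
  intro U hU
  obtain ⟨δ, hδ, hδU⟩ := mem_nhdsGT_iff_exists_Ioc_subset.1 (mem_map.1 hU)
  filter_upwards [Ioo_mem_nhdsGT (hpos δ hδ)] with u hu
  obtain ⟨a, hau, ha⟩ := ((hlim.eventually_lt_const hu.1).and (Ioo_mem_nhdsGT hδ)).exists
  obtain ⟨s, hs, rfl⟩ := intermediate_value_Icc ha.2.le
    (hcont.mono fun s hs => ha.1.trans_le hs.1) ⟨hau.le, hu.2.le⟩
  exact hδU ⟨ha.1.trans_le hs.1, hs.2⟩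

/-- For `l > 1`, antitonicity gives `F (ψ (c s)) ≤ F (l ψ s) ≤ F (ψ s)`, and the outer terms are
asymptotically equal. -/
theorem SlowlyVarying.of_comp {F ψ : ℝ → ℝ} (hanti : AntitoneOn F (Set.Ioi 0))
    (hF : ∀ u, 0 < u → 0 < F u) (hcont : ContinuousOn ψ (Set.Ioi 0))
    (hpos : ∀ s, 0 < s → 0 < ψ s) (hlim : Tendsto ψ (𝓝[>] 0) (𝓝 0))
    (hscale : ∀ l : ℝ, 1 < l → ∃ c : ℝ, 0 < c ∧ ∀ s : ℝ, 0 < s → l * ψ s ≤ ψ (c * s))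
    (h : SlowlyVarying fun x => F (ψ x⁻¹)) : SlowlyVarying fun x => F x⁻¹ := by
  refine .of_one_lt ((eventually_gt_atTop 0).mono fun x hx => (hF _ (inv_pos.2 hx)).ne') ?_
  intro l hl
  have hl0 : 0 < l := one_pos.trans hl
  obtain ⟨c, hc, hcl⟩ := hscale l hl
  have houter : Tendsto (fun s => F (ψ (c * s)) / F (ψ s)) (𝓝[>] 0) (𝓝 1) := by
    simpa [Function.comp_def, mul_comm c] using (h c⁻¹ (inv_pos.2 hc)).comp tendsto_inv_nhdsGT_zero
  have hinner : Tendsto (fun s => F (l * ψ s) / F (ψ s)) (𝓝[>] 0) (𝓝 1) := by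
    refine tendsto_of_tendsto_of_tendsto_of_le_of_le' houter tendsto_const_nhds ?_ ?_
    all_goals
      filter_upwards [self_mem_nhdsWithin] with s (hs : 0 < s)
      have hlψ : 0 < l * ψ s := mul_pos hl0 (hpos s hs)
    · exact div_le_div_of_nonneg_right (hanti hlψ (hpos _ (mul_pos hc hs)) (hcl s hs))
        (hF _ (hpos s hs)).le
    · exact (div_le_one (hF _ (hpos s hs))).2
        (hanti (hpos s hs) hlψ (le_mul_of_one_le_left (hpos s hs).le hl.le))
  have hdiv : Tendsto (fun u => F (l * u) / F u) (𝓝[>] 0) (𝓝 1) :=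
    (tendsto_map'_iff.2 hinner).mono_left (nhdsGT_zero_le_map hcont hpos hlim)
  have hx : Tendsto (fun x : ℝ => (l * x)⁻¹) atTop (𝓝[>] 0) :=
    tendsto_inv_atTop_nhdsGT_zero.comp (tendsto_id.const_mul_atTop hl0)
  simpa [Function.comp_def, mul_inv_cancel_left₀ hl0.ne', mul_comm _ l⁻¹] using
    (hdiv.comp hx).inv₀ one_ne_zero

theorem mem_layer_id_of_slowlyVarying {ν : Measure ℝ} (hν : ν ∈ probHalfLine)
    (h0 : ν (Set.Ioi 0) ≠ 0) (h : SlowlyVarying fun x => laplaceExponent ν x⁻¹ / x⁻¹) :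
    ν ∈ layer id := by
  refine ⟨hν, _, h, tendsto_const_nhds.congr' ?_⟩
  filter_upwards [self_mem_nhdsWithin] with s (hs : 0 < s)
  have hpos := (IsLevyMeasure.of_mem_probHalfLine hν).laplaceExponent_pos h0 hs
  rw [abs_laplace_sub_one hν hs.le, inv_inv, id, mul_div_cancel₀ _ hs.ne', div_self hpos.ne']

namespace IsPhi

variable {ψ : ℝ → ℝ} {ν ρ : Measure ℝ}

theorem laplaceExponent_eq (h : IsPhi ψ ν ρ) {s : ℝ} (hs : 0 < s) (hψs : 0 ≤ ψ s) :
    laplaceExponent ρ s = laplaceExponent ν (ψ s) := by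
  rw [← one_sub_laplace h.2.1 hs.le, ← one_sub_laplace h.1 hψs, h.2.2 s hs]

theorem measure_Ioi_eq_zero_iff (h : IsPhi ψ ν ρ) {s : ℝ} (hs : 0 < s) (hψs : 0 < ψ s) :
    ρ (Set.Ioi 0) = 0 ↔ ν (Set.Ioi 0) = 0 := by
  rw [← (IsLevyMeasure.of_mem_probHalfLine h.2.1).laplaceExponent_eq_zero_iff hs,
    ← (IsLevyMeasure.of_mem_probHalfLine h.1).laplaceExponent_eq_zero_iff hψs,
    h.laplaceExponent_eq hs hψs.le]

theorem mem_layer_id {b : ℝ} {μ : Measure ℝ} (hΦ : IsPhi ψ ν ρ) (h : HasCharacteristics ψ 0 b μ)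
    (hub : ¬ BddAbove (ψ '' Set.Ioi 0)) (hμ : SubHomogeneous μ ∨ SuperHomogeneous μ)
    (hρ : ρ ∈ layer ψ) : ν ∈ layer id := by
  have hψ (s : ℝ) (hs : 0 < s) : 0 < ψ s := h.pos hub hs
  have hν0 : ν (Set.Ioi 0) ≠ 0 :=
    (hΦ.measure_Ioi_eq_zero_iff one_pos (hψ 1 one_pos)).not.1 (measure_Ioi_ne_zero_of_mem_layer hρ)
  have hν := IsLevyMeasure.of_mem_probHalfLine hΦ.1
  obtain ⟨-, L, hL, hlim⟩ := hρ
  have hcomp : SlowlyVarying fun x => laplaceExponent ν (ψ x⁻¹) / ψ x⁻¹ := by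
    refine hL.of_tendsto_div ((hlim.comp tendsto_inv_atTop_nhdsGT_zero).congr' ?_)
    filter_upwards [eventually_gt_atTop 0] with x hx
    have hx' : 0 < x⁻¹ := inv_pos.2 hx
    rw [Function.comp_apply, abs_laplace_sub_one hΦ.2.1 hx'.le,
      hΦ.laplaceExponent_eq hx' (hψ _ hx').le, inv_inv, div_div]
  exact mem_layer_id_of_slowlyVarying hΦ.1 hν0 <|
    .of_comp (F := fun u => laplaceExponent ν u / u) hν.antitoneOn_laplaceExponent_div
      (fun u hu => div_pos (hν.laplaceExponent_pos hν0 hu) hu) h.continuousOn hψ h.tendsto_zero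
      (fun l hl => h.exists_mul_le_comp_mul hμ (one_pos.trans hl)) hcomp

end IsPhi

/-! ### Pure jump paths -/

section JumpPath

variable {E : Type*} [AddCommMonoid E] [TopologicalSpace E]

/-- The path on `[0, ∞)` with value `0` before its jumps that jumps by `j n` at the time `S n`.
Summability is only guaranteed where finitely many jumps have occurred. -/
noncomputable def jumpPath (j : ℕ → E) (S : ℕ → ℝ) (t : ℝ≥0) : E :=
  ∑' n, Set.indicator (Set.Ici (S n)) (fun _ => j n) (t : ℝ)

theorem jumpPath_eq_sum {j : ℕ → E} {S : ℕ → ℝ} {K : ℕ} {t : ℝ≥0} (h : ∀ n, K ≤ n → (t : ℝ) < S n) :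
    jumpPath j S t = ∑ n ∈ Finset.range K, if S n ≤ t then j n else 0 := by
  rw [jumpPath, tsum_eq_sum (s := Finset.range K)]
  · exact Finset.sum_congr rfl fun n _ => by simp [Set.indicator_apply]
  · intro n hn
    simp [h n (by simpa using hn)]

theorem eventually_nhdsGE_le_iff {α : Type*} [LinearOrder α] [TopologicalSpace α]
    [OrderTopology α] (a b : α) : ∀ᶠ x in 𝓝[≥] b, (a ≤ x ↔ a ≤ b) := by
  rcases le_or_gt a b with h | h
  · filter_upwards [self_mem_nhdsWithin] with x (hx : b ≤ x)
    exact iff_of_true (h.trans hx) h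
  · filter_upwards [nhdsWithin_le_nhds (Iio_mem_nhds h)] with x hx
    exact iff_of_false hx.not_ge h.not_ge

theorem eventually_nhdsLT_le_iff {α : Type*} [LinearOrder α] [TopologicalSpace α]
    [OrderTopology α] (a b : α) : ∀ᶠ x in 𝓝[<] b, (a ≤ x ↔ a < b) := by
  rcases lt_or_ge a b with h | h
  · filter_upwards [nhdsWithin_le_nhds (Ioi_mem_nhds h)] with x hx
    exact iff_of_true (le_of_lt hx) h
  · filter_upwards [self_mem_nhdsWithin] with x (hx : x < b)
    exact iff_of_false (hx.trans_le h).not_ge h.not_gt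

theorem tendsto_coe_nhdsGE (t : ℝ≥0) : Tendsto ((↑) : ℝ≥0 → ℝ) (𝓝[≥] t) (𝓝[≥] (t : ℝ)) :=
  NNReal.continuous_coe.continuousWithinAt.tendsto_nhdsWithin fun _ h => NNReal.coe_le_coe.2 h

theorem tendsto_coe_nhdsLT (t : ℝ≥0) : Tendsto ((↑) : ℝ≥0 → ℝ) (𝓝[<] t) (𝓝[<] (t : ℝ)) :=
  NNReal.continuous_coe.continuousWithinAt.tendsto_nhdsWithin fun _ h => NNReal.coe_lt_coe.2 h

theorem tendsto_jumpPath_nhdsLT {j : ℕ → E} {S : ℕ → ℝ} {K : ℕ} {t : ℝ≥0}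
    (h : ∀ n, K ≤ n → (t : ℝ) ≤ S n) :
    Tendsto (jumpPath j S) (𝓝[<] t)
      (𝓝 (∑ n ∈ Finset.range K, if S n < t then j n else 0)) := by
  have hiff : ∀ᶠ v : ℝ≥0 in 𝓝[<] t, ∀ n ∈ Finset.range K, (S n ≤ v ↔ S n < t) :=
    (eventually_all_finset _).2 fun n _ =>
      (tendsto_coe_nhdsLT t).eventually (eventually_nhdsLT_le_iff (S n) t)
  refine tendsto_const_nhds.congr' ?_
  filter_upwards [hiff, self_mem_nhdsWithin] with v hv (hvt : v < t)
  rw [jumpPath_eq_sum (K := K) fun n hn => (NNReal.coe_lt_coe.2 hvt).trans_le (h n hn)]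
  exact Finset.sum_congr rfl fun n hn => by simp only [hv n hn]

theorem continuousWithinAt_jumpPath_Ici {j : ℕ → E} {S : ℕ → ℝ} {K : ℕ} {t : ℝ≥0}
    (h : ∀ n, K ≤ n → (t : ℝ) + 1 < S n) :
    ContinuousWithinAt (jumpPath j S) (Set.Ici t) t := by
  have hiff : ∀ᶠ v : ℝ≥0 in 𝓝[≥] t, ∀ n ∈ Finset.range K, (S n ≤ v ↔ S n ≤ t) :=
    (eventually_all_finset _).2 fun n _ =>
      (tendsto_coe_nhdsGE t).eventually (eventually_nhdsGE_le_iff (S n) t)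
  have hlt : ∀ᶠ v : ℝ≥0 in 𝓝[≥] t, v < t + 1 :=
    nhdsWithin_le_nhds (Iio_mem_nhds (lt_add_one t))
  refine tendsto_const_nhds.congr' ?_
  filter_upwards [hiff, hlt] with v hv hvt
  have hvt' : (v : ℝ) < t + 1 := mod_cast hvt
  rw [jumpPath_eq_sum fun n hn => (lt_add_one _).trans (h n hn),
    jumpPath_eq_sum fun n hn => hvt'.trans (h n hn)]
  exact Finset.sum_congr rfl fun n hn => by simp only [hv n hn]

theorem exists_forall_lt_of_tendsto_atTop {α : Type*} [Preorder α] [NoMaxOrder α] {S : ℕ → α}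
    (h : Tendsto S atTop atTop) (c : α) : ∃ K, ∀ n, K ≤ n → c < S n :=
  eventually_atTop.1 (h.eventually_gt_atTop c)

theorem isCadlag_jumpPath (j : ℕ → E) {S : ℕ → ℝ} (h : Tendsto S atTop atTop) :
    IsCadlag (jumpPath j S) := by
  intro t
  obtain ⟨K, hK⟩ := exists_forall_lt_of_tendsto_atTop h (t + 1)
  exact ⟨continuousWithinAt_jumpPath_Ici hK, _,
    tendsto_jumpPath_nhdsLT fun n hn => ((lt_add_one _).trans (hK n hn)).le⟩

theorem leftLim_jumpPath [T2Space E] {j : ℕ → E} {S : ℕ → ℝ} {K : ℕ} {t : ℝ≥0} (ht : 0 < t)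
    (h : ∀ n, K ≤ n → (t : ℝ) ≤ S n) :
    Function.leftLim (jumpPath j S) t = ∑ n ∈ Finset.range K, if S n < t then j n else 0 := by
  have : (𝓝[<] t).NeBot := nhdsLT_neBot_of_exists_lt ⟨0, ht⟩
  exact leftLim_eq_of_tendsto (tendsto_jumpPath_nhdsLT h)

end JumpPath

/-! ### Inverses of nondecreasing paths -/

section PathInverse

/-- The right-continuous inverse `r ↦ inf {u : D u > r}` of a path; it is `0` where `D` does not
exceed `r`. -/
noncomputable def pathInverse (D : ℝ≥0 → ℝ) (r : ℝ≥0) : ℝ≥0 := sInf {u : ℝ≥0 | (r : ℝ) < D u}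

/-- A nondecreasing càdlàg path from `0` to `∞`, as are almost surely the paths of a subordinator
with unbounded symbol. -/
structure IsRegularPath (D : ℝ≥0 → ℝ) : Prop where
  zero : D 0 = 0
  monotone : Monotone D
  isCadlag : IsCadlag D
  tendsto_atTop : Tendsto D atTop atTop

theorem isRegularPath_coe : IsRegularPath fun t : ℝ≥0 => (t : ℝ) where
  zero := rfl
  monotone := NNReal.coe_mono
  isCadlag t := ⟨NNReal.continuous_coe.continuousWithinAt, t,
    NNReal.continuous_coe.continuousWithinAt⟩
  tendsto_atTop := NNReal.tendsto_coe_atTop.2 tendsto_id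

variable {D : ℝ≥0 → ℝ}

theorem IsRegularPath.nonneg (hD : IsRegularPath D) (t : ℝ≥0) : 0 ≤ D t :=
  hD.zero ▸ hD.monotone zero_le

theorem pathInverse_le {r u : ℝ≥0} (h : (r : ℝ) < D u) : pathInverse D r ≤ u :=
  csInf_le' h

theorem le_of_lt_pathInverse {r u : ℝ≥0} (h : u < pathInverse D r) : D u ≤ r :=
  not_lt.1 fun h' => (pathInverse_le h').not_gt h

theorem nonempty_lt_of_tendsto_atTop (h : Tendsto D atTop atTop) (r : ℝ≥0) :
    {u : ℝ≥0 | (r : ℝ) < D u}.Nonempty :=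
  (h.eventually_gt_atTop (r : ℝ)).exists

theorem exists_lt_of_pathInverse_lt (h : Tendsto D atTop atTop) {r u : ℝ≥0}
    (hu : pathInverse D r < u) : ∃ v < u, (r : ℝ) < D v := by
  obtain ⟨v, hv, hvu⟩ := exists_lt_of_csInf_lt (nonempty_lt_of_tendsto_atTop h r) hu
  exact ⟨v, hvu, hv⟩

theorem monotone_pathInverse (h : Tendsto D atTop atTop) : Monotone (pathInverse D) :=
  fun _ r' hr => csInf_le_csInf' (nonempty_lt_of_tendsto_atTop h r') fun _ hu =>
    lt_of_le_of_lt (NNReal.coe_le_coe.2 hr) hu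

theorem IsRegularPath.lt_pathInverse (hD : IsRegularPath D) {r u : ℝ≥0} (hu : D u < r) :
    u < pathInverse D r := by
  have hev : ∀ᶠ v in 𝓝[≥] u, D v < r := (hD.isCadlag u).1.eventually_lt tendsto_const_nhds hu
  obtain ⟨w, hw, hIco⟩ := mem_nhdsGE_iff_exists_Ico_subset.1 hev
  obtain ⟨v, huv, hvw⟩ := exists_between (Set.mem_Ioi.1 hw)
  refine huv.trans_le (le_csInf (nonempty_lt_of_tendsto_atTop hD.tendsto_atTop r)
    fun x (hx : (r : ℝ) < D x) => ?_)
  by_contra! hxv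
  exact ((hIco ⟨huv.le, hvw⟩).trans hx).not_ge (hD.monotone hxv.le)

theorem IsRegularPath.eventually_lt_pathInverse_iff (hD : IsRegularPath D) (u t : ℝ≥0) :
    ∀ᶠ r in 𝓝[>] t, (u < pathInverse D r ↔ D u ≤ t) := by
  rcases le_or_gt (D u) t with hu | hu
  · filter_upwards [self_mem_nhdsWithin] with r (hr : t < r)
    exact iff_of_true (hD.lt_pathInverse (hu.trans_lt (NNReal.coe_lt_coe.2 hr))) hu
  · have hev : ∀ᶠ r : ℝ≥0 in 𝓝 t, (r : ℝ) < D u :=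
      NNReal.continuous_coe.continuousAt.eventually_lt continuousAt_const hu
    filter_upwards [nhdsWithin_le_nhds hev] with r hr
    exact iff_of_false (pathInverse_le hr).not_gt hu.not_ge

theorem IsRegularPath.rightLim_leftLim_jumpPath {E : Type*} [AddCommMonoid E]
    [TopologicalSpace E] [T2Space E] (hD : IsRegularPath D) (j : ℕ → E) {S : ℕ → ℝ≥0}
    (hS : Tendsto S atTop atTop) (t : ℝ≥0) :
    Function.rightLim
        (fun r => Function.leftLim (jumpPath j fun n => (S n : ℝ)) (pathInverse D r)) t
      = jumpPath j (fun n => D (S n)) t := by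
  obtain ⟨K, hK⟩ := exists_forall_lt_of_tendsto_atTop hS (pathInverse D (t + 1))
  have hDK : ∀ n, K ≤ n → (t : ℝ) < D (S n) := fun n hn => by
    obtain ⟨v, hv, hlt⟩ := exists_lt_of_pathInverse_lt hD.tendsto_atTop (hK n hn)
    push_cast at hlt
    linarith [hD.monotone hv.le]
  have hiff : ∀ᶠ r in 𝓝[>] t, ∀ n ∈ Finset.range K, (S n < pathInverse D r ↔ D (S n) ≤ t) :=
    (eventually_all_finset _).2 fun n _ => hD.eventually_lt_pathInverse_iff (S n) t
  have hne : (𝓝[>] t).NeBot := nhdsGT_neBot_of_exists_gt ⟨t + 1, lt_add_one t⟩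
  refine rightLim_eq_of_tendsto (tendsto_const_nhds.congr' ?_)
  filter_upwards [hiff, Ioo_mem_nhdsGT (lt_add_one t)] with r hr hrt
  have hpos : 0 < pathInverse D r := hD.lt_pathInverse (by
    rw [hD.zero]; exact mod_cast (zero_le (a := t)).trans_lt hrt.1)
  rw [jumpPath_eq_sum hDK, leftLim_jumpPath (K := K) hpos fun n hn => ?_]
  · exact Finset.sum_congr rfl fun n hn => by simp only [NNReal.coe_lt_coe, hr n hn]
  · exact NNReal.coe_le_coe.2 ((monotone_pathInverse hD.tendsto_atTop hrt.2.le).trans (hK n hn).le)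

end PathInverse

/-! ### Piecewise linear time changes -/

section Stretch

/-- The piecewise linear map of `[0, ∞)` that fixes `0` and has slope `c k` on the `k`-th of `K`
consecutive intervals of lengths `v 0, …, v (K - 1)`, and slope `1` after them. The subtractions
are truncated: `min (t - S) v` is the length of `[S, S + v] ∩ [0, t]`. -/
noncomputable def stretch (K : ℕ) (v c : ℕ → ℝ≥0) (t : ℝ≥0) : ℝ≥0 :=
  ∑ k ∈ Finset.range K, c k * min (t - ∑ i ∈ Finset.range k, v i) (v k)
    + (t - ∑ i ∈ Finset.range K, v i)

variable {K : ℕ} {v c : ℕ → ℝ≥0}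

theorem stretch_one (K : ℕ) (v : ℕ → ℝ≥0) (t : ℝ≥0) : stretch K v 1 t = t := by
  simp only [stretch, Pi.one_apply, one_mul]
  induction K with
  | zero => simp
  | succ n ih =>
    rw [Finset.sum_range_succ, add_assoc, Finset.sum_range_succ v, ← tsub_tsub, add_comm (min _ _),
      tsub_add_min, ih]

theorem strictMono_stretch (hc : ∀ k < K, 0 < c k) : StrictMono (stretch K v c) := by
  intro s t hst
  have hmin : ∀ k, min (s - ∑ i ∈ Finset.range k, v i) (v k)
      ≤ min (t - ∑ i ∈ Finset.range k, v i) (v k) :=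
    fun k => min_le_min (tsub_le_tsub_right hst.le _) le_rfl
  have hterm : ∀ k ∈ Finset.range K, c k * min (s - ∑ i ∈ Finset.range k, v i) (v k)
      ≤ c k * min (t - ∑ i ∈ Finset.range k, v i) (v k) :=
    fun k _ => mul_le_mul_right (hmin k) _
  have htail := tsub_le_tsub_right hst.le (∑ i ∈ Finset.range K, v i)
  refine lt_of_le_of_ne (add_le_add (Finset.sum_le_sum hterm) htail) fun heq => hst.ne ?_
  obtain ⟨hsum, hsub⟩ := (add_eq_add_iff_eq_and_eq (Finset.sum_le_sum hterm) htail).1 heq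
  have heach := (Finset.sum_eq_sum_iff_of_le hterm).1 hsum
  rw [← stretch_one K v s, ← stretch_one K v t, stretch, stretch, hsub]
  simp only [Pi.one_apply, one_mul]
  congr 1
  exact Finset.sum_congr rfl fun k hk =>
    mul_left_cancel₀ (hc k (Finset.mem_range.1 hk)).ne' (heach k hk)

theorem surjective_stretch (K : ℕ) (v c : ℕ → ℝ≥0) : Function.Surjective (stretch K v c) := by
  intro y
  have hcont : Continuous (stretch K v c) := by
    unfold stretch
    fun_prop
  have hzero : stretch K v c 0 ≤ y := by simp [stretch]
  have hle : y ≤ stretch K v c (y + ∑ i ∈ Finset.range K, v i) := by simp [stretch]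
  obtain ⟨x, -, hx⟩ := intermediate_value_Icc zero_le hcont.continuousOn ⟨hzero, hle⟩
  exact ⟨x, hx⟩

theorem stretch_sum_range {n : ℕ} (hn : n ≤ K) :
    stretch K v c (∑ i ∈ Finset.range n, v i) = ∑ i ∈ Finset.range n, c i * v i := by
  have hmono : Monotone fun k => ∑ i ∈ Finset.range k, v i :=
    fun a b hab => Finset.sum_le_sum_of_subset (Finset.range_mono hab)
  rw [stretch, tsub_eq_zero_of_le (hmono hn), add_zero]
  symm
  refine Finset.sum_subset_zero_on_sdiff (Finset.range_mono hn) (fun k hk => ?_) fun k hk => ?_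
  · have hk' : n ≤ k := by simpa using (Finset.mem_sdiff.1 hk).2
    rw [tsub_eq_zero_of_le (hmono hk'), min_eq_left zero_le, mul_zero]
  · rw [min_eq_right]
    refine le_tsub_of_add_le_left ?_
    rw [← Finset.sum_range_succ]
    exact hmono (Finset.mem_range.1 hk)

theorem dist_stretch_le (K : ℕ) (v c : ℕ → ℝ≥0) (t : ℝ≥0) :
    dist (stretch K v c t) t ≤ ∑ k ∈ Finset.range K, dist (c k * v k) (v k) := by
  nth_rw 2 [← stretch_one K v t]
  simp only [stretch, Pi.one_apply, one_mul, NNReal.dist_eq, NNReal.coe_add, NNReal.coe_sum,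
    NNReal.coe_mul, add_sub_add_right_eq_sub]
  rw [← Finset.sum_sub_distrib]
  refine (Finset.abs_sum_le_sum_abs _ _).trans (Finset.sum_le_sum fun k _ => ?_)
  rw [← sub_one_mul, ← sub_one_mul, abs_mul, abs_mul, NNReal.abs_eq, NNReal.abs_eq]
  exact mul_le_mul_of_nonneg_left (NNReal.coe_le_coe.2 (min_le_right _ _)) (abs_nonneg _)

theorem exists_orderIso_sum_range (K : ℕ) (v v' : ℕ → ℝ≥0) (h : ∀ k < K, v k = 0 ↔ v' k = 0) :
    ∃ τ : ℝ≥0 ≃o ℝ≥0,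
      (∀ n ≤ K, τ (∑ i ∈ Finset.range n, v i) = ∑ i ∈ Finset.range n, v' i) ∧
      ∀ t, dist (τ t) t ≤ ∑ i ∈ Finset.range K, dist (v' i) (v i) := by
  set c : ℕ → ℝ≥0 := fun k => if v k = 0 then 1 else v' k / v k with hc
  have hcpos : ∀ k < K, 0 < c k := by
    intro k hk
    simp only [hc]
    split_ifs with h0
    · exact one_pos
    · exact div_pos (pos_iff_ne_zero.2 ((h k hk).not.1 h0)) (pos_iff_ne_zero.2 h0)
  have hcv : ∀ k < K, c k * v k = v' k := by
    intro k hk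
    simp only [hc]
    split_ifs with h0
    · rw [h0, mul_zero, (h k hk).1 h0]
    · exact div_mul_cancel₀ _ h0
  refine ⟨(strictMono_stretch hcpos).orderIsoOfSurjective _ (surjective_stretch K v c),
    fun n hn => ?_, fun t => ?_⟩
  · exact (stretch_sum_range hn).trans
      (Finset.sum_congr rfl fun k hk => hcv k ((Finset.mem_range.1 hk).trans_le hn))
  · refine (dist_stretch_le K v c t).trans_eq (Finset.sum_congr rfl fun k hk => ?_)
    rw [hcv k (Finset.mem_range.1 hk)]

end Stretch

/-! ### Measurability into the Skorokhod space -/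

section Skorokhod

/-- The sequences of space-time jumps with nonnegative waiting times of infinite sum. -/
def regularJumps (E : Type*) : Set (ℕ → E × ℝ) :=
  {x | (∀ n, 0 ≤ (x n).2) ∧
    Tendsto (fun n => ∑ i ∈ Finset.range (n + 1), (x i).2) atTop atTop}

theorem measurableSet_regularJumps {E : Type*} [MeasurableSpace E] :
    MeasurableSet (regularJumps E) := by
  refine MeasurableSet.inter (s₁ := {x : ℕ → E × ℝ | ∀ n, 0 ≤ (x n).2}) ?_ ?_
  · rw [Set.ofPred_forall]
    exact MeasurableSet.iInter fun n => measurableSet_le (by fun_prop) (by fun_prop)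
  · exact measurableSet_tendsto _ fun n => by fun_prop

variable {E : Type*} [NormedAddCommGroup E]

theorem isCadlag_zero : IsCadlag fun _ : ℝ≥0 => (0 : E) :=
  fun _ => ⟨continuousWithinAt_const, 0, tendsto_const_nhds⟩

/-- The element of the Skorokhod space given by a càdlàg function. -/
def Skorokhod.mk (f : ℝ≥0 → E) (hf : IsCadlag f) : Skorokhod E := ⟨f, hf⟩

open Classical in
/-- The path in the Skorokhod space of the CTRW with the given space-time jumps; it is taken to be
`0` if the jumps are not regular. -/
noncomputable def toSkorokhod (x : ℕ → E × ℝ) : Skorokhod E :=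
  if h : x ∈ regularJumps E then .mk _ (isCadlag_jumpPath (fun n => (x n).1) h.2)
  else .mk _ isCadlag_zero

theorem toSkorokhod_val {x : ℕ → E × ℝ} (h : x ∈ regularJumps E) :
    (toSkorokhod x).1
      = jumpPath (fun n => (x n).1) (fun n => ∑ i ∈ Finset.range (n + 1), (x i).2) := by
  rw [toSkorokhod, dif_pos h]
  rfl

theorem norm_jumpPath_sub_le {j j' : ℕ → E} {S S' : ℕ → ℝ} {K : ℕ} {t t' : ℝ≥0}
    (h : ∀ n, K ≤ n → (t : ℝ) < S n) (h' : ∀ n, K ≤ n → (t' : ℝ) < S' n)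
    (hiff : ∀ n < K, S' n ≤ t' ↔ S n ≤ t) :
    ‖jumpPath j' S' t' - jumpPath j S t‖ ≤ ∑ n ∈ Finset.range K, dist (j' n) (j n) := by
  rw [jumpPath_eq_sum h, jumpPath_eq_sum h', ← Finset.sum_sub_distrib]
  refine (norm_sum_le _ _).trans (Finset.sum_le_sum fun n hn => ?_)
  simp only [hiff n (Finset.mem_range.1 hn), dist_eq_norm]
  split_ifs <;> simp

theorem exists_orderIso_norm_jumpPath_sub_le {j j' : ℕ → E} (v v' : ℕ → ℝ≥0) (K : ℕ)
    (h : ∀ k < K, v k = 0 ↔ v' k = 0) :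
    ∃ τ : ℝ≥0 ≃o ℝ≥0, (∀ t, dist (τ t) t ≤ ∑ i ∈ Finset.range K, dist (v' i) (v i)) ∧
      ∀ t < ∑ i ∈ Finset.range K, v i,
        ‖jumpPath j' (fun n => ∑ i ∈ Finset.range (n + 1), (v' i : ℝ)) (τ t)
          - jumpPath j (fun n => ∑ i ∈ Finset.range (n + 1), (v i : ℝ)) t‖
        ≤ ∑ i ∈ Finset.range K, dist (j' i) (j i) := by
  obtain ⟨τ, hτ, hdist⟩ := exists_orderIso_sum_range K v v' h
  refine ⟨τ, hdist, fun t ht => ?_⟩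
  have hmono : ∀ w : ℕ → ℝ≥0, ∀ n, K ≤ n →
      ∑ i ∈ Finset.range K, w i ≤ ∑ i ∈ Finset.range (n + 1), w i := fun w n hn =>
    Finset.sum_le_sum_of_subset (Finset.range_mono (hn.trans n.le_succ))
  have hτt : τ t < ∑ i ∈ Finset.range K, v' i := by
    rw [← hτ K le_rfl]
    exact τ.strictMono ht
  refine norm_jumpPath_sub_le (fun n hn => ?_) (fun n hn => ?_) fun n hn => ?_
  · exact mod_cast ht.trans_le (hmono v n hn)
  · exact mod_cast hτt.trans_le (hmono v' n hn)
  · simp only [← NNReal.coe_sum, NNReal.coe_le_coe, ← hτ (n + 1) hn, τ.le_iff_le]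

/-- The space-time jumps together with the record of which waiting times vanish. Convergence of
these data, unlike convergence of the jumps alone, implies `J₁` convergence of the paths: two
simultaneous jumps must not be pulled apart. -/
noncomputable def jumpMarks {E : Type*} (x : ℕ → E × ℝ) (k : ℕ) : E × ℝ × Bool :=
  ((x k).1, (x k).2, decide ((x k).2 = 0))

theorem measurable_jumpMarks {E : Type*} [MeasurableSpace E] :
    Measurable (jumpMarks (E := E)) := by
  refine measurable_pi_lambda _ fun k => Measurable.prodMk (by fun_prop)
    (Measurable.prodMk (by fun_prop) (measurable_to_bool ?_))
  have hpre : (fun x : ℕ → E × ℝ => decide ((x k).2 = 0)) ⁻¹' {true} = {x | (x k).2 = 0} := by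
    ext x
    simp
  rw [hpre]
  exact measurableSet_eq_fun (by fun_prop) measurable_const

theorem eventually_toSkorokhod_mem_nbhd {x : ℕ → E × ℝ} (hx : x ∈ regularJumps E) {ε : ℝ}
    (hε : 0 < ε) :
    ∀ᶠ y in comap jumpMarks (𝓝 (jumpMarks x)), y ∈ regularJumps E →
      toSkorokhod y ∈ (toSkorokhod x).nbhd ε := by
  obtain ⟨K, hK⟩ := exists_forall_lt_of_tendsto_atTop hx.2 (1 / ε)
  have hspace : ∀ᶠ z in 𝓝 (jumpMarks x), ∑ k ∈ Finset.range (K + 1), dist (z k).1 (x k).1 < ε :=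
    (Continuous.continuousAt (by fun_prop)).eventually_lt continuousAt_const
      (by simpa [jumpMarks] using hε)
  have htime : ∀ᶠ z in 𝓝 (jumpMarks x),
      ∑ k ∈ Finset.range (K + 1), dist (z k).2.1 (x k).2 < ε :=
    (Continuous.continuousAt (by fun_prop)).eventually_lt continuousAt_const
      (by simpa [jumpMarks] using hε)
  have hmark : ∀ᶠ z in 𝓝 (jumpMarks x), ∀ k ∈ Finset.range (K + 1),
      (z k).2.2 = (jumpMarks x k).2.2 :=
    (eventually_all_finset _).2 fun k _ =>
      ((isOpen_discrete {(jumpMarks x k).2.2}).preimage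
        (f := fun z : ℕ → E × ℝ × Bool => (z k).2.2) (by fun_prop)).mem_nhds rfl
  filter_upwards [tendsto_comap.eventually (hspace.and (htime.and hmark))]
    with y ⟨hys, hyt, hym⟩ hy
  have hcoe : ∀ z ∈ regularJumps E, ∀ n, ((z n).2.toNNReal : ℝ) = (z n).2 := fun z hz n =>
    Real.coe_toNNReal _ (hz.1 n)
  obtain ⟨τ, hτd, hτ⟩ := exists_orderIso_norm_jumpPath_sub_le
    (j := fun n => (x n).1) (j' := fun n => (y n).1)
    (fun n => (x n).2.toNNReal) (fun n => (y n).2.toNNReal) (K + 1) fun k hk => by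
      have hiff : (y k).2 = 0 ↔ (x k).2 = 0 := by
        simpa [jumpMarks] using hym k (Finset.mem_range.2 hk)
      rw [← NNReal.coe_eq_zero, ← NNReal.coe_eq_zero, hcoe x hx, hcoe y hy, hiff]
  simp only [NNReal.dist_eq, hcoe x hx, hcoe y hy] at hτd hτ
  refine ⟨τ, fun t => (hτd t).trans_lt hyt, fun t ht => ?_⟩
  rw [toSkorokhod_val hx, toSkorokhod_val hy]
  refine (hτ t ?_).trans_lt hys
  rw [← NNReal.coe_lt_coe, NNReal.coe_sum]
  simpa only [hcoe x hx] using ht.trans_lt (hK K le_rfl)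

theorem measurable_toSkorokhod [MeasurableSpace E] [BorelSpace E] [SecondCountableTopology E] :
    Measurable (toSkorokhod (E := E)) := by
  refine measurable_of_restrict_of_restrict_compl measurableSet_regularJumps ?_ ?_
  · refine measurable_of_isOpen fun U hU => ?_
    let : TopologicalSpace (regularJumps E) := .induced (fun x => jumpMarks x.1) inferInstance
    have hopen : IsOpen ((regularJumps E).domRestrict toSkorokhod ⁻¹' U) := by
      refine isOpen_iff_mem_nhds.2 fun x hxU => ?_
      obtain ⟨ε, hε, hεU⟩ := hU _ hxU
      rw [nhds_induced, ← Function.comp_def jumpMarks, ← comap_comap]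
      filter_upwards [preimage_mem_comap (eventually_toSkorokhod_mem_nbhd x.2 hε)] with y hy
      exact hεU (hy y.2)
    obtain ⟨V, hV, hVU⟩ := isOpen_induced_iff.1 hopen
    rw [← hVU]
    exact (measurable_jumpMarks.comp measurable_subtype_coe) hV.measurableSet
  · have hconst : (regularJumps E)ᶜ.domRestrict toSkorokhod
        = fun _ => Skorokhod.mk (E := E) _ isCadlag_zero :=
      funext fun x => dif_neg x.2
    rw [hconst]
    exact measurable_const

theorem isOpen_exists_ne_zero (a : ℝ) :
    IsOpen {f : Skorokhod E | ∃ t : ℝ≥0, (t : ℝ) < a ∧ f.1 t ≠ 0} := by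
  rintro f ⟨t, hta, hft⟩
  set ε : ℝ := min (min (a - t) ‖f.1 t‖) (1 / (t + 1))
  have hε : 0 < ε :=
    lt_min (lt_min (sub_pos.2 hta) (norm_pos_iff.2 hft)) (by positivity)
  have hεa : ε ≤ a - t := (min_le_left _ _).trans (min_le_left _ _)
  have hεf : ε ≤ ‖f.1 t‖ := (min_le_left _ _).trans (min_le_right _ _)
  have htε : (t : ℝ) ≤ 1 / ε := by
    have hεt := (le_div_iff₀ (by positivity)).1 (min_le_right _ _ : ε ≤ 1 / (t + 1))
    rw [le_div_iff₀ hε]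
    linarith
  refine ⟨ε, hε, ?_⟩
  rintro g ⟨τ, hτ, hg⟩
  refine ⟨τ t, ?_, fun hgt => ?_⟩
  · have hdist := hτ t
    rw [NNReal.dist_eq] at hdist
    linarith [le_abs_self ((τ t : ℝ) - t)]
  · have hlt := hg t htε
    rw [hgt, zero_sub, norm_neg] at hlt
    exact (hlt.trans_le hεf).false

theorem isOpen_apply_zero_ne_zero : IsOpen {f : Skorokhod E | f.1 0 ≠ 0} := by
  intro f hf
  refine ⟨‖f.1 0‖, norm_pos_iff.2 hf, ?_⟩
  rintro g ⟨τ, -, hg⟩ hg0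
  have hlt := hg 0 (by simp)
  rw [show τ 0 = 0 from τ.map_bot, hg0, zero_sub, norm_neg] at hlt
  exact hlt.false

end Skorokhod

/-! ### Sums of i.i.d. waiting times -/

section Divergence

variable {Ω : Type*} [MeasurableSpace Ω] {P : Measure Ω}

theorem exists_pos_measure_Ici_ne_zero {ν : Measure ℝ} (h : ν (Set.Ioi 0) ≠ 0) :
    ∃ ε : ℝ, 0 < ε ∧ ν (Set.Ici ε) ≠ 0 := by
  by_contra! hcon
  have hcover : Set.Ioi (0 : ℝ) ⊆ ⋃ n : ℕ, Set.Ici (1 / ((n : ℝ) + 1)) := fun x hx => by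
    obtain ⟨n, hn⟩ := exists_nat_one_div_lt (Set.mem_Ioi.1 hx)
    exact Set.mem_iUnion.2 ⟨n, hn.le⟩
  exact h (measure_mono_null hcover (measure_iUnion_null fun n => hcon _ (by positivity)))

theorem ae_frequently_mem_of_iIndepFun {α : Type*} [MeasurableSpace α] {X : ℕ → Ω → α}
    (hm : ∀ n, Measurable (X n)) (hind : iIndepFun X P)
    (hid : ∀ n, IdentDistrib (X n) (X 0) P P) {A : Set α} (hA : MeasurableSet A)
    (hA0 : P (X 0 ⁻¹' A) ≠ 0) : ∀ᵐ ω ∂P, ∃ᶠ n in atTop, X n ω ∈ A := by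
  have := hind.isProbabilityMeasure
  have hms : ∀ n, MeasurableSet (X n ⁻¹' A) := fun n => hm n hA
  have hset : iIndepSet (fun n => X n ⁻¹' A) P :=
    (iIndepSet_iff_meas_biInter hms).2 fun s => hind.measure_inter_preimage_eq_mul s fun _ _ => hA
  have hsum : ∑' n, P (X n ⁻¹' A) = ∞ := by
    rw [tsum_congr fun n => (hid n).measure_mem_eq hA]
    exact ENNReal.tsum_const_eq_top_of_ne_zero hA0
  have hlimsup : ∀ᵐ ω ∂P, ω ∈ limsup (fun n => X n ⁻¹' A) atTop :=
    (prob_compl_eq_zero_iff (MeasurableSet.measurableSet_limsup hms)).2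
      (measure_limsup_eq_one hms hset hsum)
  filter_upwards [hlimsup] with ω hω
  exact mem_limsup_iff_frequently_mem.1 hω

theorem tendsto_sum_range_atTop_of_frequently_le {w : ℕ → ℝ} (hw : ∀ n, 0 ≤ w n) {ε : ℝ}
    (hε : 0 < ε) (h : ∃ᶠ n in atTop, ε ≤ w n) :
    Tendsto (fun n => ∑ i ∈ Finset.range n, w i) atTop atTop := by
  rw [← not_summable_iff_tendsto_nat_atTop_of_nonneg hw]
  intro hs
  obtain ⟨n, hle, hlt⟩ :=
    (h.and_eventually (hs.tendsto_atTop_zero.eventually_lt_const hε)).exists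
  exact hlt.not_ge hle

namespace IsIIDJumps

variable {F : Type*} [MeasurableSpace F] {J : ℕ → Ω → F} {W : ℕ → Ω → ℝ}

theorem iIndepFun_wait (h : IsIIDJumps J W P) : iIndepFun W P :=
  h.indep.comp (fun _ => Prod.snd) fun _ => measurable_snd

theorem identDistrib_wait (h : IsIIDJumps J W P) (k : ℕ) : IdentDistrib (W k) (W 0) P P :=
  (h.identDistrib k).comp measurable_snd

theorem ae_mem_regularJumps (h : IsIIDJumps J W P) (hnn : ∀ᵐ ω ∂P, 0 ≤ W 0 ω)
    (hpos : P.map (W 0) (Set.Ioi 0) ≠ 0) :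
    ∀ᵐ ω ∂P, (fun k => (J k ω, W k ω)) ∈ regularJumps F := by
  obtain ⟨ε, hε, hε0⟩ := exists_pos_measure_Ici_ne_zero hpos
  rw [Measure.map_apply (h.measurable_wait 0) measurableSet_Ici] at hε0
  have hnn' : ∀ᵐ ω ∂P, ∀ k, 0 ≤ W k ω := ae_all_iff.2 fun k =>
    (h.identDistrib_wait k).symm.ae_snd (p := fun x => 0 ≤ x) measurableSet_Ici hnn
  filter_upwards [hnn', ae_frequently_mem_of_iIndepFun h.measurable_wait h.iIndepFun_wait
    h.identDistrib_wait measurableSet_Ici hε0] with ω hω hfreq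
  exact ⟨hω, (tendsto_add_atTop_iff_nat (f := fun n => ∑ i ∈ Finset.range n, W i ω) 1).2
    (tendsto_sum_range_atTop_of_frequently_le hω hε hfreq)⟩

theorem ae_strictMono_jumpTime (h : IsIIDJumps J W P) (hpos : ∀ᵐ ω ∂P, 0 < W 0 ω) :
    ∀ᵐ ω ∂P, StrictMono fun n => jumpTime W n ω := by
  have hpos' : ∀ᵐ ω ∂P, ∀ k, 0 < W k ω := ae_all_iff.2 fun k =>
    (h.identDistrib_wait k).symm.ae_snd (p := fun x => 0 < x) measurableSet_Ioi hpos
  filter_upwards [hpos'] with ω hω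
  refine strictMono_nat_of_lt_succ fun n => ?_
  rw [jumpTime, jumpTime, Finset.sum_range_succ _ (n + 1)]
  exact lt_add_of_pos_right _ (hω (n + 1))

end IsIIDJumps

theorem jumpTime_zero {Ω : Type*} (W : ℕ → Ω → ℝ) (ω : Ω) : jumpTime W 0 ω = W 0 ω := by
  simp [jumpTime]

theorem map_mem_probHalfLine_iff [IsProbabilityMeasure P] {X : Ω → ℝ} (hX : AEMeasurable X P) :
    P.map X ∈ probHalfLine ↔ ∀ᵐ ω ∂P, 0 ≤ X ω := by
  have hcompl : {x : ℝ | 0 ≤ x}ᶜ = Set.Iio 0 := by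
    ext x
    simp
  have hae := ae_map_iff hX (measurableSet_Ici (a := (0 : ℝ)))
  rw [← hae, ae_iff, ← Set.compl_ofPred, hcompl]
  exact and_iff_right (Measure.isProbabilityMeasure_map hX)

end Divergence

/-! ### Paths of subordinators -/

section Subordinator

variable {ψ : ℝ → ℝ} {Ω : Type*} [MeasurableSpace Ω] {P : Measure Ω} {D : ℝ≥0 → Ω → ℝ}

namespace IsSubordinator

theorem measureReal_le_le (h : IsSubordinator ψ D P) (u : ℝ≥0) (c : ℝ) {s : ℝ} (hs : 0 < s) :
    P.real {ω | D u ω ≤ c} ≤ Real.exp (s * c) * Real.exp (-(u * ψ s)) := by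
  have hint : Integrable (fun ω => Real.exp (-(s * D u ω))) P :=
    Integrable.of_integral_ne_zero (by rw [h.laplace_eq u s hs]; exact (Real.exp_pos _).ne')
  have hmarkov := mul_meas_ge_le_integral_of_nonneg (ae_of_all _ fun ω => (Real.exp_pos _).le)
    hint (Real.exp (-(s * c)))
  have hset : {ω | Real.exp (-(s * c)) ≤ Real.exp (-(s * D u ω))} = {ω | D u ω ≤ c} := by
    ext ω
    simp [hs]
  rwa [h.laplace_eq u s hs, hset, Real.exp_neg, inv_mul_le_iff₀ (Real.exp_pos _)] at hmarkov

theorem ae_pos [IsFiniteMeasure P] (h : IsSubordinator ψ D P) (hψ : Tendsto ψ atTop atTop)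
    {u : ℝ≥0} (hu : 0 < u) : ∀ᵐ ω ∂P, 0 < D u ω := by
  have hlim : Tendsto (fun s => Real.exp (-(u * ψ s))) atTop (𝓝 0) :=
    Real.tendsto_exp_neg_atTop_nhds_zero.comp (hψ.const_mul_atTop (NNReal.coe_pos.2 hu))
  have hzero : P.real {ω | D u ω ≤ 0} ≤ 0 := by
    refine ge_of_tendsto hlim ?_
    filter_upwards [eventually_gt_atTop 0] with s hs
    simpa using h.measureReal_le_le u 0 hs
  rw [ae_iff, ← measureReal_eq_zero_iff]
  simpa only [not_lt] using hzero.antisymm measureReal_nonneg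

theorem ae_strictMono [IsFiniteMeasure P] (h : IsSubordinator ψ D P)
    (hψ : Tendsto ψ atTop atTop) : ∀ᵐ ω ∂P, StrictMono fun t => D t ω := by
  obtain ⟨R, hRc, hRd⟩ := TopologicalSpace.exists_countable_dense ℝ≥0
  have hinc : ∀ᵐ ω ∂P, ∀ p ∈ R, ∀ q ∈ R, p < q → 0 < D q ω - D p ω := by
    refine (ae_ball_iff hRc).2 fun p _ => (ae_ball_iff hRc).2 fun q _ =>
      eventually_imp_distrib_left.2 fun hpq => ?_
    obtain ⟨u, rfl⟩ := exists_add_of_le hpq.le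
    exact (h.stationary p u).symm.ae_snd (p := fun x => 0 < x) measurableSet_Ioi
      (h.ae_pos hψ (by simpa using hpq))
  filter_upwards [h.paths, hinc] with ω hω hωinc u v huv
  obtain ⟨p, hp, hup, hpv⟩ := hRd.exists_between huv
  obtain ⟨q, hq, hpq, hqv⟩ := hRd.exists_between hpv
  exact (hω.1 hup.le).trans_lt ((sub_pos.1 (hωinc p hp q hq hpq)).trans_le (hω.1 hqv.le))

theorem ae_tendsto_atTop [IsFiniteMeasure P] (h : IsSubordinator ψ D P)
    (hψ : Tendsto ψ atTop atTop) : ∀ᵐ ω ∂P, Tendsto (fun t => D t ω) atTop atTop := by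
  obtain ⟨s, hψs, hs⟩ := ((hψ.eventually_gt_atTop 0).and (eventually_gt_atTop 0)).exists
  have hbound : ∀ᵐ ω ∂P, ∀ c : ℕ, ∃ n : ℕ, (c : ℝ) < D n ω := by
    refine ae_all_iff.2 fun c => ?_
    have hexp : Tendsto (fun n : ℕ => Real.exp (-(n * ψ s))) atTop (𝓝 0) :=
      Real.tendsto_exp_neg_atTop_nhds_zero.comp (tendsto_natCast_atTop_atTop.atTop_mul_const hψs)
    have hlim : Tendsto (fun n : ℕ => Real.exp (s * c) * Real.exp (-(n * ψ s))) atTop (𝓝 0) := by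
      simpa only [mul_zero] using hexp.const_mul (Real.exp (s * c))
    rw [ae_iff, ← measureReal_eq_zero_iff]
    refine le_antisymm (ge_of_tendsto' hlim fun n => ?_) measureReal_nonneg
    refine (measureReal_mono fun ω hω => ?_).trans (h.measureReal_le_le n c hs)
    exact not_lt.1 fun hlt => hω ⟨n, hlt⟩
  filter_upwards [h.paths, hbound] with ω hω hωbound
  refine tendsto_atTop_atTop_of_monotone hω.1 fun c => ?_
  obtain ⟨m, hm⟩ := exists_nat_ge c
  obtain ⟨n, hn⟩ := hωbound m
  exact ⟨n, hm.trans hn.le⟩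

theorem ae_isRegularPath [IsFiniteMeasure P] (h : IsSubordinator ψ D P)
    (hψ : Tendsto ψ atTop atTop) : ∀ᵐ ω ∂P, IsRegularPath fun t => D t ω := by
  filter_upwards [h.zero, h.paths, h.ae_tendsto_atTop hψ] with ω hzero hpaths hlim
  exact ⟨hzero, hpaths.1, hpaths.2, hlim⟩

end IsSubordinator

/-- For every path `D` with right-continuous inverse `τ`, the value of `D` at `w`, as a measurable
function of the inverse: `D w` is the infimum of the `r` with `w < τ r`, and `r` may be restricted
to a countable dense set `R` of times. -/
noncomputable def valueOfInverse (R : Set ℝ≥0) (x : (ℝ≥0 → ℝ≥0) × ℝ) : ℝ≥0∞ :=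
  ⨅ r ∈ R, Set.indicator {x : (ℝ≥0 → ℝ≥0) × ℝ | (x.1 r : ℝ) ≤ x.2} (fun _ => ∞) x ⊔ (r : ℝ≥0∞)

theorem measurable_valueOfInverse {R : Set ℝ≥0} (hR : R.Countable) :
    Measurable (valueOfInverse R) := by
  refine Measurable.biInf R hR fun r _ => Measurable.sup ?_ measurable_const
  exact measurable_const.indicator (measurableSet_le (by fun_prop) (by fun_prop))

theorem IsRegularPath.valueOfInverse_pathInverse {R : Set ℝ≥0} (hR : Dense R) {D : ℝ≥0 → ℝ}
    (hD : IsRegularPath D) (w : ℝ≥0) :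
    valueOfInverse R (pathInverse D, w) = ENNReal.ofReal (D w) := by
  refine le_antisymm (le_of_forall_gt_imp_ge_of_dense fun c hc => ?_) (le_iInf₂ fun r _ => ?_)
  · obtain ⟨d, hd, hdc⟩ := ENNReal.lt_iff_exists_nnreal_btwn.1 hc
    obtain ⟨r, hr, hwr, hrd⟩ := hR.exists_between (ENNReal.coe_lt_coe.1 hd)
    have hlt : w < pathInverse D r :=
      hD.lt_pathInverse ((Real.toNNReal_lt_iff_lt_coe (hD.nonneg w)).1 hwr)
    refine (iInf₂_le r hr).trans ?_
    rw [Set.indicator_of_notMem (by simpa using hlt), max_eq_right zero_le]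
    exact (ENNReal.coe_le_coe.2 hrd.le).trans hdc.le
  · by_cases hlt : w < pathInverse D r
    · exact le_sup_of_le_right
        (ENNReal.coe_le_coe.2 (Real.toNNReal_le_iff_le_coe.2 (le_of_lt_pathInverse hlt)))
    · rw [Set.indicator_of_mem (by simpa using hlt), top_sup_eq]
      exact le_top

/-- This is Fubini's theorem: given `w = v`, the variable `F (X, v)` has the Laplace transform
`e^{-v ψ(s)}`, whose mean over `v` is the Laplace transform of `w` at `ψ(s)`. -/
theorem isPhi_map_of_indepFun [IsProbabilityMeasure P] {α : Type*} [MeasurableSpace α]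
    {X : Ω → α} {w : Ω → ℝ} {F : α × ℝ → ℝ} (hF : Measurable F) (hF0 : ∀ x, 0 ≤ F x)
    (hX : Measurable X) (hw : Measurable w) (hw0 : ∀ᵐ ω ∂P, 0 ≤ w ω) (hind : IndepFun X w P)
    (hlap : ∀ s, 0 < s → ∀ v : ℝ≥0, ∫ ω, Real.exp (-(s * F (X ω, v))) ∂P = Real.exp (-(v * ψ s))) :
    IsPhi ψ (P.map w) (P.map fun ω => F (X ω, w ω)) := by
  have hH : Measurable fun ω => F (X ω, w ω) := hF.comp (hX.prodMk hw)
  refine ⟨(map_mem_probHalfLine_iff hw.aemeasurable).2 hw0,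
    (map_mem_probHalfLine_iff hH.aemeasurable).2 (ae_of_all _ fun ω => hF0 _), fun s hs => ?_⟩
  have := Measure.isProbabilityMeasure_map (μ := P) hX.aemeasurable
  have := Measure.isProbabilityMeasure_map (μ := P) hw.aemeasurable
  let G : α × ℝ → ℝ := fun x => Real.exp (-(s * F x))
  have hGm : Measurable G := by fun_prop
  have hGint : Integrable G ((P.map X).prod (P.map w)) := by
    refine Integrable.of_bound hGm.aestronglyMeasurable 1 (ae_of_all _ fun x => ?_)
    rw [Real.norm_eq_abs, Real.abs_exp]
    exact Real.exp_le_one_iff.2 (neg_nonpos.2 (mul_nonneg hs.le (hF0 x)))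
  calc laplace (P.map fun ω => F (X ω, w ω)) s = ∫ ω, G (X ω, w ω) ∂P := by
        rw [laplace, integral_map hH.aemeasurable (by fun_prop)]
    _ = ∫ x, G x ∂((P.map X).prod (P.map w)) := by
        rw [← (indepFun_iff_map_prod_eq_prod_map_map hX.aemeasurable hw.aemeasurable).1 hind,
          integral_map (hX.prodMk hw).aemeasurable hGm.aestronglyMeasurable]
    _ = ∫ v, ∫ x, G (x, v) ∂(P.map X) ∂(P.map w) := integral_prod_symm _ hGint
    _ = laplace (P.map w) (ψ s) := by
        refine integral_congr_ae ?_
        filter_upwards [(ae_map_iff hw.aemeasurable measurableSet_Ici).2 hw0] with v hv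
        have hGv : Measurable fun x => G (x, v) := hGm.comp measurable_prodMk_right
        rw [integral_map hX.aemeasurable hGv.aestronglyMeasurable]
        lift v to ℝ≥0 using hv
        rw [mul_comm, ← hlap s hs v]

variable {T : ℝ≥0 → Ω → ℝ≥0} {w : Ω → ℝ}

theorem ae_eq_valueOfInverse (hD : ∀ᵐ ω ∂P, IsRegularPath fun t => D t ω)
    (hT : ∀ᵐ ω ∂P, ∀ t, T t ω = pathInverse (fun u => D u ω) t) {R : Set ℝ≥0} (hR : Dense R) :
    ∀ᵐ ω ∂P, ∀ v : ℝ≥0, (valueOfInverse R (fun t => T t ω, v)).toReal = D v ω := by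
  filter_upwards [hD, hT] with ω hDω hTω v
  rw [funext hTω, hDω.valueOfInverse_pathInverse hR, ENNReal.toReal_ofReal (hDω.nonneg v)]

theorem IsSubordinator.isPhi_map_comp [IsProbabilityMeasure P] (h : IsSubordinator ψ D P)
    (hD : ∀ᵐ ω ∂P, IsRegularPath fun t => D t ω) (hTm : ∀ t, Measurable (T t))
    (hT : ∀ᵐ ω ∂P, ∀ t, T t ω = pathInverse (fun u => D u ω) t) (hw : Measurable w)
    (hw0 : ∀ᵐ ω ∂P, 0 ≤ w ω) (hind : IndepFun (fun ω t => T t ω) w P) :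
    AEMeasurable (fun ω => D (w ω).toNNReal ω) P ∧
      IsPhi ψ (P.map w) (P.map fun ω => D (w ω).toNNReal ω) := by
  obtain ⟨R, hRc, hRd⟩ := TopologicalSpace.exists_countable_dense ℝ≥0
  have hval := ae_eq_valueOfInverse hD hT hRd
  have hF : Measurable fun x => (valueOfInverse R x).toReal :=
    (measurable_valueOfInverse hRc).ennreal_toReal
  have hTm' : Measurable fun ω t => T t ω := measurable_pi_lambda _ hTm
  have hae : (fun ω => (valueOfInverse R (fun t => T t ω, w ω)).toReal)
      =ᵐ[P] fun ω => D (w ω).toNNReal ω := by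
    filter_upwards [hval, hw0] with ω hω hwω
    rw [← hω, Real.coe_toNNReal _ hwω]
  refine ⟨(hF.comp (hTm'.prodMk hw)).aemeasurable.congr hae, ?_⟩
  rw [← Measure.map_congr hae]
  refine isPhi_map_of_indepFun hF (fun _ => ENNReal.toReal_nonneg) hTm' hw hw0 hind
    fun s hs v => ?_
  rw [← h.laplace_eq v s hs]
  refine integral_congr_ae ?_
  filter_upwards [hval] with ω hω
  rw [hω]

end Subordinator

/-! ### The time at which a path leaves the origin -/

section ExitTime

variable {E : Type*} [NormedAddCommGroup E] {Ω Ω' : Type*} [MeasurableSpace Ω]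
  [MeasurableSpace Ω'] {P : Measure Ω} {P' : Measure Ω'}

theorem jumpPath_eq_zero {j : ℕ → E} {S : ℕ → ℝ} {t : ℝ≥0} (h : ∀ n, (t : ℝ) < S n) :
    jumpPath j S t = 0 := by
  rw [jumpPath_eq_sum (K := 0) fun n _ => h n, Finset.sum_range_zero]

theorem jumpPath_eq_apply_zero {j : ℕ → E} {S : ℕ → ℝ} {t : ℝ≥0} (h0 : S 0 ≤ t)
    (h : ∀ n, 1 ≤ n → (t : ℝ) < S n) : jumpPath j S t = j 0 := by
  rw [jumpPath_eq_sum h, Finset.sum_range_one, if_pos h0]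

/-- `h` is the time at which the path `f` leaves the origin: the infimum of the times at which it
does not vanish. -/
def IsExitTime (f : ℝ≥0 → E) (h : ℝ) : Prop :=
  ∀ a : ℝ, (∃ t : ℝ≥0, (t : ℝ) < a ∧ f t ≠ 0) ↔ h < a

theorem isExitTime_jumpPath {j : ℕ → E} {S : ℕ → ℝ} (hj : j 0 ≠ 0) (h0 : 0 ≤ S 0)
    (hS : StrictMono S) : IsExitTime (jumpPath j S) (S 0) := by
  refine fun a => ⟨?_, fun h => ?_⟩
  · rintro ⟨t, hta, ht⟩
    by_contra! ha
    exact ht (jumpPath_eq_zero fun n => (hta.trans_le ha).trans_le (hS.monotone n.zero_le))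
  · have hcoe : ((S 0).toNNReal : ℝ) = S 0 := Real.coe_toNNReal _ h0
    refine ⟨(S 0).toNNReal, hcoe.symm ▸ h, ?_⟩
    rwa [jumpPath_eq_apply_zero hcoe.ge fun n hn => hcoe.symm ▸ hS (Nat.zero_lt_of_lt hn)]

theorem HasJ1Law.measure_eq {Z : ℝ≥0 → Ω → E} {Q : Measure (Skorokhod E)} (h : HasJ1Law Z Q P)
    {p : (ℝ≥0 → E) → Prop} (hp : MeasurableSet {f : Skorokhod E | p f.1}) :
    P {ω | p fun t => Z t ω} = Q {f | p f.1} := by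
  obtain ⟨z, hz, hzZ⟩ := h
  rw [← hz.map_eq, Measure.map_apply_of_aemeasurable hz.aemeasurable hp]
  refine measure_congr ?_
  filter_upwards [hzZ] with ω hω
  exact congrArg p (funext fun t => (hω t).symm)

theorem SameJ1Law.measure_eq {Z : ℝ≥0 → Ω → E} {Z' : ℝ≥0 → Ω' → E} (h : SameJ1Law Z P Z' P')
    {p : (ℝ≥0 → E) → Prop} (hp : MeasurableSet {f : Skorokhod E | p f.1}) :
    P {ω | p fun t => Z t ω} = P' {ω | p fun t => Z' t ω} := by
  obtain ⟨Q, hZ, hZ'⟩ := h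
  rw [hZ.measure_eq hp, hZ'.measure_eq hp]

theorem SameJ1Law.map_eq_of_isExitTime [IsProbabilityMeasure P] [IsProbabilityMeasure P']
    {Z : ℝ≥0 → Ω → E} {Z' : ℝ≥0 → Ω' → E} (h : SameJ1Law Z P Z' P') {H : Ω → ℝ} {H' : Ω' → ℝ}
    (hH : AEMeasurable H P) (hH' : AEMeasurable H' P')
    (hZ : ∀ᵐ ω ∂P, IsExitTime (fun t => Z t ω) (H ω))
    (hZ' : ∀ᵐ ω ∂P', IsExitTime (fun t => Z' t ω) (H' ω)) : P.map H = P'.map H' := by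
  have := Measure.isProbabilityMeasure_map hH
  have := Measure.isProbabilityMeasure_map hH'
  have hIio : ∀ a, P.map H (Set.Iio a) = P'.map H' (Set.Iio a) := fun a => by
    rw [Measure.map_apply_of_aemeasurable hH measurableSet_Iio,
      Measure.map_apply_of_aemeasurable hH' measurableSet_Iio]
    calc P {ω | H ω < a} = P {ω | ∃ t : ℝ≥0, (t : ℝ) < a ∧ Z t ω ≠ 0} :=
          measure_congr (hZ.mono fun ω hω => propext (hω a).symm)
      _ = P' {ω | ∃ t : ℝ≥0, (t : ℝ) < a ∧ Z' t ω ≠ 0} :=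
          h.measure_eq (p := fun f => ∃ t : ℝ≥0, (t : ℝ) < a ∧ f t ≠ 0)
            (isOpen_exists_ne_zero a).measurableSet
      _ = P' {ω | H' ω < a} := measure_congr (hZ'.mono fun ω hω => propext (hω a))
  refine Measure.ext_of_Ici _ _ fun a => ?_
  rw [← Set.compl_Iio, prob_compl_eq_one_sub measurableSet_Iio,
    prob_compl_eq_one_sub measurableSet_Iio, hIio]

end ExitTime

/-! ### The converse direction -/

section Converse

variable {E : Type*} [NormedAddCommGroup E]

theorem IsRegularPath.timeChange_ctrw_eq {Ω : Type*} {J : ℕ → Ω → E} {W : ℕ → Ω → ℝ}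
    {T : ℝ≥0 → Ω → ℝ≥0} {D : ℝ≥0 → ℝ} (hD : IsRegularPath D) {ω : Ω}
    (hT : ∀ t, T t ω = pathInverse D t) (hreg : (fun k => (J k ω, W k ω)) ∈ regularJumps E) :
    (fun t => timeChange (ctrw J W) T t ω)
      = jumpPath (fun n => J n ω) fun n => D (jumpTime W n ω).toNNReal := by
  have hctrw : (fun v => ctrw J W v ω)
      = jumpPath (fun n => J n ω) fun n => ((jumpTime W n ω).toNNReal : ℝ) := by
    have hcoe : ∀ n, ((jumpTime W n ω).toNNReal : ℝ) = jumpTime W n ω := fun n =>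
      Real.coe_toNNReal _ (Finset.sum_nonneg fun i _ => hreg.1 i)
    simp only [hcoe]
    rfl
  ext t
  rw [← hD.rightLim_leftLim_jumpPath (fun n => J n ω)
    (S := fun n => (jumpTime W n ω).toNNReal) (tendsto_real_toNNReal_atTop.comp hreg.2) t]
  simp only [timeChange, hctrw, hT]

variable [MeasurableSpace E] {Ω : Type*} [MeasurableSpace Ω] {P : Measure Ω}

theorem IsIIDJumps.ae_wait_pos {J : ℕ → Ω → E} {V : ℕ → Ω → ℝ} (hY : IsIIDJumps J V P)
    (hJ : ∀ᵐ ω ∂P, J 0 ω ≠ 0) (hnn : ∀ᵐ ω ∂P, 0 ≤ V 0 ω) (hpos : P.map (V 0) (Set.Ioi 0) ≠ 0)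
    (h0 : ∀ᵐ ω ∂P, ctrw J V 0 ω = 0) : ∀ᵐ ω ∂P, 0 < V 0 ω := by
  -- If `V 0` vanished and `V 1` did not, the walk would be at `J 0 ≠ 0` at time `0`.
  have hnull : P (V 0 ⁻¹' {0} ∩ V 1 ⁻¹' Set.Ioi 0) = 0 := by
    rw [measure_eq_zero_iff_ae_notMem]
    filter_upwards [hJ, h0, hY.ae_mem_regularJumps hnn hpos] with ω hJω h0ω hreg
    rintro ⟨hV0 : V 0 ω = 0, hV1 : 0 < V 1 ω⟩
    refine hJω (Eq.trans (Eq.symm ?_) h0ω)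
    refine jumpPath_eq_apply_zero (j := fun n => J n ω) (S := fun n => jumpTime V n ω)
      ((jumpTime_zero V ω).trans hV0).le fun n hn => hV1.trans_le ?_
    exact Finset.single_le_sum (f := fun i => V i ω) (fun i _ => hreg.1 i)
      (Finset.mem_range.2 (by lia))
  rw [(hY.iIndepFun_wait.indepFun zero_ne_one).measure_inter_preimage_eq_mul _ _
      (measurableSet_singleton 0) measurableSet_Ioi,
    (hY.identDistrib_wait 1).measure_mem_eq measurableSet_Ioi,
    ← Measure.map_apply (hY.measurable_wait 0) measurableSet_Ioi, mul_eq_zero,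
    or_iff_left hpos, measure_eq_zero_iff_ae_notMem] at hnull
  filter_upwards [hnn, hnull] with ω hle hne
  exact lt_of_le_of_ne hle (Ne.symm hne)

theorem IsSubordinator.ae_timeChange_ctrw_eq {ψ : ℝ → ℝ} [IsProbabilityMeasure P]
    {D : ℝ≥0 → Ω → ℝ} (hD : IsSubordinator ψ D P) (hψ : Tendsto ψ atTop atTop) {J : ℕ → Ω → E}
    {W : ℕ → Ω → ℝ} {T : ℝ≥0 → Ω → ℝ≥0} (hX : IsIIDJumps J W P) (hW : ∀ᵐ ω ∂P, 0 < W 0 ω)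
    (hT : ∀ᵐ ω ∂P, ∀ t, T t ω = pathInverse (fun u => D u ω) t) :
    ∀ᵐ ω ∂P, 0 < D (W 0 ω).toNNReal ω ∧
      ∃ S : ℕ → ℝ, StrictMono S ∧ S 0 = D (W 0 ω).toNNReal ω ∧
        (fun t => timeChange (ctrw J W) T t ω) = jumpPath (fun n => J n ω) S := by
  have hWpos : P.map (W 0) (Set.Ioi 0) ≠ 0 := by
    rw [Measure.map_apply (hX.measurable_wait 0) measurableSet_Ioi, Ne,
      measure_eq_zero_iff_ae_notMem]
    intro hnull
    obtain ⟨ω, hpos, hnpos⟩ := (hW.and hnull).exists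
    exact hnpos hpos
  filter_upwards [hD.ae_isRegularPath hψ, hD.ae_strictMono hψ, hW, hT,
    hX.ae_mem_regularJumps (hW.mono fun ω h => h.le) hWpos, hX.ae_strictMono_jumpTime hW]
    with ω hreg hmono hWω hTω hjumps htimes
  refine ⟨?_, _, fun m n hmn => hmono ((Real.toNNReal_lt_toNNReal_iff_of_nonneg ?_).2
    (htimes hmn)), by simp only [jumpTime_zero], hreg.timeChange_ctrw_eq hTω hjumps⟩
  · exact hreg.zero.symm.trans_lt (hmono (Real.toNNReal_pos.2 hWω))
  · exact Finset.sum_nonneg fun i _ => hjumps.1 i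

theorem mem_layer_of_sameJ1Law {ψ : ℝ → ℝ} {b : ℝ} {μ : Measure ℝ}
    (hψ : HasCharacteristics ψ 0 b μ) (hψb : ¬ BddAbove (ψ '' Set.Ioi 0))
    (hμ : SubHomogeneous μ ∨ SuperHomogeneous μ) [IsProbabilityMeasure P]
    {Ω' : Type*} [MeasurableSpace Ω'] {P' : Measure Ω'} [IsProbabilityMeasure P']
    {J : ℕ → Ω → E} {V : ℕ → Ω → ℝ} (hY : IsIIDJumps J V P) (hV : P.map (V 0) ∈ layer ψ)
    (hJ : ∀ᵐ ω ∂P, J 0 ω ≠ 0)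
    {J' : ℕ → Ω' → E} {W : ℕ → Ω' → ℝ} {T : ℝ≥0 → Ω' → ℝ≥0} (hX : IsIIDJumps J' W P')
    (hJ' : ∀ᵐ ω ∂P', J' 0 ω ≠ 0) (hW : ∀ᵐ ω ∂P', 0 < W 0 ω) (hT : IsInverseSubordinator ψ T P')
    (hind : IndepFun (fun ω t => T t ω) (fun ω k => W k ω) P')
    (hlaw : SameJ1Law (ctrw J V) P (timeChange (ctrw J' W) T) P') :
    P.map (V 0) ∈ layerImage id ψ ∧ P'.map (W 0) ∈ layer id := by
  obtain ⟨hTm, D, hD, hTD⟩ := hT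
  have hVnn := (map_mem_probHalfLine_iff (hY.measurable_wait 0).aemeasurable).1 hV.1
  have hψlim := hψ.tendsto_atTop_atTop hψb
  have hpath := hD.ae_timeChange_ctrw_eq hψlim hX hW hTD
  obtain ⟨hHm, hΦ⟩ := hD.isPhi_map_comp (hD.ae_isRegularPath hψlim) hTm hTD
    (hX.measurable_wait 0) (hW.mono fun ω h => h.le)
    (hind.comp (φ := id) measurable_id (measurable_pi_apply 0))
  have hstart : ∀ᵐ ω ∂P, ctrw J V 0 ω = 0 := by
    refine (hlaw.measure_eq (p := fun f => f 0 ≠ 0) isOpen_apply_zero_ne_zero.measurableSet).trans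
      ?_
    rw [measure_eq_zero_iff_ae_notMem]
    filter_upwards [hpath] with ω ⟨hpos, S, hS, hS0, hZ⟩
    exact not_not.2 ((congrFun hZ 0).trans (jumpPath_eq_zero fun n =>
      (hpos.trans_eq hS0.symm).trans_le (hS.monotone n.zero_le)))
  have hVpos := hY.ae_wait_pos hJ hVnn (measure_Ioi_ne_zero_of_mem_layer hV) hstart
  have hmap : P.map (V 0) = P'.map fun ω => D (W 0 ω).toNNReal ω := by
    refine hlaw.map_eq_of_isExitTime (hY.measurable_wait 0).aemeasurable hHm ?_ ?_
    · filter_upwards [hJ, hVpos, hY.ae_strictMono_jumpTime hVpos] with ω hJω hVω hS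
      have hexit := isExitTime_jumpPath (j := fun n => J n ω) hJω
        (hVω.trans_eq (jumpTime_zero V ω).symm).le hS
      rwa [jumpTime_zero] at hexit
    · filter_upwards [hJ', hpath] with ω hJω ⟨hpos, S, hS, hS0, hZ⟩
      rw [hZ, ← hS0]
      exact isExitTime_jumpPath (j := fun n => J' n ω) hJω (hpos.trans_eq hS0.symm).le hS
  rw [← hmap] at hΦ
  have hWid := hΦ.mem_layer_id hψ hψb hμ hV
  exact ⟨⟨_, hWid, hΦ⟩, hWid⟩

end Converse

/-! ### Poisson point processes -/

section Poisson

theorem integral_prod_infinitePi {ι 𝕜 : Type*} [RCLike 𝕜] {X : ι → Type*}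
    [∀ i, MeasurableSpace (X i)] {ν : ∀ i, Measure (X i)} [∀ i, IsProbabilityMeasure (ν i)]
    {f : ∀ i, X i → 𝕜} (hf : ∀ i, Measurable (f i)) (s : Finset ι) :
    ∫ x, ∏ i ∈ s, f i (x i) ∂(Measure.infinitePi ν) = ∏ i ∈ s, ∫ x, f i x ∂(ν i) := by
  have hprod : Measurable fun x : ∀ i : s, X i => ∏ i : s, f i (x i) :=
    Finset.measurable_fun_prod _ fun i _ => (hf i).comp (measurable_pi_apply i)
  have hrestrict := integral_restrict_infinitePi (μ := ν) hprod.aestronglyMeasurable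
  rw [integral_fintype_prod_eq_prod fun (i : s) x => f i x] at hrestrict
  rw [← Finset.prod_coe_sort s fun i => ∫ x, f i x ∂(ν i), ← hrestrict]
  simp only [Finset.restrict, ← Finset.prod_coe_sort s]

theorem integral_const_pow_poissonMeasure (r : ℝ≥0) (c : ℂ) :
    ∫ n, c ^ n ∂(poissonMeasure r) = Complex.exp (r * (c - 1)) := by
  have hexp : Complex.exp (r * c) = ∑' n : ℕ, (r * c) ^ n / (n.factorial : ℂ) := by
    rw [Complex.exp_eq_exp_ℂ, NormedSpace.exp_eq_tsum_div]
  rw [integral_poissonMeasure, mul_sub_one, sub_eq_neg_add, Complex.exp_add, hexp, ← tsum_mul_left]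
  refine tsum_congr fun n => ?_
  rw [Complex.real_smul, mul_pow]
  push_cast
  ring

variable {S : Type*} [MeasurableSpace S]

theorem exists_smul_probability [Nonempty S] (κ : Measure S) [IsFiniteMeasure κ] :
    ∃ (r : ℝ≥0) (η : Measure S), IsProbabilityMeasure η ∧ κ = r • η := by
  let κ' : FiniteMeasure S := ⟨κ, inferInstance⟩
  exact ⟨κ'.mass, κ'.normalize, inferInstance,
    congrArg Subtype.val κ'.self_eq_mass_smul_normalize⟩

/-- The law of a finite Poisson configuration with intensity `r • η`, encoded as a Poisson number of
points together with an i.i.d. sequence with law `η` of which only so many terms are points. -/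
noncomputable def poissonPoints (r : ℝ≥0) (η : Measure S) : Measure (ℕ × (ℕ → S)) :=
  (poissonMeasure r).prod (Measure.infinitePi fun _ => η)

instance (r : ℝ≥0) (η : Measure S) [IsProbabilityMeasure η] :
    IsProbabilityMeasure (poissonPoints r η) := by
  unfold poissonPoints; infer_instance

/-- The sum of `h` over the points of a finite configuration `p`, encoded as in `poissonPoints`. -/
def pointSum {S M : Type*} [AddCommMonoid M] (h : S → M) (p : ℕ × (ℕ → S)) : M :=
  ∑ i ∈ Finset.range p.1, h (p.2 i)

section Measurability

variable {T : Type*} [MeasurableSpace T] {M : Type*} [AddCommMonoid M] [MeasurableSpace M]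
  [MeasurableAdd₂ M]

theorem measurable_pointSum_comp {h : T → S → M} (hh : Measurable (Function.uncurry h))
    {p : T → ℕ × (ℕ → S)} (hp : Measurable p) : Measurable fun t => pointSum (h t) (p t) := by
  have hsum : Measurable fun q : ℕ × T × (ℕ → S) => pointSum (h q.2.1) (q.1, q.2.2) :=
    measurable_from_prod_countable_right fun n =>
      Finset.measurable_fun_sum (Finset.range n) fun i _ =>
        hh.comp (measurable_fst.prodMk ((measurable_pi_apply i).comp measurable_snd))
  exact hsum.comp (hp.fst.prodMk (measurable_id.prodMk hp.snd))

theorem measurable_pointSum {h : S → M} (hh : Measurable h) : Measurable (pointSum h) :=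
  measurable_pointSum_comp (h := fun _ => h) (hh.comp measurable_snd) measurable_id

end Measurability

theorem norm_cexp_le_one {z : ℂ} (hz : z.re ≤ 0) : ‖Complex.exp z‖ ≤ 1 := by
  rw [Complex.norm_exp]
  exact Real.exp_le_one_iff.2 hz

theorem re_pointSum_nonpos {S : Type*} {h : S → ℂ} (hre : ∀ x, (h x).re ≤ 0) (p : ℕ × (ℕ → S)) :
    (pointSum h p).re ≤ 0 := by
  rw [pointSum, Complex.re_sum]
  exact Finset.sum_nonpos fun i _ => hre _

theorem integral_cexp_pointSum (r : ℝ≥0) (η : Measure S) [IsProbabilityMeasure η] {h : S → ℂ}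
    (hh : Measurable h) (hre : ∀ x, (h x).re ≤ 0) :
    ∫ p, Complex.exp (pointSum h p) ∂(poissonPoints r η)
      = Complex.exp (∫ x, (Complex.exp (h x) - 1) ∂(r • η)) := by
  have hexp : Measurable fun x => Complex.exp (h x) := hh.cexp
  have hint : Integrable (fun x => Complex.exp (h x)) η :=
    Integrable.of_bound hexp.aestronglyMeasurable 1 (ae_of_all _ fun x => norm_cexp_le_one (hre x))
  have hintp : Integrable (fun p => Complex.exp (pointSum h p)) (poissonPoints r η) :=
    Integrable.of_bound (measurable_pointSum hh).cexp.aestronglyMeasurable 1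
      (ae_of_all _ fun p => norm_cexp_le_one (re_pointSum_nonpos hre p))
  calc ∫ p, Complex.exp (pointSum h p) ∂(poissonPoints r η)
      = ∫ n, ∫ x, Complex.exp (pointSum h (n, x)) ∂(Measure.infinitePi fun _ => η)
          ∂(poissonMeasure r) := integral_prod _ hintp
    _ = ∫ n, (∫ x, Complex.exp (h x) ∂η) ^ n ∂(poissonMeasure r) := by
        refine integral_congr_ae (ae_of_all _ fun n => ?_)
        simp only [pointSum, Complex.exp_sum, integral_prod_infinitePi fun _ : ℕ => hexp,
          Finset.prod_const, Finset.card_range]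
    _ = Complex.exp (∫ x, (Complex.exp (h x) - 1) ∂(r • η)) := by
        rw [integral_const_pow_poissonMeasure, integral_smul_nnreal_measure,
          integral_sub hint (integrable_const _), integral_const, probReal_univ, one_smul,
          NNReal.smul_def, Complex.real_smul]

/-- The law of a sequence of independent finite Poisson configurations, with intensities
`r n • η n`; together they form a Poisson point process with intensity `∑ n, r n • η n`. -/
noncomputable def poissonProcess (r : ℕ → ℝ≥0) (η : ℕ → Measure S) :
    Measure (ℕ → ℕ × (ℕ → S)) :=
  Measure.infinitePi fun n => poissonPoints (r n) (η n)

variable {r : ℕ → ℝ≥0} {η : ℕ → Measure S} [∀ n, IsProbabilityMeasure (η n)]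

instance : IsProbabilityMeasure (poissonProcess r η) := by
  unfold poissonProcess; infer_instance

theorem integral_cexp_sum_pointSum {h : S → ℂ} (hh : Measurable h) (hre : ∀ x, (h x).re ≤ 0)
    (s : Finset ℕ) : ∫ ω, Complex.exp (∑ n ∈ s, pointSum h (ω n)) ∂(poissonProcess r η)
      = Complex.exp (∑ n ∈ s, ∫ x, (Complex.exp (h x) - 1) ∂(r n • η n)) := by
  simp only [Complex.exp_sum, poissonProcess, ← integral_cexp_pointSum (r _) (η _) hh hre]
  exact integral_prod_infinitePi (fun _ => (measurable_pointSum hh).cexp) s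

variable {m : Measure S}

theorem integral_eq_cexp_of_tendsto (hm : m = Measure.sum fun n => r n • η n)
    {h : S → ℂ} (hh : Measurable h) (hre : ∀ x, (h x).re ≤ 0)
    (hint : Integrable (fun x => Complex.exp (h x) - 1) m) {U : (ℕ → ℕ × (ℕ → S)) → ℂ}
    (hU : ∀ᵐ ω ∂(poissonProcess r η), Tendsto
      (fun M => Complex.exp (∑ n ∈ Finset.range M, pointSum h (ω n))) atTop (𝓝 (U ω))) :
    ∫ ω, U ω ∂(poissonProcess r η) = Complex.exp (∫ x, (Complex.exp (h x) - 1) ∂m) := by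
  have hlim : Tendsto (fun M => ∫ ω, Complex.exp (∑ n ∈ Finset.range M, pointSum h (ω n))
      ∂(poissonProcess r η)) atTop (𝓝 (∫ ω, U ω ∂(poissonProcess r η))) := by
    refine tendsto_integral_of_dominated_convergence (fun _ => 1) (fun M => ?_)
      (integrable_const _) (fun M => ae_of_all _ fun ω => norm_cexp_le_one ?_) hU
    · exact (Finset.measurable_fun_sum _ fun n _ => (measurable_pointSum hh).comp
        (measurable_pi_apply n)).cexp.aestronglyMeasurable
    · rw [Complex.re_sum]
      exact Finset.sum_nonpos fun n _ => re_pointSum_nonpos hre _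
  simp_rw [integral_cexp_sum_pointSum hh hre] at hlim
  rw [hm] at hint ⊢
  exact tendsto_nhds_unique hlim
    ((Complex.continuous_exp.tendsto _).comp (hasSum_integral_measure hint).tendsto_sum_nat)

/-- The sum of `g` over all the points of a sequence of finite configurations. -/
noncomputable def totalSum {S : Type*} (g : S → ℝ≥0) (ω : ℕ → ℕ × (ℕ → S)) : ℝ≥0∞ :=
  ∑' n, ((pointSum g (ω n) : ℝ≥0) : ℝ≥0∞)

theorem measurable_totalSum_comp {T : Type*} [MeasurableSpace T] {g : T → S → ℝ≥0}
    (hg : Measurable (Function.uncurry g)) {f : T → ℕ → ℕ × (ℕ → S)} (hf : Measurable f) :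
    Measurable fun t => totalSum (g t) (f t) :=
  Measurable.tsum fun n =>
    (measurable_pointSum_comp hg ((measurable_pi_apply n).comp hf)).coe_nnreal_ennreal

theorem measurable_totalSum {g : S → ℝ≥0} (hg : Measurable g) : Measurable (totalSum g) :=
  measurable_totalSum_comp (g := fun _ => g) (hg.comp measurable_snd) measurable_id

theorem totalSum_mono {S : Type*} {g g' : S → ℝ≥0} (h : g ≤ g') (ω : ℕ → ℕ × (ℕ → S)) :
    totalSum g ω ≤ totalSum g' ω :=
  ENNReal.tsum_le_tsum fun _ => ENNReal.coe_le_coe.2 (Finset.sum_le_sum fun _ _ => h _)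

theorem totalSum_zero {S : Type*} (ω : ℕ → ℕ × (ℕ → S)) : totalSum 0 ω = 0 := by
  simp [totalSum, pointSum]

theorem hasSum_totalSum {S : Type*} {g : S → ℝ≥0} {ω : ℕ → ℕ × (ℕ → S)} (h : totalSum g ω ≠ ∞) :
    HasSum (fun n => ((pointSum g (ω n) : ℝ≥0) : ℝ)) (totalSum g ω).toReal := by
  have hs := ENNReal.tsum_coe_ne_top_iff_summable.1 h
  rw [totalSum, ← ENNReal.coe_tsum hs, ENNReal.coe_toReal, NNReal.coe_tsum]
  exact (NNReal.summable_coe.2 hs).hasSum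

theorem tendsto_exp_neg_mul_sum_pointSum {S : Type*} (g : S → ℝ≥0) {s : ℝ} (hs : 0 < s)
    (ω : ℕ → ℕ × (ℕ → S)) :
    Tendsto (fun M => Real.exp (-(s * ∑ n ∈ Finset.range M, ((pointSum g (ω n) : ℝ≥0) : ℝ)))) atTop
      (𝓝 ({ω | totalSum g ω ≠ ∞}.indicator
        (fun ω => Real.exp (-(s * (totalSum g ω).toReal))) ω)) := by
  by_cases hω : totalSum g ω = ∞
  · rw [Set.indicator_of_notMem (not_not.2 hω)]
    refine Real.tendsto_exp_neg_atTop_nhds_zero.comp (Tendsto.const_mul_atTop hs ?_)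
    rwa [← not_summable_iff_tendsto_nat_atTop_of_nonneg fun k => NNReal.coe_nonneg _,
      NNReal.summable_coe, ← ENNReal.tsum_coe_ne_top_iff_summable, not_not]
  · rw [Set.indicator_of_mem hω]
    exact (Real.continuous_exp.tendsto _).comp
      ((hasSum_totalSum hω).tendsto_sum_nat.const_mul s).neg

theorem isLevyMeasure_map {g : S → ℝ≥0} (hg : Measurable g)
    (hint : Integrable (fun x => min 1 (g x : ℝ)) m) :
    IsLevyMeasure (m.map fun x => (g x : ℝ)) :=
  ⟨(ae_map_iff (by fun_prop) measurableSet_Ici).2 (ae_of_all _ fun x => (g x).2),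
    (integrable_map_measure (by fun_prop) (by fun_prop)).2 hint⟩

theorem integral_exp_neg_totalSum (hm : m = Measure.sum fun n => r n • η n) {g : S → ℝ≥0}
    (hg : Measurable g) (hint : Integrable (fun x => min 1 (g x : ℝ)) m) {s : ℝ} (hs : 0 < s) :
    ∫ ω, {ω | totalSum g ω ≠ ∞}.indicator (fun ω => Real.exp (-(s * (totalSum g ω).toReal))) ω
        ∂(poissonProcess r η)
      = Real.exp (-laplaceExponent (m.map fun x => (g x : ℝ)) s) := by
  have hexp : Integrable (fun x => 1 - Real.exp (-(s * g x))) m :=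
    ((isLevyMeasure_map hg hint).integrable_one_sub_exp hs.le).comp_measurable (by fun_prop)
  have hneg (x : S) : Complex.exp ((-(s * g x) : ℝ) : ℂ) - 1
      = ((-(1 - Real.exp (-(s * g x))) : ℝ) : ℂ) := by
    push_cast
    ring
  have hre (x : S) : ((-(s * g x) : ℝ) : ℂ).re ≤ 0 := by
    rw [Complex.ofReal_re]
    exact neg_nonpos.2 (mul_nonneg hs.le (g x).2)
  have hlaplace := integral_eq_cexp_of_tendsto hm (h := fun x => ((-(s * g x) : ℝ) : ℂ))
    (by fun_prop) hre (by simp only [hneg]; exact hexp.neg.ofReal) (ae_of_all _ fun ω => by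
      refine ((Complex.continuous_ofReal.tendsto _).comp
        (tendsto_exp_neg_mul_sum_pointSum g hs ω)).congr fun M => ?_
      simp only [Function.comp_apply, Complex.ofReal_exp, pointSum]
      push_cast
      simp only [Finset.mul_sum, Finset.sum_neg_distrib])
  simp only [hneg] at hlaplace
  rw [integral_complex_ofReal, integral_complex_ofReal, ← Complex.ofReal_exp, Complex.ofReal_inj,
    integral_neg] at hlaplace
  rw [hlaplace, laplaceExponent, integral_map (by fun_prop) (by fun_prop)]

/-- The probability that the sum is finite is at least its Laplace transform at any `s > 0`, which
tends to `1` as `s → 0`. -/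
theorem ae_totalSum_ne_top (hm : m = Measure.sum fun n => r n • η n) {g : S → ℝ≥0}
    (hg : Measurable g) (hint : Integrable (fun x => min 1 (g x : ℝ)) m) :
    ∀ᵐ ω ∂(poissonProcess r η), totalSum g ω ≠ ∞ := by
  have hset : MeasurableSet {ω | totalSum g ω ≠ ∞} :=
    measurable_totalSum hg (measurableSet_singleton ∞).compl
  have hlevy := isLevyMeasure_map hg hint
  have hlim : Tendsto (fun s => Real.exp (-laplaceExponent (m.map fun x => (g x : ℝ)) s))
      (𝓝[>] 0) (𝓝 1) := by
    have hcont := (hlevy.continuousOn_laplaceExponent 0 Set.self_mem_Ici).tendsto.mono_left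
      (nhdsWithin_mono _ Set.Ioi_subset_Ici_self)
    simpa [laplaceExponent] using hcont.neg.rexp
  have hone : 1 ≤ (poissonProcess r η).real {ω | totalSum g ω ≠ ∞} := by
    refine le_of_tendsto hlim ?_
    filter_upwards [self_mem_nhdsWithin] with s (hs : 0 < s)
    rw [← integral_exp_neg_totalSum hm hg hint hs, ← integral_indicator_one hset]
    refine integral_mono_of_nonneg (ae_of_all _ fun ω => ?_)
      ((integrable_const _).indicator hset) (ae_of_all _ fun ω => ?_)
    · exact Set.indicator_nonneg (fun _ _ => (Real.exp_pos _).le) ω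
    · refine Set.indicator_le_indicator (Real.exp_le_one_iff.2 (neg_nonpos.2 ?_))
      exact mul_nonneg hs.le ENNReal.toReal_nonneg
  refine (prob_compl_eq_zero_iff hset).2 ((ENNReal.toReal_eq_one_iff _).1 ?_)
  exact le_antisymm measureReal_le_one hone

end Poisson

/-! ### The jumps of a subordinator as a Poisson point process -/

section Subordinator

variable {μ : Measure ℝ} {b : ℝ}

theorem HasCharacteristics.sFinite {ψ : ℝ → ℝ} (h : HasCharacteristics ψ 0 b μ) : SFinite μ := by
  have hfin : IsFiniteMeasure (μ.withDensity fun y => ENNReal.ofReal (min 1 y)) :=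
    isFiniteMeasure_withDensity h.integrable.ne
  rw [← withDensity_inv_same (μ := μ) (f := fun y => ENNReal.ofReal (min 1 y)) (by fun_prop) ?_
    (ae_of_all _ fun y => ENNReal.ofReal_ne_top)]
  · infer_instance
  · filter_upwards [measure_eq_zero_iff_ae_notMem.1 h.concentrated] with y hy
    exact (ENNReal.ofReal_pos.2 (lt_min one_pos (not_le.1 hy))).ne'

/-- The integral `∫ (e^{z y} - 1) μ(dy)`, the continuation of `z ↦ -laplaceExponent μ (-z)` to
`Re z ≤ 0`. -/
noncomputable def levyIntegral (μ : Measure ℝ) (z : ℂ) : ℂ :=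
  ∫ y : ℝ, (Complex.exp (z * y) - 1) ∂μ

theorem levyIntegral_neg_ofReal (μ : Measure ℝ) (s : ℝ) :
    levyIntegral μ (-s : ℝ) = ((-laplaceExponent μ s : ℝ) : ℂ) := by
  rw [levyIntegral, laplaceExponent, ← integral_neg, ← integral_complex_ofReal]
  refine integral_congr_ae (ae_of_all _ fun y => ?_)
  push_cast
  ring_nf

theorem norm_cexp_mul_sub_one_le {z : ℂ} (hz : z.re ≤ 0) {y : ℝ} (hy : 0 ≤ y) :
    ‖Complex.exp (z * y) - 1‖ ≤ 2 * max 1 ‖z‖ * min 1 y := by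
  have htwo : ‖Complex.exp (z * y) - 1‖ ≤ 2 := by
    have hre : (z * y).re ≤ 0 := by
      rw [Complex.re_mul_ofReal]
      exact mul_nonpos_of_nonpos_of_nonneg hz hy
    refine (norm_sub_le _ _).trans ?_
    rw [norm_one]
    linarith [norm_cexp_le_one hre]
  rcases le_total y 1 with hy1 | hy1
  · rw [min_eq_right hy1, mul_assoc]
    refine le_trans ?_ (mul_le_mul_of_nonneg_left
      (mul_le_mul_of_nonneg_right (le_max_right 1 ‖z‖) hy) zero_le_two)
    have hnorm : ‖z * (y : ℂ)‖ = ‖z‖ * y := by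
      rw [norm_mul, Complex.norm_real, Real.norm_of_nonneg hy]
    rcases le_total ‖z * (y : ℂ)‖ 1 with h | h
    · exact (Complex.norm_exp_sub_one_le h).trans_eq (by rw [hnorm])
    · linarith
  · rw [min_eq_left hy1]
    linarith [le_max_left 1 ‖z‖]

theorem IsLevyMeasure.integrable_cexp_mul_sub_one (h : IsLevyMeasure μ) {z : ℂ} (hz : z.re ≤ 0) :
    Integrable (fun y : ℝ => Complex.exp (z * y) - 1) μ := by
  refine (h.integrable_min.const_mul (2 * max 1 ‖z‖)).mono' (by fun_prop) ?_
  filter_upwards [h.ae_nonneg] with y hy using norm_cexp_mul_sub_one_le hz hy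

/-- The intensity measure of the point process of the jumps of a subordinator with Lévy measure
`μ`; a point `(u, y)` is a jump of size `y` at the time `u`. -/
noncomputable def jumpIntensity (μ : Measure ℝ) : Measure (ℝ × ℝ≥0) :=
  (volume : Measure ℝ).prod (μ.map Real.toNNReal)

section Mark

variable {F : Type*} [NormedAddCommGroup F] {f : ℝ → F}

theorem IsLevyMeasure.integrable_map_toNNReal (h : IsLevyMeasure μ) (hf : Integrable f μ) :
    Integrable (fun y : ℝ≥0 => f y) (μ.map Real.toNNReal) := by
  refine Integrable.comp_measurable (f := fun y : ℝ≥0 => (y : ℝ)) ?_ measurable_coe_nnreal_real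
  rwa [map_coe_map_toNNReal h.ae_nonneg]

theorem IsLevyMeasure.integral_map_toNNReal [NormedSpace ℝ F] (h : IsLevyMeasure μ)
    (hf : AEStronglyMeasurable f μ) :
    ∫ y : ℝ≥0, f y ∂(μ.map Real.toNNReal) = ∫ y, f y ∂μ := by
  rw [← integral_map (φ := fun y : ℝ≥0 => (y : ℝ)) measurable_coe_nnreal_real.aemeasurable,
    map_coe_map_toNNReal h.ae_nonneg]
  rwa [map_coe_map_toNNReal h.ae_nonneg]

end Mark

theorem integrable_indicator_Ioc (s t : ℝ) {F : Type*} [NormedAddCommGroup F] (c : F) :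
    Integrable ((Set.Ioc s t).indicator fun _ => c) volume :=
  (integrableOn_const measure_Ioc_lt_top.ne).integrable_indicator measurableSet_Ioc

/-- The contribution of the jump `x = (time, size)` to the sum of the jumps in `(0, t]`. -/
noncomputable def jumpUpTo (t : ℝ≥0) (x : ℝ × ℝ≥0) : ℝ≥0 :=
  (Set.Ioc 0 (t : ℝ)).indicator (fun _ => x.2) x.1

theorem measurable_uncurry_jumpUpTo : Measurable (Function.uncurry jumpUpTo) := by
  have hpos : MeasurableSet {p : ℝ≥0 × ℝ × ℝ≥0 | 0 < p.2.1} :=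
    measurableSet_lt measurable_const (by fun_prop)
  have hle : MeasurableSet {p : ℝ≥0 × ℝ × ℝ≥0 | p.2.1 ≤ p.1} :=
    measurableSet_le (by fun_prop) (by fun_prop)
  exact measurable_snd.snd.indicator (hpos.inter hle)

theorem measurable_jumpUpTo (t : ℝ≥0) : Measurable (jumpUpTo t) :=
  measurable_uncurry_jumpUpTo.comp measurable_prodMk_left

theorem jumpUpTo_zero : jumpUpTo 0 = 0 := by
  ext x
  simp [jumpUpTo]

theorem monotone_jumpUpTo : Monotone jumpUpTo := fun _ _ hst _ =>
  Set.indicator_le_indicator_of_subset (Set.Ioc_subset_Ioc_right (NNReal.coe_le_coe.2 hst))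
    (fun _ => zero_le) _

theorem jumpUpTo_sub {s t : ℝ≥0} (hst : s ≤ t) (x : ℝ × ℝ≥0) :
    (jumpUpTo t x : ℝ) - jumpUpTo s x
      = (Set.Ioc (s : ℝ) t).indicator (fun _ => (x.2 : ℝ)) x.1 := by
  have hst' : (s : ℝ) ≤ t := hst
  have hs : (0 : ℝ) ≤ s := s.2
  simp only [jumpUpTo, Set.indicator_apply, Set.mem_Ioc]
  split_ifs <;> grind [NNReal.coe_zero]

theorem IsLevyMeasure.integrable_min_jumpUpTo (h : IsLevyMeasure μ) (t : ℝ≥0) :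
    Integrable (fun x => min 1 (jumpUpTo t x : ℝ)) (jumpIntensity μ) := by
  refine ((integrable_indicator_Ioc 0 (t : ℝ) (1 : ℝ)).mul_prod
    (h.integrable_map_toNNReal h.integrable_min)).congr (ae_of_all _ fun x => ?_)
  by_cases hx : x.1 ∈ Set.Ioc 0 (t : ℝ) <;> simp [jumpUpTo, hx]

/-- The contribution of the jump `x` to `∑ j, z j * (X (t (j + 1)) - X (t j))`, where `X` is the
sum of the jumps up to a given time. -/
noncomputable def incrementExponent {n : ℕ} (t : Fin (n + 1) → ℝ≥0) (z : Fin n → ℂ)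
    (x : ℝ × ℝ≥0) : ℂ :=
  ∑ j, z j * ((jumpUpTo (t j.succ) x : ℝ) - (jumpUpTo (t j.castSucc) x : ℝ) : ℝ)

section incrementExponent

variable {n : ℕ} {t : Fin (n + 1) → ℝ≥0} {z : Fin n → ℂ}

theorem measurable_incrementExponent (t : Fin (n + 1) → ℝ≥0) (z : Fin n → ℂ) :
    Measurable (incrementExponent t z) := by
  have := measurable_jumpUpTo
  unfold incrementExponent
  fun_prop

theorem re_incrementExponent_nonpos (ht : Monotone t) (hz : ∀ j, (z j).re ≤ 0) (x : ℝ × ℝ≥0) :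
    (incrementExponent t z x).re ≤ 0 := by
  rw [incrementExponent, Complex.re_sum]
  refine Finset.sum_nonpos fun j _ => ?_
  rw [Complex.re_mul_ofReal]
  refine mul_nonpos_of_nonpos_of_nonneg (hz j) (sub_nonneg.2 (NNReal.coe_le_coe.2 ?_))
  exact monotone_jumpUpTo (ht (Fin.castSucc_le_succ j)) x

theorem pairwise_disjoint_Ioc_castSucc_succ {α : Type*} [Preorder α] {t : Fin (n + 1) → α}
    (ht : Monotone t) :
    Pairwise (Function.onFun Disjoint fun j : Fin n => Set.Ioc (t j.castSucc) (t j.succ)) := by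
  refine (pairwise_disjoint_on _).2 fun i j hij => Set.disjoint_left.2 fun x hxi hxj => ?_
  exact (hxi.2.trans (ht (Fin.succ_le_castSucc_iff.2 hij))).not_gt hxj.1

theorem cexp_sum_indicator_sub_one {ι α : Type*} [Fintype ι] {A : ι → Set α}
    (hA : Pairwise (Function.onFun Disjoint A)) (c : ι → ℂ) (x : α) :
    Complex.exp (∑ j, (A j).indicator (fun _ => c j) x) - 1
      = ∑ j, (A j).indicator (fun _ => Complex.exp (c j) - 1) x := by
  by_cases hx : ∃ j, x ∈ A j
  · obtain ⟨j, hj⟩ := hx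
    have hne (i : ι) (hij : i ≠ j) : x ∉ A i := Set.disjoint_right.1 (hA hij) hj
    rw [Fintype.sum_eq_single j fun i hij => Set.indicator_of_notMem (hne i hij) _,
      Fintype.sum_eq_single j fun i hij => Set.indicator_of_notMem (hne i hij) _,
      Set.indicator_of_mem hj, Set.indicator_of_mem hj]
  · have hx' (i : ι) : x ∉ A i := fun hi => hx ⟨i, hi⟩
    simp [hx']

theorem cexp_incrementExponent_sub_one (ht : Monotone t) (x : ℝ × ℝ≥0) :
    Complex.exp (incrementExponent t z x) - 1
      = ∑ j : Fin n, (Set.Ioc (t j.castSucc : ℝ) (t j.succ)).indicator (fun _ => (1 : ℂ)) x.1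
        * (Complex.exp (z j * (x.2 : ℝ)) - 1) := by
  have hj (j : Fin n) : z j * ((jumpUpTo (t j.succ) x : ℝ) - (jumpUpTo (t j.castSucc) x : ℝ) : ℝ)
      = (Set.Ioc (t j.castSucc : ℝ) (t j.succ)).indicator (fun _ => z j * (x.2 : ℝ)) x.1 := by
    rw [jumpUpTo_sub (ht (Fin.castSucc_le_succ j)), Set.indicator_apply, Set.indicator_apply]
    split_ifs <;> simp
  have hdisj : Pairwise (Function.onFun Disjoint fun j : Fin n =>
      Set.Ioc (t j.castSucc : ℝ) (t j.succ)) :=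
    pairwise_disjoint_Ioc_castSucc_succ (NNReal.coe_mono.comp ht)
  rw [incrementExponent, Finset.sum_congr rfl fun j _ => hj j, cexp_sum_indicator_sub_one hdisj]
  simp only [Set.indicator_apply, ite_mul, one_mul, zero_mul]

theorem IsLevyMeasure.integrable_cexp_incrementExponent (h : IsLevyMeasure μ)
    (ht : Monotone t) (hz : ∀ j, (z j).re ≤ 0) :
    Integrable (fun x => Complex.exp (incrementExponent t z x) - 1) (jumpIntensity μ) := by
  simp_rw [cexp_incrementExponent_sub_one ht]
  exact integrable_finsetSum _ fun j _ => (integrable_indicator_Ioc _ _ 1).mul_prod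
    (h.integrable_map_toNNReal (h.integrable_cexp_mul_sub_one (hz j)))

theorem IsLevyMeasure.integral_cexp_incrementExponent [SFinite μ] (h : IsLevyMeasure μ)
    (ht : Monotone t) (hz : ∀ j, (z j).re ≤ 0) :
    ∫ x, (Complex.exp (incrementExponent t z x) - 1) ∂(jumpIntensity μ)
      = ∑ j : Fin n, ((t j.succ : ℝ) - t j.castSucc : ℝ) * levyIntegral μ (z j) := by
  have hint (j : Fin n) := h.integrable_cexp_mul_sub_one (hz j)
  simp_rw [cexp_incrementExponent_sub_one ht]
  rw [jumpIntensity, integral_finsetSum _ fun j _ => (integrable_indicator_Ioc _ _ 1).mul_prod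
    (h.integrable_map_toNNReal (hint j))]
  refine Finset.sum_congr rfl fun j _ => ?_
  have hle : (t j.castSucc : ℝ) ≤ t j.succ := NNReal.coe_le_coe.2 (ht (Fin.castSucc_le_succ j))
  rw [integral_prod_mul ((Set.Ioc (t j.castSucc : ℝ) (t j.succ)).indicator fun _ => (1 : ℂ))
    (fun y : ℝ≥0 => Complex.exp (z j * (y : ℝ)) - 1), integral_indicator measurableSet_Ioc,
    setIntegral_const, Real.volume_real_Ioc_of_le hle, Complex.real_smul, mul_one,
    h.integral_map_toNNReal (hint j).aestronglyMeasurable, levyIntegral]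

end incrementExponent

theorem pointSum_incrementExponent {n : ℕ} (t : Fin (n + 1) → ℝ≥0) (z : Fin n → ℂ)
    (p : ℕ × (ℕ → ℝ × ℝ≥0)) :
    pointSum (incrementExponent t z) p = ∑ j : Fin n, z j *
      (((pointSum (jumpUpTo (t j.succ)) p : ℝ≥0) : ℝ)
        - ((pointSum (jumpUpTo (t j.castSucc)) p : ℝ≥0) : ℝ) : ℝ) := by
  simp only [pointSum, incrementExponent]
  rw [Finset.sum_comm]
  refine Finset.sum_congr rfl fun j _ => ?_
  push_cast
  rw [← Finset.sum_sub_distrib, Finset.mul_sum]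

theorem tendsto_sum_pointSum_incrementExponent {n : ℕ} (t : Fin (n + 1) → ℝ≥0) (z : Fin n → ℂ)
    {ω : ℕ → ℕ × (ℕ → ℝ × ℝ≥0)} (h : ∀ j, totalSum (jumpUpTo (t j)) ω ≠ ∞) :
    Tendsto (fun M => ∑ k ∈ Finset.range M, pointSum (incrementExponent t z) (ω k)) atTop
      (𝓝 (∑ j : Fin n, z j * ((totalSum (jumpUpTo (t j.succ)) ω).toReal
        - (totalSum (jumpUpTo (t j.castSucc)) ω).toReal : ℝ))) := by
  simp_rw [pointSum_incrementExponent]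
  refine Tendsto.congr (fun M => Finset.sum_comm) (tendsto_finsetSum _ fun j _ => ?_)
  simp_rw [← Finset.mul_sum, ← Complex.ofReal_sum]
  refine Tendsto.const_mul _ ((Complex.continuous_ofReal.tendsto _).comp ?_)
  exact ((hasSum_totalSum (h _)).sub (hasSum_totalSum (h _))).tendsto_sum_nat

/-- The subordinator with drift `b` and with the given jumps. -/
noncomputable def poissonSubordinator (b : ℝ) (t : ℝ≥0) (ω : ℕ → ℕ × (ℕ → ℝ × ℝ≥0)) : ℝ :=
  b * t + (totalSum (jumpUpTo t) ω).toReal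

theorem poissonSubordinator_zero (b : ℝ) : poissonSubordinator b 0 = 0 := by
  ext ω
  simp [poissonSubordinator, jumpUpTo_zero, totalSum_zero]

theorem measurable_poissonSubordinator (b : ℝ) (t : ℝ≥0) : Measurable (poissonSubordinator b t) :=
  (measurable_totalSum (measurable_jumpUpTo t)).ennreal_toReal.const_add _

section Path

variable {ω : ℕ → ℕ × (ℕ → ℝ × ℝ≥0)}

theorem monotone_poissonSubordinator (hb : 0 ≤ b) (hω : ∀ t, totalSum (jumpUpTo t) ω ≠ ∞) :
    Monotone fun t => poissonSubordinator b t ω := fun _ t hst =>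
  add_le_add (mul_le_mul_of_nonneg_left (NNReal.coe_le_coe.2 hst) hb)
    (ENNReal.toReal_mono (hω t) (totalSum_mono (monotone_jumpUpTo hst) ω))

theorem eventually_pointSum_jumpUpTo_eq (p : ℕ × (ℕ → ℝ × ℝ≥0)) (t : ℝ≥0) :
    ∀ᶠ v in 𝓝[≥] t, pointSum (jumpUpTo v) p = pointSum (jumpUpTo t) p := by
  have hiff : ∀ᶠ v : ℝ≥0 in 𝓝[≥] t, ∀ i ∈ Finset.range p.1, ((p.2 i).1 ≤ v ↔ (p.2 i).1 ≤ t) :=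
    (eventually_all_finset _).2 fun i _ =>
      (tendsto_coe_nhdsGE t).eventually (eventually_nhdsGE_le_iff (p.2 i).1 (t : ℝ))
  filter_upwards [hiff] with v hv
  refine Finset.sum_congr rfl fun i hi => ?_
  simp only [jumpUpTo, Set.indicator_apply, Set.mem_Ioc, hv i hi]

theorem continuousWithinAt_toReal_totalSum_jumpUpTo (hω : ∀ t, totalSum (jumpUpTo t) ω ≠ ∞)
    (t : ℝ≥0) :
    ContinuousWithinAt (fun u => (totalSum (jumpUpTo u) ω).toReal) (Set.Ici t) t := by
  simp_rw [ContinuousWithinAt, ← (hasSum_totalSum (hω _)).tsum_eq]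
  refine tendsto_tsum_of_dominated_convergence (hasSum_totalSum (hω (t + 1))).summable
    (fun n => ?_) ?_
  · refine tendsto_const_nhds.congr' ?_
    filter_upwards [eventually_pointSum_jumpUpTo_eq (ω n) t] with v hv
    rw [hv]
  · filter_upwards [nhdsWithin_le_nhds (Iio_mem_nhds (lt_add_one t))] with v hv n
    rw [Real.norm_of_nonneg (NNReal.coe_nonneg _)]
    exact NNReal.coe_le_coe.2 (Finset.sum_le_sum fun _ _ => monotone_jumpUpTo hv.le _)

theorem isCadlag_poissonSubordinator (hb : 0 ≤ b) (hω : ∀ t, totalSum (jumpUpTo t) ω ≠ ∞) :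
    IsCadlag fun t => poissonSubordinator b t ω := fun t =>
  ⟨ContinuousWithinAt.add (by fun_prop) (continuousWithinAt_toReal_totalSum_jumpUpTo hω t),
    _, (monotone_poissonSubordinator hb hω).tendsto_leftLim t⟩

end Path

section Law

variable {r : ℕ → ℝ≥0} {η : ℕ → Measure (ℝ × ℝ≥0)} [∀ n, IsProbabilityMeasure (η n)]

theorem IsLevyMeasure.ae_forall_totalSum_jumpUpTo_ne_top (h : IsLevyMeasure μ)
    (hm : jumpIntensity μ = Measure.sum fun n => r n • η n) :
    ∀ᵐ ω ∂(poissonProcess r η), ∀ t, totalSum (jumpUpTo t) ω ≠ ∞ := by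
  filter_upwards [ae_all_iff.2 fun n : ℕ =>
    ae_totalSum_ne_top hm (measurable_jumpUpTo n) (h.integrable_min_jumpUpTo n)] with ω hω t
  obtain ⟨n, hn⟩ := exists_nat_ge t
  exact ne_top_of_le_ne_top (hω n) (totalSum_mono (monotone_jumpUpTo hn) ω)

variable [SFinite μ]

theorem IsLevyMeasure.integral_cexp_increments (h : IsLevyMeasure μ)
    (hm : jumpIntensity μ = Measure.sum fun n => r n • η n) {n : ℕ} {t : Fin (n + 1) → ℝ≥0}
    (ht : Monotone t) {z : Fin n → ℂ} (hz : ∀ j, (z j).re ≤ 0) :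
    ∫ ω, Complex.exp (∑ j : Fin n, z j * (poissonSubordinator b (t j.succ) ω
        - poissonSubordinator b (t j.castSucc) ω : ℝ)) ∂(poissonProcess r η)
      = ∏ j : Fin n, Complex.exp (((t j.succ : ℝ) - t j.castSucc : ℝ)
        * (b * z j + levyIntegral μ (z j))) := by
  have hjumps := integral_eq_cexp_of_tendsto hm (measurable_incrementExponent t z)
    (re_incrementExponent_nonpos ht hz) (h.integrable_cexp_incrementExponent ht hz)
    ((h.ae_forall_totalSum_jumpUpTo_ne_top hm).mono fun ω hω =>
      (Complex.continuous_exp.tendsto _).comp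
        (tendsto_sum_pointSum_incrementExponent t z fun j => hω _))
  have hdrift (ω : ℕ → ℕ × (ℕ → ℝ × ℝ≥0)) :
      ∑ j : Fin n, z j * (poissonSubordinator b (t j.succ) ω
        - poissonSubordinator b (t j.castSucc) ω : ℝ)
      = (∑ j : Fin n, z j * (b * ((t j.succ : ℝ) - t j.castSucc : ℝ)))
        + ∑ j : Fin n, z j * ((totalSum (jumpUpTo (t j.succ)) ω).toReal
          - (totalSum (jumpUpTo (t j.castSucc)) ω).toReal : ℝ) := by
    rw [← Finset.sum_add_distrib]
    refine Finset.sum_congr rfl fun j _ => ?_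
    simp only [poissonSubordinator]
    push_cast
    ring
  simp_rw [hdrift, Complex.exp_add]
  rw [integral_const_mul, hjumps, h.integral_cexp_incrementExponent ht hz, ← Complex.exp_add,
    ← Complex.exp_sum, ← Finset.sum_add_distrib]
  congr 1
  refine Finset.sum_congr rfl fun j _ => ?_
  ring

theorem IsLevyMeasure.integral_cexp_increment (h : IsLevyMeasure μ)
    (hm : jumpIntensity μ = Measure.sum fun n => r n • η n) {s t : ℝ≥0} (hst : s ≤ t)
    {z : ℂ} (hz : z.re ≤ 0) :
    ∫ ω, Complex.exp (z * (poissonSubordinator b t ω - poissonSubordinator b s ω : ℝ))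
        ∂(poissonProcess r η)
      = Complex.exp (((t : ℝ) - s : ℝ) * (b * z + levyIntegral μ z)) := by
  have hmono : Monotone ![s, t] := by
    rw [Fin.monotone_iff_le_succ, Fin.forall_fin_one]
    exact hst
  simpa using h.integral_cexp_increments hm hmono (z := ![z]) (Fin.forall_fin_one.2 hz)

theorem measurable_poissonSubordinator_sub (b : ℝ) (s t : ℝ≥0) :
    Measurable fun ω => poissonSubordinator b t ω - poissonSubordinator b s ω :=
  (measurable_poissonSubordinator b t).sub (measurable_poissonSubordinator b s)

theorem IsLevyMeasure.charFun_map_poissonSubordinator_sub (h : IsLevyMeasure μ)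
    (hm : jumpIntensity μ = Measure.sum fun n => r n • η n) {s t : ℝ≥0} (hst : s ≤ t) (ξ : ℝ) :
    charFun ((poissonProcess r η).map fun ω =>
        poissonSubordinator b t ω - poissonSubordinator b s ω) ξ
      = Complex.exp (((t : ℝ) - s : ℝ)
        * (b * (ξ * Complex.I) + levyIntegral μ (ξ * Complex.I))) := by
  rw [← h.integral_cexp_increment hm hst (by simp), charFun_apply,
    integral_map (measurable_poissonSubordinator_sub b s t).aemeasurable (by fun_prop)]
  refine integral_congr_ae (ae_of_all _ fun ω => ?_)
  simp only [Real.inner_apply]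
  congr 1
  push_cast
  ring

theorem IsLevyMeasure.hasIndepIncrements_poissonSubordinator (h : IsLevyMeasure μ)
    (hm : jumpIntensity μ = Measure.sum fun n => r n • η n) :
    HasIndepIncrements (poissonSubordinator b) (poissonProcess r η) := by
  intro n t ht
  have hinc (i : Fin n) := measurable_poissonSubordinator_sub b (t i.castSucc) (t i.succ)
  rw [iIndepFun_iff_charFun_pi fun i => (hinc i).aemeasurable]
  intro ξ
  have hprod := h.integral_cexp_increments (b := b) hm ht (z := fun j => (ξ j : ℂ) * Complex.I)
    fun j => by simp
  rw [Finset.prod_congr rfl fun i _ =>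
      h.charFun_map_poissonSubordinator_sub hm (ht (Fin.castSucc_le_succ i)) (ξ i),
    ← hprod, charFun_apply, integral_map ?_ (by fun_prop)]
  · refine integral_congr_ae (ae_of_all _ fun ω => ?_)
    simp only [PiLp.inner_apply, Real.inner_apply]
    congr 1
    push_cast
    rw [Finset.sum_mul]
    exact Finset.sum_congr rfl fun j _ => by ring
  · exact ((WithLp.measurable_toLp 2 _).comp (measurable_pi_lambda _ hinc)).aemeasurable

theorem IsLevyMeasure.identDistrib_poissonSubordinator_sub (h : IsLevyMeasure μ)
    (hm : jumpIntensity μ = Measure.sum fun n => r n • η n) (t u : ℝ≥0) :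
    IdentDistrib (fun ω => poissonSubordinator b (t + u) ω - poissonSubordinator b t ω)
      (poissonSubordinator b u) (poissonProcess r η) (poissonProcess r η) where
  aemeasurable_fst := (measurable_poissonSubordinator_sub b _ _).aemeasurable
  aemeasurable_snd := (measurable_poissonSubordinator b u).aemeasurable
  map_eq := by
    have hsub : poissonSubordinator b u
        = fun ω => poissonSubordinator b u ω - poissonSubordinator b 0 ω := by
      simp [poissonSubordinator_zero]
    have := Measure.isProbabilityMeasure_map (μ := poissonProcess r η)
      (measurable_poissonSubordinator_sub b t (t + u)).aemeasurable
    have := Measure.isProbabilityMeasure_map (μ := poissonProcess r η)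
      (measurable_poissonSubordinator_sub b 0 u).aemeasurable
    rw [hsub]
    refine Measure.ext_of_charFun (funext fun ξ => ?_)
    rw [h.charFun_map_poissonSubordinator_sub hm le_self_add,
      h.charFun_map_poissonSubordinator_sub hm zero_le, NNReal.coe_add, add_sub_cancel_left,
      NNReal.coe_zero, sub_zero]

theorem IsLevyMeasure.integral_exp_neg_poissonSubordinator (h : IsLevyMeasure μ)
    (hm : jumpIntensity μ = Measure.sum fun n => r n • η n) (t : ℝ≥0) {s : ℝ} (hs : 0 ≤ s) :
    ∫ ω, Real.exp (-(s * poissonSubordinator b t ω)) ∂(poissonProcess r η)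
      = Real.exp (-(t * (b * s + laplaceExponent μ s))) := by
  have hcexp := h.integral_cexp_increment (b := b) hm (zero_le (a := t)) (z := ((-s : ℝ) : ℂ))
    (by simpa using hs)
  rw [levyIntegral_neg_ofReal, poissonSubordinator_zero] at hcexp
  simp only [Pi.zero_apply, sub_zero, NNReal.coe_zero, ← Complex.ofReal_mul, ← Complex.ofReal_add,
    ← Complex.ofReal_exp, integral_complex_ofReal, Complex.ofReal_inj] at hcexp
  simpa only [neg_mul, mul_neg, ← neg_add] using hcexp

theorem IsLevyMeasure.isSubordinator_poissonSubordinator (h : IsLevyMeasure μ) (hb : 0 ≤ b)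
    (hm : jumpIntensity μ = Measure.sum fun n => r n • η n) :
    IsSubordinator (fun s => b * s + laplaceExponent μ s) (poissonSubordinator b)
      (poissonProcess r η) where
  measurable := measurable_poissonSubordinator b
  zero := ae_of_all _ fun ω => by rw [poissonSubordinator_zero, Pi.zero_apply]
  paths := (h.ae_forall_totalSum_jumpUpTo_ne_top hm).mono fun _ hω =>
    ⟨monotone_poissonSubordinator hb hω, isCadlag_poissonSubordinator hb hω⟩
  indepIncrements := h.hasIndepIncrements_poissonSubordinator hm
  stationary := h.identDistrib_poissonSubordinator_sub hm
  laplace_eq t _ hs := h.integral_exp_neg_poissonSubordinator hm t hs.le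

end Law

end Subordinator

/-! ### Existence of subordinators -/

section Existence

variable {ψ : ℝ → ℝ} {Ω Ω' : Type*} [MeasurableSpace Ω] [MeasurableSpace Ω'] {P : Measure Ω}
  {P' : Measure Ω'} {D : ℝ≥0 → Ω → ℝ}

theorem IsSubordinator.congr {ψ' : ℝ → ℝ} {D' : ℝ≥0 → Ω → ℝ} (h : IsSubordinator ψ D P)
    (hψ : ∀ s, 0 < s → ψ' s = ψ s) (hm : ∀ t, Measurable (D' t))
    (hae : ∀ᵐ ω ∂P, ∀ t, D t ω = D' t ω) : IsSubordinator ψ' D' P where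
  measurable := hm
  zero := by filter_upwards [h.zero, hae] with ω hzero hω using (hω 0).symm.trans hzero
  paths := by
    filter_upwards [h.paths, hae] with ω hpaths hω
    rwa [funext hω] at hpaths
  indepIncrements n t ht := (h.indepIncrements n t ht).congr fun i => by
    filter_upwards [hae] with ω hω
    simp only [hω]
  stationary t u := by
    refine ((IdentDistrib.of_ae_eq ((hm _).sub (hm _)).aemeasurable ?_).trans
      (h.stationary t u)).trans (IdentDistrib.of_ae_eq (h.measurable u).aemeasurable ?_)
    · filter_upwards [hae] with ω hω
      simp only [Pi.sub_apply, hω]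
    · filter_upwards [hae] with ω hω using hω u
  laplace_eq t s hs := by
    rw [hψ s hs, ← h.laplace_eq t s hs]
    refine integral_congr_ae ?_
    filter_upwards [hae] with ω hω
    rw [hω]

theorem iIndepFun_comp_measurePreserving {ι : Type*} {β : ι → Type*} [∀ i, MeasurableSpace (β i)]
    {X : ∀ i, Ω → β i} (hX : ∀ i, Measurable (X i)) (h : iIndepFun X P) {f : Ω' → Ω}
    (hf : MeasurePreserving f P' P) : iIndepFun (fun i ω => X i (f ω)) P' := by
  refine iIndepFun_iff_measure_inter_preimage_eq_mul.2 fun S A hA => ?_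
  have hpre (i : ι) (hi : i ∈ S) : MeasurableSet (X i ⁻¹' A i) := hX i (hA i hi)
  calc P' (⋂ i ∈ S, (fun ω => X i (f ω)) ⁻¹' A i) = P' (f ⁻¹' ⋂ i ∈ S, X i ⁻¹' A i) := by
        simp only [Set.preimage_iInter]
        rfl
    _ = ∏ i ∈ S, P (X i ⁻¹' A i) := by
        rw [hf.measure_preimage (S.measurableSet_biInter hpre).nullMeasurableSet,
          h.measure_inter_preimage_eq_mul S hA]
    _ = ∏ i ∈ S, P' ((fun ω => X i (f ω)) ⁻¹' A i) := Finset.prod_congr rfl fun i hi =>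
        (hf.measure_preimage (hpre i hi).nullMeasurableSet).symm

theorem IsSubordinator.comp_measurePreserving (h : IsSubordinator ψ D P) {f : Ω' → Ω}
    (hf : MeasurePreserving f P' P) : IsSubordinator ψ (fun t ω => D t (f ω)) P' where
  measurable t := (h.measurable t).comp hf.measurable
  zero := hf.quasiMeasurePreserving.ae h.zero
  paths := hf.quasiMeasurePreserving.ae h.paths
  indepIncrements n t ht := iIndepFun_comp_measurePreserving
    (fun i => (h.measurable _).sub (h.measurable _)) (h.indepIncrements n t ht) hf
  stationary t u := by
    have hinc : Measurable fun ω => D (t + u) ω - D t ω := (h.measurable _).sub (h.measurable _)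
    refine ⟨(hinc.comp hf.measurable).aemeasurable,
      ((h.measurable u).comp hf.measurable).aemeasurable, ?_⟩
    have hmap := (h.stationary t u).map_eq
    rwa [← hf.map_eq, Measure.map_map hinc hf.measurable,
      Measure.map_map (h.measurable u) hf.measurable] at hmap
  laplace_eq t s hs := by
    have hD : Measurable fun ω => Real.exp (-(s * D t ω)) :=
      Real.measurable_exp.comp ((h.measurable t).const_mul s).neg
    rw [← h.laplace_eq t s hs, ← hf.map_eq,
      integral_map hf.measurable.aemeasurable hD.aestronglyMeasurable]

theorem measurable_uncurry_poissonSubordinator (b : ℝ) :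
    Measurable (Function.uncurry (poissonSubordinator b)) :=
  (measurable_fst.coe_nnreal_real.const_mul b).add
    (measurable_totalSum_comp (g := fun p : ℝ≥0 × (ℕ → ℕ × (ℕ → ℝ × ℝ≥0)) => jumpUpTo p.1)
      (measurable_uncurry_jumpUpTo.comp (measurable_fst.fst.prodMk measurable_snd))
      measurable_snd).ennreal_toReal

theorem HasCharacteristics.exists_isSubordinator {b : ℝ} {μ : Measure ℝ}
    (h : HasCharacteristics ψ 0 b μ) :
    ∃ (Ω : Type) (_ : MeasurableSpace Ω) (P : Measure Ω) (_ : IsProbabilityMeasure P)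
      (D : ℝ≥0 → Ω → ℝ), IsSubordinator ψ D P ∧ Measurable (Function.uncurry D) := by
  have := h.sFinite
  have : SFinite (jumpIntensity μ) := by unfold jumpIntensity; infer_instance
  choose r η hη hr using fun n => exists_smul_probability (sfiniteSeq (jumpIntensity μ) n)
  have hm : jumpIntensity μ = Measure.sum fun n => r n • η n := by
    simp only [← hr]
    exact (sum_sfiniteSeq _).symm
  refine ⟨_, inferInstance, poissonProcess r η, inferInstance, poissonSubordinator b, ?_,
    measurable_uncurry_poissonSubordinator b⟩
  exact (h.isLevyMeasure.isSubordinator_poissonSubordinator h.b_nonneg hm).congr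
    (fun s hs => h.eq_add_laplaceExponent hs) (measurable_poissonSubordinator b)
    (ae_of_all _ fun _ _ => rfl)

theorem IsSubordinator.exists_isRegularPath [IsFiniteMeasure P] (h : IsSubordinator ψ D P)
    (hD : Measurable (Function.uncurry D)) (hψ : Tendsto ψ atTop atTop) :
    ∃ D' : ℝ≥0 → Ω → ℝ, IsSubordinator ψ D' P ∧ Measurable (Function.uncurry D') ∧
      ∀ ω, IsRegularPath fun t => D' t ω := by
  classical
  obtain ⟨N, hN, hNm, hN0⟩ := exists_measurable_superset_of_null (ae_iff.1 (h.ae_isRegularPath hψ))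
  let D' : ℝ≥0 → Ω → ℝ := fun t ω => if ω ∈ N then t else D t ω
  have hD' : Measurable (Function.uncurry D') :=
    Measurable.ite (measurable_snd hNm) measurable_fst.coe_nnreal_real hD
  refine ⟨D', h.congr (fun _ _ => rfl) (fun t => hD'.comp measurable_prodMk_left) ?_, hD',
    fun ω => ?_⟩
  · filter_upwards [measure_eq_zero_iff_ae_notMem.1 hN0] with ω hω t
    exact (if_neg hω).symm
  · by_cases hω : ω ∈ N
    · simpa only [D', if_pos hω] using isRegularPath_coe
    · simpa only [D', if_neg hω] using not_not.1 (mt (@hN ω) hω)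

theorem measurable_pathInverse (hm : ∀ t, Measurable (D t))
    (h : ∀ ω, Tendsto (fun t => D t ω) atTop atTop) (hmono : ∀ ω, Monotone fun t => D t ω)
    (r : ℝ≥0) : Measurable fun ω => pathInverse (fun t => D t ω) r := by
  obtain ⟨R, hRc, hRd⟩ := TopologicalSpace.exists_countable_dense ℝ≥0
  refine measurable_of_Iio fun c => ?_
  have hset : (fun ω => pathInverse (fun t => D t ω) r) ⁻¹' Set.Iio c
      = ⋃ u ∈ R ∩ Set.Iio c, {ω | (r : ℝ) < D u ω} := by
    ext ω
    simp only [Set.mem_preimage, Set.mem_Iio, Set.mem_iUnion, Set.mem_ofPred_eq, exists_prop,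
      Set.mem_inter_iff]
    constructor
    · intro hc
      obtain ⟨v, hv, hrv⟩ := exists_lt_of_pathInverse_lt (h ω) hc
      obtain ⟨u, hu, hvu, huc⟩ := hRd.exists_between hv
      exact ⟨u, ⟨hu, huc⟩, hrv.trans_le (hmono ω hvu.le)⟩
    · rintro ⟨u, ⟨-, huc⟩, hu⟩
      exact (pathInverse_le hu).trans_lt huc
  rw [hset]
  exact MeasurableSet.biUnion (hRc.mono Set.inter_subset_left) fun u _ =>
    measurableSet_lt measurable_const (hm u)

end Existence

/-! ### Increments of a subordinator along a random walk -/

section Walk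

variable {ψ : ℝ → ℝ} {Ω : Type*} [MeasurableSpace Ω] {P : Measure Ω} {D : ℝ≥0 → Ω → ℝ}
  {M : Type*} {a : M → ℝ≥0}

/-- The time after `n` steps of the walk with marks `x`, of which a mark `m` makes a step of length
`a m`. -/
def walkTime (a : M → ℝ≥0) (n : ℕ) (x : ℕ → M) : ℝ≥0 := ∑ i ∈ Finset.range n, a (x i)

/-- The increment of `D` over the `k`-th step of the walk. -/
def walkIncrement {Ω : Type*} (D : ℝ≥0 → Ω → ℝ) (a : M → ℝ≥0) (k : ℕ) (p : Ω × (ℕ → M)) : ℝ :=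
  D (walkTime a (k + 1) p.2) p.1 - D (walkTime a k p.2) p.1

theorem monotone_walkTime (a : M → ℝ≥0) (x : ℕ → M) : Monotone fun n => walkTime a n x :=
  fun _ _ hmn => Finset.sum_le_sum_of_subset (Finset.range_mono hmn)

theorem jumpTime_walkIncrement {Ω : Type*} {D : ℝ≥0 → Ω → ℝ} {p : Ω × (ℕ → M)}
    (h0 : D 0 p.1 = 0) (n : ℕ) :
    jumpTime (walkIncrement D a) n p = D (walkTime a (n + 1) p.2) p.1 := by
  have htel := Finset.sum_range_sub (fun k => D (walkTime a k p.2) p.1) (n + 1)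
  rwa [walkTime, walkTime, Finset.sum_range_zero, h0, sub_zero] at htel

theorem IsSubordinator.measure_walkIncrement_mem (h : IsSubordinator ψ D P) (a : M → ℝ≥0)
    (x : ℕ → M) (s : Finset ℕ) {t : ℕ → Set ℝ} (ht : ∀ k, MeasurableSet (t k)) :
    P {ω | ∀ k ∈ s, walkIncrement D a k (ω, x) ∈ t k} = ∏ k ∈ s, P {ω | D (a (x k)) ω ∈ t k} := by
  have hind := (h.indepIncrements.nat (monotone_walkTime a x)).measure_inter_preimage_eq_mul s
    (sets := t) fun k _ => ht k
  have hset : {ω | ∀ k ∈ s, walkIncrement D a k (ω, x) ∈ t k}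
      = ⋂ k ∈ s, (fun ω => D (walkTime a (k + 1) x) ω - D (walkTime a k x) ω) ⁻¹' t k := by
    ext ω
    simp only [walkIncrement, Set.mem_ofPred_eq, Set.mem_iInter, Set.mem_preimage]
  rw [hset, hind]
  refine Finset.prod_congr rfl fun k _ => ?_
  rw [show walkTime a (k + 1) x = walkTime a k x + a (x k) from Finset.sum_range_succ _ _]
  exact (h.stationary _ _).measure_mem_eq (ht k)

variable [MeasurableSpace M] {η : Measure M}

theorem measurable_walkTime (ha : Measurable a) (n : ℕ) : Measurable (walkTime a n) :=
  Finset.measurable_fun_sum _ fun i _ => ha.comp (measurable_pi_apply i)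

theorem measurable_walkIncrement (hD : Measurable (Function.uncurry D)) (ha : Measurable a)
    (k : ℕ) : Measurable (walkIncrement D a k) := by
  have hDwalk (n : ℕ) : Measurable fun p : Ω × (ℕ → M) => D (walkTime a n p.2) p.1 :=
    hD.comp (((measurable_walkTime ha n).comp measurable_snd).prodMk measurable_fst)
  exact (hDwalk _).sub (hDwalk _)

theorem lintegral_prod_infinitePi {ι : Type*} {X : ι → Type*} [∀ i, MeasurableSpace (X i)]
    {ν : ∀ i, Measure (X i)} [∀ i, IsProbabilityMeasure (ν i)] {f : ∀ i, X i → ℝ≥0∞}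
    (hf : ∀ i, Measurable (f i)) (s : Finset ι) :
    ∫⁻ x, ∏ i ∈ s, f i (x i) ∂(Measure.infinitePi ν) = ∏ i ∈ s, ∫⁻ x, f i x ∂(ν i) := by
  rw [lintegral_prod_eq_prod_lintegral_of_indepFun s (fun i (x : ∀ i, X i) => f i (x i))
    (iIndepFun_infinitePi hf) fun i => (hf i).comp (measurable_pi_apply i)]
  exact Finset.prod_congr rfl fun i _ =>
    (measurePreserving_eval_infinitePi ν i).lintegral_comp (hf i)

theorem IsSubordinator.map_walkIncrement [IsProbabilityMeasure P] [IsProbabilityMeasure η]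
    (h : IsSubordinator ψ D P) (hD : Measurable (Function.uncurry D)) (ha : Measurable a) :
    (P.prod (Measure.infinitePi fun _ : ℕ => η)).map (fun p k => (walkIncrement D a k p, p.2 k))
      = Measure.infinitePi fun _ => (P.prod η).map fun q => (D (a q.2) q.1, q.2) := by
  have hstep : Measurable fun q : Ω × M => (D (a q.2) q.1, q.2) :=
    (hD.comp ((ha.comp measurable_snd).prodMk measurable_fst)).prodMk measurable_snd
  have hjoint : Measurable fun (p : Ω × (ℕ → M)) k => (walkIncrement D a k p, p.2 k) :=
    measurable_pi_lambda _ fun k => (measurable_walkIncrement hD ha k).prodMk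
      ((measurable_pi_apply k).comp measurable_snd)
  have := Measure.isProbabilityMeasure_map (μ := P.prod η) hstep.aemeasurable
  refine Measure.eq_infinitePi _ fun s t ht => ?_
  have hpi : MeasurableSet ((s : Set ℕ).pi t) := MeasurableSet.pi s.countable_toSet fun i _ => ht i
  calc _ = ∫⁻ x : ℕ → M, P {ω | ∀ k ∈ s, walkIncrement D a k (ω, x) ∈ {v | (v, x k) ∈ t k}}
          ∂(Measure.infinitePi fun _ => η) := by
        rw [Measure.map_apply hjoint hpi, Measure.prod_apply_symm (hjoint hpi)]
        rfl
    _ = ∫⁻ x : ℕ → M, ∏ k ∈ s, P {ω | (D (a (x k)) ω, x k) ∈ t k}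
          ∂(Measure.infinitePi fun _ => η) :=
        lintegral_congr fun x => h.measure_walkIncrement_mem a x s fun k =>
          measurable_prodMk_right (ht k)
    _ = ∏ k ∈ s, ∫⁻ m, P {ω | (D (a m) ω, m) ∈ t k} ∂η :=
        lintegral_prod_infinitePi (f := fun k m => P {ω | (D (a m) ω, m) ∈ t k})
          (fun k => measurable_measure_prodMk_right (hstep (ht k))) s
    _ = _ := Finset.prod_congr rfl fun k _ => by
        rw [Measure.map_apply hstep (ht k), Measure.prod_apply_symm (hstep (ht k))]
        rfl

theorem IsSubordinator.map_comp_walkIncrement [IsProbabilityMeasure P] [IsProbabilityMeasure η]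
    (h : IsSubordinator ψ D P) (hD : Measurable (Function.uncurry D)) (ha : Measurable a)
    {N : Type*} [MeasurableSpace N] {g : ℝ × M → N} (hg : Measurable g) :
    (P.prod (Measure.infinitePi fun _ : ℕ => η)).map (fun p k => g (walkIncrement D a k p, p.2 k))
      = Measure.infinitePi fun _ => (P.prod η).map fun q => g (D (a q.2) q.1, q.2) := by
  have hstep : Measurable fun q : Ω × M => (D (a q.2) q.1, q.2) :=
    (hD.comp ((ha.comp measurable_snd).prodMk measurable_fst)).prodMk measurable_snd
  have hjoint : Measurable fun (p : Ω × (ℕ → M)) k => (walkIncrement D a k p, p.2 k) :=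
    measurable_pi_lambda _ fun k => (measurable_walkIncrement hD ha k).prodMk
      ((measurable_pi_apply k).comp measurable_snd)
  have := Measure.isProbabilityMeasure_map (μ := P.prod η) hstep.aemeasurable
  have hmap := congrArg (Measure.map fun (y : ℕ → ℝ × M) k => g (y k))
    (h.map_walkIncrement (η := η) hD ha)
  rw [Measure.map_map (by fun_prop) hjoint, Measure.infinitePi_map_pi _ fun _ => hg] at hmap
  simp only [Measure.map_map hg hstep] at hmap
  exact hmap

end Walk

/-! ### The direct direction -/

section Direct

theorem exists_measurable_sampling {F : Type*} [MeasurableSpace F] [StandardBorelSpace F]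
    [Nonempty F] {β : Type*} [MeasurableSpace β] {Ω : Type*} [MeasurableSpace Ω] {P : Measure Ω}
    [IsProbabilityMeasure P] {X : Ω → F} {V : Ω → β} (hX : AEMeasurable X P)
    (hV : AEMeasurable V P) :
    ∃ f : β × unitInterval → F, Measurable f ∧
      ((P.map V).prod volume).map (fun q => (f q, q.1)) = P.map fun ω => (X ω, V ω) := by
  obtain ⟨f, hf, hfκ⟩ := (condDistrib X V P).exists_measurable_map_eq_unitInterval
  refine ⟨Function.uncurry f, hf, ?_⟩
  have := Measure.isProbabilityMeasure_map (μ := P) hV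
  have hm : Measurable fun q : β × unitInterval => (q.1, Function.uncurry f q) :=
    measurable_fst.prodMk hf
  have hmap : ((P.map V).prod volume).map (fun q => (q.1, Function.uncurry f q))
      = P.map fun ω => (V ω, X ω) := by
    rw [← compProd_map_condDistrib hX]
    refine Measure.ext fun s hs => ?_
    rw [Measure.map_apply hm hs, Measure.prod_apply (hm hs), Measure.compProd_apply hs]
    refine lintegral_congr fun v => ?_
    have hfv : Measurable (f v) := hf.comp measurable_prodMk_left
    rw [← hfκ, Measure.map_apply hfv (measurable_prodMk_left hs)]
    rfl
  have hswap := congrArg (Measure.map Prod.swap) hmap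
  rwa [Measure.map_map measurable_swap hm,
    AEMeasurable.map_map_of_aemeasurable measurable_swap.aemeasurable (hV.prodMk hX)] at hswap

section IIDJumps

variable {E : Type*} [MeasurableSpace E] {Ω Ω' : Type*} [MeasurableSpace Ω]
  [MeasurableSpace Ω'] {P : Measure Ω} {P' : Measure Ω'} {J : ℕ → Ω → E} {V : ℕ → Ω → ℝ}

theorem IsIIDJumps.map_eq [IsProbabilityMeasure P] (h : IsIIDJumps J V P) :
    P.map (fun ω k => (J k ω, V k ω))
      = Measure.infinitePi fun _ => P.map fun ω => (J 0 ω, V 0 ω) := by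
  rw [(iIndepFun_iff_map_fun_eq_infinitePi_map fun k =>
    (h.measurable_jump k).prodMk (h.measurable_wait k)).1 h.indep]
  simp only [fun k => (h.identDistrib k).map_eq]

theorem isIIDJumps_of_map_eq [IsProbabilityMeasure P] (hJ : ∀ k, Measurable (J k))
    (hV : ∀ k, Measurable (V k)) {L : Measure (E × ℝ)} [IsProbabilityMeasure L]
    (h : P.map (fun ω k => (J k ω, V k ω)) = Measure.infinitePi fun _ => L) :
    IsIIDJumps J V P := by
  have hm (k : ℕ) : Measurable fun ω => (J k ω, V k ω) := (hJ k).prodMk (hV k)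
  have hmarginal (k : ℕ) : P.map (fun ω => (J k ω, V k ω)) = L := by
    rw [← Measure.infinitePi_map_eval (fun _ : ℕ => L) k, ← h,
      Measure.map_map (measurable_pi_apply k) (measurable_pi_lambda _ hm)]
    rfl
  refine ⟨hJ, hV, (iIndepFun_iff_map_fun_eq_infinitePi_map hm).2 ?_, fun k =>
    ⟨(hm k).aemeasurable, (hm 0).aemeasurable, (hmarginal k).trans (hmarginal 0).symm⟩⟩
  simp only [h, hmarginal]

variable {E : Type*} [NormedAddCommGroup E] [MeasurableSpace E] [BorelSpace E]
  [SecondCountableTopology E] {J : ℕ → Ω → E}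

theorem hasJ1Law_of_ae_mem_regularJumps (hm : AEMeasurable (fun ω k => (J k ω, V k ω)) P)
    (h : ∀ᵐ ω ∂P, (fun k => (J k ω, V k ω)) ∈ regularJumps E) {Z : ℝ≥0 → Ω → E}
    (hZ : ∀ᵐ ω ∂P, ∀ t, Z t ω = ctrw J V t ω) :
    HasJ1Law Z ((P.map fun ω k => (J k ω, V k ω)).map toSkorokhod) P := by
  refine ⟨fun ω => toSkorokhod fun k => (J k ω, V k ω),
    ⟨measurable_toSkorokhod.comp_aemeasurable hm, ?_⟩, ?_⟩
  · rw [AEMeasurable.map_map_of_aemeasurable measurable_toSkorokhod.aemeasurable hm]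
    rfl
  · filter_upwards [h, hZ] with ω hω hZω t
    rw [hZω, toSkorokhod_val hω]
    rfl

theorem sameJ1Law_of_identDistrib {J' : ℕ → Ω' → E} {V' : ℕ → Ω' → ℝ} {Z' : ℝ≥0 → Ω' → E}
    (h : IdentDistrib (fun ω k => (J k ω, V k ω)) (fun ω k => (J' k ω, V' k ω)) P P')
    (hreg : ∀ᵐ ω ∂P, (fun k => (J k ω, V k ω)) ∈ regularJumps E)
    (hZ' : ∀ᵐ ω ∂P', ∀ t, Z' t ω = ctrw J' V' t ω) : SameJ1Law (ctrw J V) P Z' P' :=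
  ⟨_, hasJ1Law_of_ae_mem_regularJumps h.aemeasurable_fst hreg (ae_of_all _ fun _ _ => rfl),
    h.map_eq ▸ hasJ1Law_of_ae_mem_regularJumps h.aemeasurable_snd
      (h.ae_snd measurableSet_regularJumps hreg) hZ'⟩

end IIDJumps

section RandomTime

variable {ψ : ℝ → ℝ} {Ω : Type*} [MeasurableSpace Ω] {P : Measure Ω} [IsProbabilityMeasure P]
  {D : ℝ≥0 → Ω → ℝ} {ν ρ : Measure ℝ}

theorem IsSubordinator.map_eq_of_isPhi (h : IsSubordinator ψ D P)
    (hD : Measurable (Function.uncurry D)) (hD0 : ∀ t ω, 0 ≤ D t ω) (hΦ : IsPhi ψ ν ρ) :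
    (P.prod (ν.map Real.toNNReal)).map (fun q => D q.2 q.1) = ρ := by
  obtain ⟨hν, hρ, hlap⟩ := hΦ
  have := hν.1
  have := Measure.isProbabilityMeasure_map (μ := ν) measurable_real_toNNReal.aemeasurable
  have hw : (P.prod (ν.map Real.toNNReal)).map (fun q => (q.2 : ℝ)) = ν :=
    ((measurePreserving_coe_map_toNNReal hν).comp measurePreserving_snd).map_eq
  have hprod : IsPhi ψ ν ((P.prod (ν.map Real.toNNReal)).map fun q => D q.2 q.1) := by
    have hF : Measurable fun p : Ω × ℝ => D p.2.toNNReal p.1 :=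
      hD.comp (measurable_snd.real_toNNReal.prodMk measurable_fst)
    have hΦ := isPhi_map_of_indepFun (ψ := ψ) (P := P.prod (ν.map Real.toNNReal)) hF
      (fun p => hD0 _ _) measurable_fst measurable_snd.coe_nnreal_real
      (ae_of_all _ fun q => q.2.coe_nonneg)
      (indepFun_prod measurable_id measurable_coe_nnreal_real) fun s hs v => ?_
    · simpa only [hw, Real.toNNReal_coe] using hΦ
    · simp only [Real.toNNReal_coe]
      rw [integral_fun_fst (f := fun ω => Real.exp (-(s * D v ω))), probReal_univ, one_smul,
        h.laplace_eq v s hs]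
  exact ext_of_laplace hprod.2.1 hρ fun s hs => (hprod.2.2 s hs).trans (hlap s hs).symm

theorem IsSubordinator.map_prodMk_eq_prod_of_isPhi (h : IsSubordinator ψ D P)
    (hD : Measurable (Function.uncurry D)) (hD0 : ∀ t ω, 0 ≤ D t ω) (hΦ : IsPhi ψ ν ρ)
    {U : Type*} [MeasurableSpace U] (σ : Measure U) [SFinite σ] :
    (P.prod ((ν.map Real.toNNReal).prod σ)).map (fun q => (D q.2.1 q.1, q.2.2)) = ρ.prod σ := by
  have := hΦ.1.1
  have hD' : Measurable fun q : Ω × ℝ≥0 => D q.2 q.1 := hD.comp measurable_swap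
  have hstep : Measurable fun q : Ω × ℝ≥0 × U => (D q.2.1 q.1, q.2.2) :=
    (hD.comp (measurable_snd.fst.prodMk measurable_fst)).prodMk measurable_snd.snd
  rw [← h.map_eq_of_isPhi hD hD0 hΦ, ← Measure.prodAssoc_prod,
    Measure.map_map hstep MeasurableEquiv.prodAssoc.measurable]
  conv_rhs => rw [← Measure.map_id (μ := σ)]
  rw [Measure.map_prod_map _ _ hD' measurable_id]
  rfl

end RandomTime

section WalkTimeChange

variable {ψ : ℝ → ℝ} {Ω : Type*} {D : ℝ≥0 → Ω → ℝ} {M : Type*} {a : M → ℝ≥0}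

/-- The length of the `k`-th step of the walk: the waiting time of the walk whose time change by the
inverse of `D` waits for `walkIncrement D a`. -/
def walkStep (a : M → ℝ≥0) (k : ℕ) (p : Ω × (ℕ → M)) : ℝ := a (p.2 k)

theorem toNNReal_jumpTime_walkStep (a : M → ℝ≥0) (n : ℕ) (p : Ω × (ℕ → M)) :
    (jumpTime (walkStep a) n p).toNNReal = walkTime a (n + 1) p.2 := by
  simp only [jumpTime, walkStep, walkTime, ← NNReal.coe_sum, Real.toNNReal_coe]

theorem timeChange_ctrw_walkStep {E : Type*} [NormedAddCommGroup E] {J : ℕ → Ω × (ℕ → M) → E}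
    {p : Ω × (ℕ → M)} (hD : IsRegularPath fun t => D t p.1)
    (h : (fun k => (J k p, walkStep a k p)) ∈ regularJumps E) (t : ℝ≥0) :
    timeChange (ctrw J (walkStep a)) (fun r q => pathInverse (fun u => D u q.1) r) t p
      = ctrw J (walkIncrement D a) t p := by
  refine (congrFun (hD.timeChange_ctrw_eq (fun _ => rfl) h) t).trans ?_
  simp only [toNNReal_jumpTime_walkStep, ← jumpTime_walkIncrement hD.zero]
  rfl

variable [MeasurableSpace Ω] {P : Measure Ω} [IsProbabilityMeasure P] [MeasurableSpace M]
  {η : Measure M} [IsProbabilityMeasure η]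

theorem map_walkStep (ha : Measurable a) (k : ℕ) :
    (P.prod (Measure.infinitePi fun _ => η)).map (walkStep a k) = η.map fun m => (a m : ℝ) := by
  have hcoe : MeasurePreserving (fun m => (a m : ℝ)) η (η.map fun m => (a m : ℝ)) :=
    ha.coe_nnreal_real.measurePreserving η
  exact (hcoe.comp ((measurePreserving_eval_infinitePi _ k).comp measurePreserving_snd)).map_eq

variable {E : Type*} [MeasurableSpace E] {G : ℝ × M → E}

theorem IsSubordinator.isIIDJumps_walkStep (h : IsSubordinator ψ D P)
    (hD : Measurable (Function.uncurry D)) (ha : Measurable a) (hG : Measurable G) :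
    IsIIDJumps (fun k p => G (walkIncrement D a k p, p.2 k)) (walkStep a)
      (P.prod (Measure.infinitePi fun _ => η)) := by
  have hg : Measurable fun y : ℝ × M => (G y, (a y.2 : ℝ)) := by fun_prop
  have hstep : Measurable fun q : Ω × M => (D (a q.2) q.1, q.2) :=
    (hD.comp ((ha.comp measurable_snd).prodMk measurable_fst)).prodMk measurable_snd
  have : IsProbabilityMeasure ((P.prod η).map fun q => (G (D (a q.2) q.1, q.2), (a q.2 : ℝ))) :=
    Measure.isProbabilityMeasure_map (hg.comp hstep).aemeasurable
  exact isIIDJumps_of_map_eq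
    (fun k => hG.comp ((measurable_walkIncrement hD ha k).prodMk
      ((measurable_pi_apply k).comp measurable_snd)))
    (fun k => (ha.comp ((measurable_pi_apply k).comp measurable_snd)).coe_nnreal_real)
    (h.map_comp_walkIncrement hD ha hg)

theorem IsSubordinator.sameJ1Law_timeChange_walk {E : Type*} [NormedAddCommGroup E]
    [MeasurableSpace E] [BorelSpace E] [SecondCountableTopology E] {G : ℝ × M → E}
    (h : IsSubordinator ψ D P) (hD : Measurable (Function.uncurry D))
    (hreg : ∀ ω, IsRegularPath fun t => D t ω) (ha : Measurable a) (hG : Measurable G)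
    (hη : η.map (fun m => (a m : ℝ)) (Set.Ioi 0) ≠ 0) {Ω' : Type*} [MeasurableSpace Ω']
    {P' : Measure Ω'} [IsProbabilityMeasure P'] {J : ℕ → Ω' → E} {V : ℕ → Ω' → ℝ}
    (hY : IsIIDJumps J V P') (hJV : ∀ᵐ ω ∂P', (fun k => (J k ω, V k ω)) ∈ regularJumps E)
    (hlaw : (P.prod η).map (fun q => (G (D (a q.2) q.1, q.2), D (a q.2) q.1))
      = P'.map fun ω => (J 0 ω, V 0 ω)) :
    SameJ1Law (ctrw J V) P'
      (timeChange (ctrw (fun k p => G (walkIncrement D a k p, p.2 k)) (walkStep a))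
        fun t p => pathInverse (fun u => D u p.1) t) (P.prod (Measure.infinitePi fun _ => η)) := by
  have hstep (k : ℕ) : Measurable fun p : Ω × (ℕ → M) => (walkIncrement D a k p, p.2 k) :=
    (measurable_walkIncrement hD ha k).prodMk ((measurable_pi_apply k).comp measurable_snd)
  have hwalk := (h.isIIDJumps_walkStep (η := η) hD ha hG).ae_mem_regularJumps
    (ae_of_all _ fun p => NNReal.coe_nonneg _) (by rwa [map_walkStep ha])
  refine sameJ1Law_of_identDistrib (J' := fun k p => G (walkIncrement D a k p, p.2 k))
    (V' := walkIncrement D a) ⟨?_, ?_, ?_⟩ hJV ?_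
  · exact (measurable_pi_lambda _ fun k =>
      (hY.measurable_jump k).prodMk (hY.measurable_wait k)).aemeasurable
  · exact (measurable_pi_lambda _ fun k => (hG.comp (hstep k)).prodMk (hstep k).fst).aemeasurable
  · rw [hY.map_eq, ← hlaw]
    exact (h.map_comp_walkIncrement hD ha (hG.prodMk measurable_fst)).symm
  · filter_upwards [hwalk] with p hp t using timeChange_ctrw_walkStep (hreg p.1) hp t

end WalkTimeChange

theorem exists_sameJ1Law_timeChange {E : Type*} [NormedAddCommGroup E] [MeasurableSpace E]
    [BorelSpace E] [SecondCountableTopology E] [StandardBorelSpace E] {ψ : ℝ → ℝ} {b : ℝ}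
    {μ : Measure ℝ} (h : HasCharacteristics ψ 0 b μ) (hub : ¬ BddAbove (ψ '' Set.Ioi 0))
    {Ω : Type*} [MeasurableSpace Ω] {P : Measure Ω} [IsProbabilityMeasure P]
    {J : ℕ → Ω → E} {V : ℕ → Ω → ℝ} (hY : IsIIDJumps J V P) {ν : Measure ℝ}
    (hΦ : IsPhi ψ ν (P.map (V 0))) (hν : ν (Set.Ioi 0) ≠ 0) :
    ∃ (Ω' : Type) (_ : MeasurableSpace Ω') (P' : Measure Ω') (_ : IsProbabilityMeasure P')
      (J' : ℕ → Ω' → E) (W : ℕ → Ω' → ℝ) (T : ℝ≥0 → Ω' → ℝ≥0),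
      IsIIDJumps J' W P' ∧ P'.map (W 0) = ν ∧ IsInverseSubordinator ψ T P' ∧
      IndepFun (fun ω t => T t ω) (fun ω k => W k ω) P' ∧
      SameJ1Law (ctrw J V) P (timeChange (ctrw J' W) T) P' := by
  obtain ⟨Ω₀, _, P₀, _, D₀, hD₀, hD₀m⟩ := h.exists_isSubordinator
  obtain ⟨D, hD, hDm, hreg⟩ := hD₀.exists_isRegularPath hD₀m (h.tendsto_atTop_atTop hub)
  obtain ⟨f, hf, hflaw⟩ := exists_measurable_sampling (hY.measurable_jump 0).aemeasurable
    (hY.measurable_wait 0).aemeasurable (P := P)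
  have := hΦ.1.1
  have := Measure.isProbabilityMeasure_map (μ := ν) measurable_real_toNNReal.aemeasurable
  let η : Measure (ℝ≥0 × unitInterval) := (ν.map Real.toNNReal).prod volume
  have hG : Measurable fun y : ℝ × ℝ≥0 × unitInterval => f (y.1, y.2.2) := by fun_prop
  have hη : η.map (fun m => (m.1 : ℝ)) = ν :=
    ((measurePreserving_coe_map_toNNReal hΦ.1).comp measurePreserving_fst).map_eq
  have hlaw : (P₀.prod η).map (fun q => (f (D q.2.1 q.1, q.2.2), D q.2.1 q.1))
      = P.map fun ω => (J 0 ω, V 0 ω) := by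
    have hDq : Measurable fun q : Ω₀ × ℝ≥0 × unitInterval => (D q.2.1 q.1, q.2.2) :=
      (hDm.comp (measurable_snd.fst.prodMk measurable_fst)).prodMk measurable_snd.snd
    rw [← hflaw, ← hD.map_prodMk_eq_prod_of_isPhi hDm (fun t ω => (hreg ω).nonneg t) hΦ volume,
      Measure.map_map (hf.prodMk measurable_fst) hDq]
    rfl
  have hT := measurable_pathInverse hD.measurable (fun ω => (hreg ω).tendsto_atTop)
    fun ω => (hreg ω).monotone
  have hJV := hY.ae_mem_regularJumps
    ((map_mem_probHalfLine_iff (hY.measurable_wait 0).aemeasurable).1 hΦ.2.1)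
    ((hΦ.measure_Ioi_eq_zero_iff one_pos (h.pos hub one_pos)).not.2 hν)
  exact ⟨_, inferInstance, P₀.prod (Measure.infinitePi fun _ => η), inferInstance, _, _, _,
    hD.isIIDJumps_walkStep hDm measurable_fst hG, (map_walkStep measurable_fst 0).trans hη,
    ⟨fun t => (hT t).comp measurable_fst, _, hD.comp_measurePreserving measurePreserving_fst,
      ae_of_all _ fun _ _ => rfl⟩,
    indepFun_prod (measurable_pi_lambda _ hT)
      (measurable_pi_lambda _ fun k => (measurable_pi_apply k).fst.coe_nnreal_real),
    hD.sameJ1Law_timeChange_walk hDm hreg measurable_fst hG (hη.symm ▸ hν) hY hJV hlaw⟩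

end Direct

end CTRW

theorem mainTheorem4_general {E : Type*} [NormedAddCommGroup E] [MeasurableSpace E] [BorelSpace E]
    [SecondCountableTopology E] [StandardBorelSpace E] (ψ : ℝ → ℝ)
    (hψ : ψ ∈ CTRW.unboundedBernstein)
    {Ω : Type*} [MeasurableSpace Ω] (P : Measure Ω) [IsProbabilityMeasure P]
    (J : ℕ → Ω → E) (V : ℕ → Ω → ℝ) (hY : CTRW.IsIIDJumps J V P) :
    (P.map (V 0) ∈ CTRW.layerImage id ψ →
      ∃ (Ω' : Type) (_ : MeasurableSpace Ω') (P' : Measure Ω') (_ : IsProbabilityMeasure P')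
        (J' : ℕ → Ω' → E) (W : ℕ → Ω' → ℝ) (T : ℝ≥0 → Ω' → ℝ≥0),
        CTRW.IsIIDJumps J' W P' ∧
        P'.map (W 0) ∈ CTRW.layer id ∧
        CTRW.IsInverseSubordinator ψ T P' ∧
        IndepFun (fun ω t => T t ω) (fun ω k => W k ω) P' ∧
        CTRW.SameJ1Law (CTRW.ctrw J V) P (CTRW.timeChange (CTRW.ctrw J' W) T) P') ∧
    (∀ (b : ℝ) (μ : Measure ℝ), CTRW.HasCharacteristics ψ 0 b μ →
      (CTRW.SubHomogeneous μ ∨ CTRW.SuperHomogeneous μ) →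
      P.map (V 0) ∈ CTRW.layer ψ →
      (∀ᵐ ω ∂P, J 0 ω ≠ 0) →
      ∀ {Ω' : Type*} [MeasurableSpace Ω'] (P' : Measure Ω') [IsProbabilityMeasure P']
        (J' : ℕ → Ω' → E) (W : ℕ → Ω' → ℝ) (T : ℝ≥0 → Ω' → ℝ≥0),
        CTRW.IsIIDJumps J' W P' →
        (∀ᵐ ω ∂P', J' 0 ω ≠ 0) →
        (∀ᵐ ω ∂P', 0 < W 0 ω) →
        CTRW.IsInverseSubordinator ψ T P' →
        IndepFun (fun ω t => T t ω) (fun ω k => W k ω) P' →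
        CTRW.SameJ1Law (CTRW.ctrw J V) P (CTRW.timeChange (CTRW.ctrw J' W) T) P' →
        P.map (V 0) ∈ CTRW.layerImage id ψ ∧ P'.map (W 0) ∈ CTRW.layer id) := by
  obtain ⟨⟨b₀, μ₀, h₀⟩, hub⟩ := hψ
  refine ⟨?_, ?_⟩
  · rintro ⟨ν, hν, hΦ⟩
    obtain ⟨Ω', _, P', _, J', W, T, hX, hW, hT, hind, hlaw⟩ :=
      CTRW.exists_sameJ1Law_timeChange h₀ hub hY hΦ (CTRW.measure_Ioi_ne_zero_of_mem_layer hν)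
    exact ⟨Ω', _, P', inferInstance, J', W, T, hX, hW ▸ hν, hT, hind, hlaw⟩
  · intro b μ h hμ hV hJ Ω' _ P' _ J' W T hX hJ' hW hT hind hlaw
    exact CTRW.mem_layer_of_sameJ1Law h hub hμ hY hV hJ hX hJ' hW hT hind hlaw

theorem mainTheorem4 (d : ℕ) (ψ : ℝ → ℝ) (hψ : ψ ∈ CTRW.unboundedBernstein)
    {Ω : Type*} [MeasurableSpace Ω] (P : Measure Ω) [IsProbabilityMeasure P]
    (J : ℕ → Ω → EuclideanSpace ℝ (Fin d)) (V : ℕ → Ω → ℝ) (hY : CTRW.IsIIDJumps J V P) :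
    (P.map (V 0) ∈ CTRW.layerImage id ψ →
      ∃ (Ω' : Type) (_ : MeasurableSpace Ω') (P' : Measure Ω') (_ : IsProbabilityMeasure P')
        (J' : ℕ → Ω' → EuclideanSpace ℝ (Fin d)) (W : ℕ → Ω' → ℝ) (T : ℝ≥0 → Ω' → ℝ≥0),
        CTRW.IsIIDJumps J' W P' ∧
        P'.map (W 0) ∈ CTRW.layer id ∧
        CTRW.IsInverseSubordinator ψ T P' ∧
        IndepFun (fun ω t => T t ω) (fun ω k => W k ω) P' ∧
        CTRW.SameJ1Law (CTRW.ctrw J V) P (CTRW.timeChange (CTRW.ctrw J' W) T) P') ∧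
    (∀ (b : ℝ) (μ : Measure ℝ), CTRW.HasCharacteristics ψ 0 b μ →
      (CTRW.SubHomogeneous μ ∨ CTRW.SuperHomogeneous μ) →
      P.map (V 0) ∈ CTRW.layer ψ →
      (∀ᵐ ω ∂P, J 0 ω ≠ 0) →
      ∀ {Ω' : Type*} [MeasurableSpace Ω'] (P' : Measure Ω') [IsProbabilityMeasure P']
        (J' : ℕ → Ω' → EuclideanSpace ℝ (Fin d)) (W : ℕ → Ω' → ℝ) (T : ℝ≥0 → Ω' → ℝ≥0),
        CTRW.IsIIDJumps J' W P' →
        (∀ᵐ ω ∂P', J' 0 ω ≠ 0) →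
        (∀ᵐ ω ∂P', 0 < W 0 ω) →
        CTRW.IsInverseSubordinator ψ T P' →
        IndepFun (fun ω t => T t ω) (fun ω k => W k ω) P' →
        CTRW.SameJ1Law (CTRW.ctrw J V) P (CTRW.timeChange (CTRW.ctrw J' W) T) P' →
        P.map (V 0) ∈ CTRW.layerImage id ψ ∧ P'.map (W 0) ∈ CTRW.layer id) :=
  mainTheorem4_general ψ hψ P J V hY
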